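/- **Notation.** Let $s_1,s_3\in\mathbb C\setminus\{0\}$ with $1-s_1s_3\in\mathbb C\setminus(-\infty,0]$, and put $\nu=-\frac1{2\pi i}\log(1-s_1s_3)$, $h_1=\frac{\sqrt{2\pi}}{\Gamma(-\nu)}e^{i\pi\nu}$, $h^2=-h_1/s_3$. Let $D_\mu$ denote the parabolic cylinder function. For $\operatorname{Re}t>0$ and $|\operatorname{Re}z|<\frac12$ put $\zeta(z,t)=2\sqrt{-\tfrac{4it}{3}z^3+itz-\tfrac{it}{3}}$ (the branch, analytic for $\operatorname{Re} z>-1$, with $\arg\zeta=\frac{3\pi}4$ for $t>0$, $z>\frac12$), $\xi(z,t)=\zeta(-z,t)$, $m(z)=\frac{z+1/2}{z-1/2}$, and $$\mathcal A=\zeta^{\nu}\xi^{\nu}e^{\frac{2i}{3}t}\left(e^{-\pi i\nu}D_{-\nu}(i\zeta)D_{-\nu}(i\xi)+\nu^2h^{-4}e^{2\pi i\nu}D_{\nu-1}(\zeta)D_{\nu-1}(\xi)\right),$$ $$\mathcal B=m^{2\nu}\zeta^{\nu}\xi^{-\nu}\left(ih^2e^{-\pi i\nu}D_{-\nu}(i\zeta)D_{-\nu-1}(i\xi)+\nu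 h^{-2}e^{2\pi i\nu}D_{\nu-1}(\zeta)D_{\nu}(\xi)\right),\qquad \mathcal C(z,t)=\mathcal B(-z,t).$$ Here $(\zeta m)^\nu$ is the analytic branch on $\operatorname{Re}z>-\frac12$ with $\arg(\zeta m)=\frac{3\pi}4$ for $t>0$, $z>\frac12$; $(\xi m^{-1})^{\nu}$ is its value at $-z$; $\zeta^\nu\xi^\nu=(\zeta m)^\nu(\xi m^{-1})^\nu$ and $m^{2\nu}\zeta^\nu\xi^{-\nu}=(\zeta m)^\nu(\xi m^{-1})^{-\nu}$. A prime is $\partial_z$ (or $\partial_w$), a dot is $\partial_t$. Let $0<c_1,c_3<\frac12$, and let $l_1,l_2,l_3$ be the lines $\operatorname{Re}z=c_1$, $\operatorname{Re}z=0$, $\operatorname{Re}z=-c_3$, all oriented upwards. Fix $t$ with $\operatorname{Re}t>0$ such that $\mathcal A(\cdot,t)$ has no zero in the strip $-c_3\le\operatorname{Re}z\le c_1$. **The LDU problem.** Let $Y$ (a $2\times 2$ matrix function, with pieces $Y_1,\dots,Y_4$ from right to left, each analytic up to the boundary of its region) satisfy $Y_{i+1}=Y_iF_i$ on $l_i$ and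 $Y(z)\to\mathbb 1$ as $z\to\infty$, where $$F_1=\begin{pmatrix}1&0\\ \mathcal C/\mathcal A&1\end{pmatrix},\quad F_2=\begin{pmatrix}\mathcal A&0\\0&1/\mathcal A\end{pmatrix},\quad F_3=\begin{pmatrix}1&\mathcal B/\mathcal A\\0&1\end{pmatrix}.$$ **The LU problem.** Let $\varphi(z,t)=\exp\int_{i\mathbb R}\frac{\log\mathcal A(w,t)}{w-z}\frac{dw}{2\pi i}$, with the continuous branch of $\log\mathcal A$ on $i\mathbb R$ that vanishes at $\pm i\infty$; then $\varphi_+=\varphi_-\mathcal A$ on $i\mathbb R$, where $+$ is the left side. Put $\widetilde Y_i=Y_i\varphi^{-\sigma_3}$ and $$\widetilde F_1=\begin{pmatrix}1&0\\ \frac{\mathcal C}{\mathcal A}\varphi^{-2}&1\end{pmatrix},\qquad \widetilde F_3=\begin{pmatrix}1&\frac{\mathcal B}{\mathcal A}\varphi^{2}\\0&1\end{pmatrix}.$$ **Proposition.** $\widetilde Y$ has no jump on $l_2$ and solves the Riemann–Hilbert problem on $l_1\cup l_3$ with $\widetilde Y_{2}=\widetilde Y_1\widetilde F_1$ on $l_1$,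 $\widetilde Y_{4}=\widetilde Y_3\widetilde F_3$ on $l_3$, $\widetilde Y_2=\widetilde Y_3$, $\widetilde Y\to\mathbb 1$ at infinity. The integrals in the Malgrange forms $$\partial_t\log\tau_{LDU}:=\sum_{i=1}^3\int_{l_i}\operatorname{Tr}\left[Y_i^{-1}Y_i'\dot F_iF_i^{-1}\right]\frac{dz}{2\pi i},\qquad \partial_t\log\tau_{LU}:=\sum_{i=1,3}\int_{l_i}\operatorname{Tr}\left[\widetilde Y_i^{-1}\widetilde Y_i'\dot{\widetilde F}_i\widetilde F_i^{-1}\right]\frac{dz}{2\pi i}$$ converge absolutely, and for every $0<\varepsilon\le c_3$, with absolutely convergent integrals, $$\partial_t\log\tau_{LDU}=\partial_t\log\tau_{LU}+2\int_{i\mathbb R}\frac{\dot{\mathcal A}(z,t)}{\mathcal A(z,t)}\left(\int_{i\mathbb R-\varepsilon}\frac{\mathcal A'(w,t)}{\mathcal A(w,t)\,(w-z)}\frac{dw}{2\pi i}\right)\frac{dz}{2\pi i}.$$ (If all lines are oriented downwards instead, both Malgrange forms change sign and the formula holds with $z-w$ in place of $w-z$.) -/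

import Mathlib

open Complex MeasureTheory Filter Topology

noncomputable section

namespace PainleveTwo

/-! ### Parabolic cylinder functions -/

/-- Kummer's confluent hypergeometric function `M(a, b, z) = ∑ (a)ₙ / (b)ₙ zⁿ / n!`. -/
def kummerM (a b z : ℂ) : ℂ :=
  ∑' n : ℕ, (ascPochhammer ℂ n).eval a / (ascPochhammer ℂ n).eval b * z ^ n / (n.factorial : ℂ)

/-- The parabolic cylinder function `D_ν(z)`, entire in `z`. At the poles of a Gamma function
the convention `Γ = 0`, `x / 0 = 0` gives the right value `1 / Γ = 0`. -/
def pcfD (ν z : ℂ) : ℂ :=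
  (2 : ℂ) ^ (ν / 2) * exp (-z ^ 2 / 4) *
    ((Real.sqrt Real.pi : ℂ) / Gamma ((1 - ν) / 2) * kummerM (-ν / 2) (1 / 2) (z ^ 2 / 2)
      - (Real.sqrt (2 * Real.pi) : ℂ) * z / Gamma (-ν / 2) *
          kummerM ((1 - ν) / 2) (3 / 2) (z ^ 2 / 2))

/-! ### The entries of the jump matrix on the imaginary axis -/

/-- `ν = -(1 / 2πi) log (1 - s₁ s₃)`. -/
def nu (s₁ s₃ : ℂ) : ℂ := -(1 / (2 * Real.pi * I)) * log (1 - s₁ * s₃)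

/-- `h² = -h₁ / s₃` with `h₁ = √(2π) e^{iπν} / Γ(-ν)`. Only even powers of `h` are ever used. -/
def hSq (s₁ s₃ : ℂ) : ℂ :=
  -((Real.sqrt (2 * Real.pi) : ℂ) / Gamma (-nu s₁ s₃) * exp (I * Real.pi * nu s₁ s₃)) / s₃

/-- The local variable `ζ(z,t) = 2 √(-(4it/3) z³ + itz - it/3)`: the branch that is analytic for
`Re z > -1`, with `arg ζ = 3π/4` for `t > 0`, `z > 1/2` (see `zeta_sq`). -/
def zeta (z t : ℂ) : ℂ :=
  ((4 / Real.sqrt 3 : ℝ) : ℂ) * exp (3 * Real.pi * I / 4) * exp (log t / 2) *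
    (z - 1 / 2) * exp (log (z + 1) / 2)

theorem zeta_sq (z t : ℂ) (ht : t ≠ 0) (hz : z ≠ -1) :
    zeta z t ^ 2 = 4 * (-(4 * I * t / 3) * z ^ 3 + I * t * z - I * t / 3) := by
  have h1 : exp (log t / 2) ^ 2 = t := by
    rw [← exp_nat_mul]; push_cast; rw [mul_div_cancel₀ _ two_ne_zero, exp_log ht]
  have hz' : z + 1 ≠ 0 := fun h => hz (eq_neg_of_add_eq_zero_left h)
  have h2 : exp (log (z + 1) / 2) ^ 2 = z + 1 := by
    rw [← exp_nat_mul]; push_cast; rw [mul_div_cancel₀ _ two_ne_zero, exp_log hz']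
  have h3 : exp (3 * Real.pi * I / 4) ^ 2 = -I := by
    rw [← exp_nat_mul]
    have : ((2 : ℕ) : ℂ) * (3 * Real.pi * I / 4) = Real.pi * I + Real.pi / 2 * I := by
      push_cast; ring
    rw [this, exp_add, exp_pi_mul_I, exp_pi_div_two_mul_I]; ring
  have h4 : ((4 / Real.sqrt 3 : ℝ) : ℂ) ^ 2 = 16 / 3 := by
    rw [← ofReal_pow, div_pow, Real.sq_sqrt (by norm_num)]; norm_num
  unfold zeta
  rw [mul_pow, mul_pow, mul_pow, mul_pow, h1, h2, h3, h4]
  ring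

/-- `ξ(z,t) = ζ(-z,t)`. -/
def xi (z t : ℂ) : ℂ := zeta (-z) t

/-- The logarithm of `ζ(z,t) (z + 1/2) / (z - 1/2)`, analytic for `Re z > -1/2`
(see `exp_logRight`). Powers of `ζ`, of `ξ` and of `m = (z + 1/2) / (z - 1/2)` occur in the jump
matrix only through `(ζ m)^ν = exp (ν logRight z t)` and `(ξ m⁻¹)^ν = exp (ν logRight (-z) t)`,
which are analytic in the strip `|Re z| < 1/2`, where `m^ν` and `ζ^ν` alone are not. -/
def logRight (z t : ℂ) : ℂ :=
  (Real.log (4 / Real.sqrt 3) : ℂ) + 3 * Real.pi * I / 4 + log t / 2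
    + log (z + 1 / 2) + log (z + 1) / 2

theorem exp_logRight (z t : ℂ) (hz : z ≠ -1 / 2) :
    exp (logRight z t) * (z - 1 / 2) = zeta z t * (z + 1 / 2) := by
  have hz' : z + 1 / 2 ≠ 0 := fun h => hz (by linear_combination h)
  have hp : (0 : ℝ) < 4 / Real.sqrt 3 := by positivity
  unfold logRight zeta
  rw [exp_add, exp_add, exp_add, exp_add, exp_log hz', ← ofReal_exp, Real.exp_log hp]
  ring

/-- The `(1,1)` entry of the jump matrix:
`A = ζ^ν ξ^ν e^{2it/3} (e^{-πiν} D_{-ν}(iζ) D_{-ν}(iξ) + ν² h⁻⁴ e^{2πiν} D_{ν-1}(ζ) D_{ν-1}(ξ))`. -/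
def jumpA (s₁ s₃ z t : ℂ) : ℂ :=
  exp (nu s₁ s₃ * (logRight z t + logRight (-z) t)) * exp (2 * I / 3 * t) *
    (exp (-Real.pi * I * nu s₁ s₃) *
        pcfD (-nu s₁ s₃) (I * zeta z t) * pcfD (-nu s₁ s₃) (I * xi z t)
      + nu s₁ s₃ ^ 2 / hSq s₁ s₃ ^ 2 * exp (2 * Real.pi * I * nu s₁ s₃) *
        pcfD (nu s₁ s₃ - 1) (zeta z t) * pcfD (nu s₁ s₃ - 1) (xi z t))

/-- The `(1,2)` entry of the jump matrix: `B = m^{2ν} ζ^ν ξ^{-ν}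
(i h² e^{-πiν} D_{-ν}(iζ) D_{-ν-1}(iξ) + ν h⁻² e^{2πiν} D_{ν-1}(ζ) D_ν(ξ))`. -/
def jumpB (s₁ s₃ z t : ℂ) : ℂ :=
  exp (nu s₁ s₃ * (logRight z t - logRight (-z) t)) *
    (I * hSq s₁ s₃ * exp (-Real.pi * I * nu s₁ s₃) *
        pcfD (-nu s₁ s₃) (I * zeta z t) * pcfD (-nu s₁ s₃ - 1) (I * xi z t)
      + nu s₁ s₃ / hSq s₁ s₃ * exp (2 * Real.pi * I * nu s₁ s₃) *
        pcfD (nu s₁ s₃ - 1) (zeta z t) * pcfD (nu s₁ s₃) (xi z t))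

/-- The `(2,1)` entry of the jump matrix: `C(z,t) = B(-z,t)`. -/
def jumpC (s₁ s₃ z t : ℂ) : ℂ := jumpB s₁ s₃ (-z) t

/-! ### Vertical lines and Malgrange forms -/

/-- Matrices of size two. -/
abbrev Mat2 := Matrix (Fin 2) (Fin 2) ℂ

/-- Convergence of the integral of `f` over the line `Re z = c`. -/
def LineIntegrable (c : ℝ) (f : ℂ → ℂ) : Prop :=
  Integrable (fun y : ℝ => f (c + y * I))

/-- `∫ f(z) dz / 2πi` over the line `Re z = c`, oriented upwards. -/
def lineInt (c : ℝ) (f : ℂ → ℂ) : ℂ :=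
  1 / (2 * Real.pi * I) * ∫ y : ℝ, f (c + y * I) * I

/-- Entrywise analyticity in a neighbourhood of every point of `S`. -/
def AnalyticMat (Y : ℂ → Mat2) (S : Set ℂ) : Prop :=
  ∀ i j, AnalyticOnNhd ℂ (fun z => Y z i j) S

/-- Entrywise complex derivative. -/
def derivMat (Y : ℂ → Mat2) (z : ℂ) : Mat2 :=
  Matrix.of fun i j => deriv (fun w => Y w i j) z

/-- `Tr [Y⁻¹ Y' Ḟ F⁻¹]` at the point `z` and the time `t`; the prime is `∂/∂z`, the dot `∂/∂t`. -/
def malgrangeDensity (Y : ℂ → Mat2) (F : ℂ → ℂ → Mat2) (t z : ℂ) : ℂ :=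
  ((Y z)⁻¹ * derivMat Y z * derivMat (fun τ => F z τ) t * (F z t)⁻¹).trace

/-- `Y(z) → 1` as `z → ∞` in `S`. -/
def TendsToOneAtInfinity (Y : ℂ → Mat2) (S : Set ℂ) : Prop :=
  Tendsto Y (Bornology.cobounded ℂ ⊓ 𝓟 S) (𝓝 1)

/-! ### The problem with lower triangular, diagonal and upper triangular jumps -/

/-- The lower triangular factor, on `l₁`. -/
def F1 (s₁ s₃ z t : ℂ) : Mat2 := !![1, 0; jumpC s₁ s₃ z t / jumpA s₁ s₃ z t, 1]

/-- The diagonal factor, on `l₂`. -/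
def F2 (s₁ s₃ z t : ℂ) : Mat2 := !![jumpA s₁ s₃ z t, 0; 0, 1 / jumpA s₁ s₃ z t]

/-- The upper triangular factor, on `l₃`. -/
def F3 (s₁ s₃ z t : ℂ) : Mat2 := !![1, jumpB s₁ s₃ z t / jumpA s₁ s₃ z t; 0, 1]

/-- `Y₁, Y₂, Y₃, Y₄` (from right to left) solve, at the time `t`, the Riemann–Hilbert problem on
the lines `l₁ = {Re z = c₁}`, `l₂ = {Re z = 0}`, `l₃ = {Re z = -c₃}` with jumps
`Y_{i+1} = Y_i F_i` on `l_i`. -/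
structure SolvesLDU (s₁ s₃ : ℂ) (c₁ c₃ : ℝ) (t : ℂ) (Y₁ Y₂ Y₃ Y₄ : ℂ → Mat2) : Prop where
  analytic₁ : AnalyticMat Y₁ {z | c₁ ≤ z.re}
  analytic₂ : AnalyticMat Y₂ {z | 0 ≤ z.re ∧ z.re ≤ c₁}
  analytic₃ : AnalyticMat Y₃ {z | -c₃ ≤ z.re ∧ z.re ≤ 0}
  analytic₄ : AnalyticMat Y₄ {z | z.re ≤ -c₃}
  jump₁ : ∀ z : ℂ, z.re = c₁ → Y₂ z = Y₁ z * F1 s₁ s₃ z t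
  jump₂ : ∀ z : ℂ, z.re = 0 → Y₃ z = Y₂ z * F2 s₁ s₃ z t
  jump₃ : ∀ z : ℂ, z.re = -c₃ → Y₄ z = Y₃ z * F3 s₁ s₃ z t
  infinity₁ : TendsToOneAtInfinity Y₁ {z | c₁ ≤ z.re}
  infinity₂ : TendsToOneAtInfinity Y₂ {z | 0 ≤ z.re ∧ z.re ≤ c₁}
  infinity₃ : TendsToOneAtInfinity Y₃ {z | -c₃ ≤ z.re ∧ z.re ≤ 0}
  infinity₄ : TendsToOneAtInfinity Y₄ {z | z.re ≤ -c₃}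

/-- The Malgrange form `∂ₜ log τ_LDU`. -/
def malgrangeLDU (s₁ s₃ : ℂ) (c₁ c₃ : ℝ) (t : ℂ) (Y₁ Y₂ Y₃ : ℂ → Mat2) : ℂ :=
  lineInt c₁ (malgrangeDensity Y₁ (F1 s₁ s₃) t)
    + lineInt 0 (malgrangeDensity Y₂ (F2 s₁ s₃) t)
    + lineInt (-c₃) (malgrangeDensity Y₃ (F3 s₁ s₃) t)

/-! ### Conjugation by `φ^{σ₃}` -/

/-- `L` is a continuous logarithm of `a` on the real line that vanishes at `±∞`. For given `a`
there is at most one. -/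
def IsLogBranch (a L : ℝ → ℂ) : Prop :=
  Continuous L ∧ (∀ y, exp (L y) = a y) ∧ Tendsto L (cocompact ℝ) (𝓝 0)

/-- The continuous logarithm of `a` that vanishes at `±∞` (some function if there is none). -/
def logBranch (a : ℝ → ℂ) : ℝ → ℂ := Classical.epsilon (IsLogBranch a)

/-- `φ(z,t) = exp ∫_{iℝ} log A(w,t) / (w - z) dw / 2πi`, for `z` off the imaginary axis. With the
imaginary axis oriented upwards, its boundary values satisfy `φ₊ = φ₋ A`, where `+` is the left
side. -/
def phi (s₁ s₃ z t : ℂ) : ℂ :=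
  exp (1 / (2 * Real.pi * I) *
    ∫ y : ℝ, logBranch (fun u : ℝ => jumpA s₁ s₃ (u * I) t) y / (y * I - z) * I)

/-- `φ^{-σ₃}`. -/
def phiConj (s₁ s₃ z t : ℂ) : Mat2 := !![(phi s₁ s₃ z t)⁻¹, 0; 0, phi s₁ s₃ z t]

/-- The conjugated lower triangular jump `φ^{σ₃} F₁ φ^{-σ₃}`, on `l₁`. -/
def Ft1 (s₁ s₃ z t : ℂ) : Mat2 :=
  !![1, 0; jumpC s₁ s₃ z t / jumpA s₁ s₃ z t * ((phi s₁ s₃ z t) ^ 2)⁻¹, 1]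

/-- The conjugated upper triangular jump `φ^{σ₃} F₃ φ^{-σ₃}`, on `l₃`. -/
def Ft3 (s₁ s₃ z t : ℂ) : Mat2 :=
  !![1, jumpB s₁ s₃ z t / jumpA s₁ s₃ z t * (phi s₁ s₃ z t) ^ 2; 0, 1]

/-- `W₁, W₂ = W₃, W₄` (from right to left) solve, at the time `t`, the Riemann–Hilbert problem on
the lines `l₁ = {Re z = c₁}`, `l₃ = {Re z = -c₃}` with the conjugated triangular jumps. -/
structure SolvesLU (s₁ s₃ : ℂ) (c₁ c₃ : ℝ) (t : ℂ) (W₁ W₂ W₄ : ℂ → Mat2) : Prop where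
  analytic₁ : AnalyticMat W₁ {z | c₁ ≤ z.re}
  analytic₂ : AnalyticMat W₂ {z | -c₃ ≤ z.re ∧ z.re ≤ c₁}
  analytic₄ : AnalyticMat W₄ {z | z.re ≤ -c₃}
  jump₁ : ∀ z : ℂ, z.re = c₁ → W₂ z = W₁ z * Ft1 s₁ s₃ z t
  jump₃ : ∀ z : ℂ, z.re = -c₃ → W₄ z = W₂ z * Ft3 s₁ s₃ z t
  infinity₁ : TendsToOneAtInfinity W₁ {z | c₁ ≤ z.re}
  infinity₂ : TendsToOneAtInfinity W₂ {z | -c₃ ≤ z.re ∧ z.re ≤ c₁}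
  infinity₄ : TendsToOneAtInfinity W₄ {z | z.re ≤ -c₃}

/-- The Malgrange form `∂ₜ log τ_LU`. -/
def malgrangeLU (s₁ s₃ : ℂ) (c₁ c₃ : ℝ) (t : ℂ) (W₁ W₃ : ℂ → Mat2) : ℂ :=
  lineInt c₁ (malgrangeDensity W₁ (Ft1 s₁ s₃) t)
    + lineInt (-c₃) (malgrangeDensity W₃ (Ft3 s₁ s₃) t)

/-- `w ↦ A'(w,t) / (A(w,t) (w - z))`. -/
def innerDensity (s₁ s₃ t z w : ℂ) : ℂ :=
  deriv (fun v => jumpA s₁ s₃ v t) w / (jumpA s₁ s₃ w t * (w - z))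

/-- `z ↦ Ȧ(z,t) / A(z,t) · ∫_{iℝ-ε} A'(w,t) / (A(w,t) (w - z)) dw / 2πi`. -/
def outerDensity (s₁ s₃ : ℂ) (ε : ℝ) (t z : ℂ) : ℂ :=
  deriv (fun τ => jumpA s₁ s₃ z τ) t / jumpA s₁ s₃ z t * lineInt (-ε) (innerDensity s₁ s₃ t z)

end PainleveTwo

end

/-!
The two Malgrange forms differ because conjugating by `φ^{-σ₃}` removes the jump on the imaginary
axis at the price of a time dependence hidden in `φ`. Write `ψ = ∂ₜ log φ` (`dotLogPhi`) and, on the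
`i`-th region, `Tᵢ = Tr (Yᵢ⁻¹ Yᵢ' σ₃)` (`diagPart`). A computation with triangular matrices shows
that on `l₁` and `l₃` the LU density is the LDU density plus or minus `ψ` times the jump of `T`
(`malgrangeDensity_Ft1`, `malgrangeDensity_Ft3`), while on the axis the LDU density is `(Ȧ/A) T₂`
and `T₃ = T₂ + 2 A'/A` (`diagPart_jump`). Since `ψ` is the Cauchy transform of `Ȧ/A` along the axis
(`hasDerivAt_phi`), Fubini's theorem (`lineInt_mul_cauchyTr`) moves the transform onto the `Tᵢ`.
The transforms of `T₁` over `l₁` and of `T₄` over `l₃` at points of the axis vanish, because the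
contours close in a half plane; those of `T₂` and `T₃` are brought to the axis by Cauchy's formula
in a strip. What is left over is the double integral of `Ȧ/A` against `A'/A` (`malgrangeLDU_eq`).
The inner line may be placed at any `-ε` with `0 < ε ≤ c₃` by Cauchy's theorem
(`Admissible.outer_integral`).

All of this needs decay at infinity, from which the convergence of the integrals, their interchange
and the closing of contours follow.

* *The jump matrix.* Rotating the contour in an integral representation of the parabolic cylinder
  function gives its leading asymptotics in sectors (`norm_pcfE_sub_le`). Since
  `ζ² + ξ² = -8it/3` (`zeta_sq_add_xi_sq`), the exponential factors `e^{∓ζ²/4}` and `e^{∓ξ²/4}` of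
  the products in `A` and `B` multiply to a function of `t` alone, and only powers of `z` remain.
  This gives `A - 1, B, C = O(|z|^{-δ})` with `δ = 1 - 2 |Re ν|` (`decay`) in
  sectors around the axis, locally uniformly in `t` (`exists_jump_bounds`); `δ > 0` because
  `1 - s₁ s₃` lies off the negative axis. Because the estimates hold in sectors, Cauchy's
  inequality in discs of radius proportional to `|z|` gains a factor `1/|z|` for the `z`-derivatives,
  and because they are locally uniform in `t` it also bounds the time derivatives.
* *The function `φ`.* As `A` is even, a continuous logarithm of `A` in the strip that vanishes at
  one end of the axis also vanishes at the other (`exists_log`). Shifting the contour continues `φ`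
  analytically from the right half plane across the axis (`exists_phi_right`).
* *The solutions `Y`.* By Liouville's theorem `det Yᵢ = 1` (`det_eq_one`). The jump relations extend
  `Yᵢ` boundedly to sectors around the ends of the lines (`exists_extension`), so that
  `Yᵢ' = O(1/|z|)` by Cauchy's inequality (`SolvesLDU.decaysOn_deriv`).
-/

noncomputable section

namespace PainleveTwo

/-! ### Kummer's function -/

theorem ascPochhammer_eval_succ_right (a : ℂ) (n : ℕ) :
    (ascPochhammer ℂ (n + 1)).eval a = (ascPochhammer ℂ n).eval a * (a + n) := by
  rw [ascPochhammer_succ_right]; simp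

theorem ascPochhammer_eval_succ_left (a : ℂ) (n : ℕ) :
    (ascPochhammer ℂ (n + 1)).eval a = a * (ascPochhammer ℂ n).eval (a + 1) := by
  rw [ascPochhammer_succ_left]; simp

/-- The two recursions for Pochhammer symbols combined. -/
theorem ascPochhammer_eval_shift (a : ℂ) (n : ℕ) :
    a * (ascPochhammer ℂ n).eval (a + 1) = (ascPochhammer ℂ n).eval a * (a + n) := by
  rw [← ascPochhammer_eval_succ_left, ascPochhammer_eval_succ_right]

theorem add_natCast_ne_zero_of_re_pos {b : ℂ} (hb : 0 < b.re) (n : ℕ) : b + n ≠ 0 := by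
  intro h
  have := congrArg Complex.re h
  simp at this
  have : (0 : ℝ) ≤ n := n.cast_nonneg
  linarith

theorem ascPochhammer_eval_ne_zero {b : ℂ} (hb : 0 < b.re) (n : ℕ) :
    (ascPochhammer ℂ n).eval b ≠ 0 := by
  induction n with
  | zero => simp
  | succ n ih =>
    rw [ascPochhammer_eval_succ_right]
    exact mul_ne_zero ih (add_natCast_ne_zero_of_re_pos hb n)

theorem norm_ascPochhammer_div_le (a : ℂ) {b : ℂ} (hb : 0 < b.re) (n : ℕ) :
    ‖(ascPochhammer ℂ n).eval a / (ascPochhammer ℂ n).eval b‖ ≤ (‖a‖ / b.re + 1) ^ n := by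
  induction n with
  | zero => simp
  | succ n ih =>
    rw [ascPochhammer_eval_succ_right, ascPochhammer_eval_succ_right, mul_div_mul_comm, norm_mul,
      pow_succ]
    refine mul_le_mul ih ?_ (norm_nonneg _) (by positivity)
    rw [norm_div, div_le_iff₀ (norm_pos_iff.2 (add_natCast_ne_zero_of_re_pos hb n))]
    have h1 : b.re + n ≤ ‖b + n‖ := by
      have := Complex.re_le_norm (b + n)
      simpa using this
    have h2 : ‖a + n‖ ≤ ‖a‖ + n := by
      simpa using norm_add_le a (n : ℂ)
    have h3 : ‖a‖ + n ≤ (‖a‖ / b.re + 1) * (b.re + n) := by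
      have : ‖a‖ / b.re * b.re = ‖a‖ := div_mul_cancel₀ _ hb.ne'
      have h4 : 0 ≤ ‖a‖ / b.re * n := by positivity
      nlinarith
    calc _ ≤ _ := h2
      _ ≤ _ := h3
      _ ≤ _ := by gcongr

/-- The general term of Kummer's series. -/
def kummerTerm (a b z : ℂ) (n : ℕ) : ℂ :=
  (ascPochhammer ℂ n).eval a / (ascPochhammer ℂ n).eval b * z ^ n / (n.factorial : ℂ)

theorem norm_kummerTerm_le (a : ℂ) {b : ℂ} (hb : 0 < b.re) (z : ℂ) (n : ℕ) :
    ‖kummerTerm a b z n‖ ≤ ((‖a‖ / b.re + 1) * ‖z‖) ^ n / n.factorial := by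
  rw [kummerTerm, norm_div, norm_mul, norm_pow, mul_pow, Complex.norm_natCast]
  gcongr
  exact norm_ascPochhammer_div_le a hb n

theorem summable_kummerTerm (a : ℂ) {b : ℂ} (hb : 0 < b.re) (z : ℂ) :
    Summable (kummerTerm a b z) :=
  Summable.of_norm_bounded (Real.summable_pow_div_factorial _) (norm_kummerTerm_le a hb z)

theorem hasSum_kummerM (a : ℂ) {b : ℂ} (hb : 0 < b.re) (z : ℂ) :
    HasSum (kummerTerm a b z) (kummerM a b z) :=
  (summable_kummerTerm a hb z).hasSum

theorem differentiable_kummerM (a : ℂ) {b : ℂ} (hb : 0 < b.re) :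
    Differentiable ℂ (kummerM a b) := by
  intro z
  have h : DifferentiableOn ℂ (fun w => ∑' n, kummerTerm a b w n) (Metric.ball 0 (‖z‖ + 1)) := by
    refine differentiableOn_tsum_of_summable_norm
      (Real.summable_pow_div_factorial ((‖a‖ / b.re + 1) * (‖z‖ + 1))) (fun n => ?_)
      Metric.isOpen_ball (fun n w hw => ?_)
    · unfold kummerTerm; fun_prop
    · refine (norm_kummerTerm_le a hb w n).trans ?_
      have : ‖w‖ ≤ ‖z‖ + 1 := by simpa using (mem_ball_zero_iff.1 hw).le
      gcongr
  exact (h.differentiableAt (Metric.isOpen_ball.mem_nhds (by simp)))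

/-- The contiguous relation `b M(a, b) = b M(a + 1, b) - z M(a + 1, b + 1)`. -/
theorem kummerM_contiguous_left (a : ℂ) {b : ℂ} (hb : 0 < b.re) (z : ℂ) :
    b * kummerM a b z = b * kummerM (a + 1) b z - z * kummerM (a + 1) (b + 1) z := by
  have hb1 : 0 < (b + 1).re := by simp; linarith
  have hb0 : b ≠ 0 := fun h => by simp [h] at hb
  have h1 := (hasSum_kummerM a hb z).mul_left b
  have h2 := (hasSum_kummerM (a + 1) hb z).mul_left b
  have h3 : HasSum (fun n => b * kummerTerm (a + 1) b z n - b * kummerTerm a b z n)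
      (z * kummerM (a + 1) (b + 1) z) := by
    rw [← hasSum_nat_add_iff' 1]
    have h0 : b * kummerTerm (a + 1) b z 0 - b * kummerTerm a b z 0 = 0 := by simp [kummerTerm]
    rw [Finset.sum_range_one, h0, sub_zero]
    refine ((hasSum_kummerM (a + 1) hb1 z).mul_left z).congr_fun ?_
    intro n
    have e1 := ascPochhammer_eval_succ_left b n
    have e2 := ascPochhammer_eval_succ_right (a + 1) n
    have e3 := ascPochhammer_eval_succ_left a n
    have n1 := ascPochhammer_eval_ne_zero hb1 n
    have n2 : (n.factorial : ℂ) ≠ 0 := Nat.cast_ne_zero.2 n.factorial_ne_zero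
    have n3 : (n : ℂ) + 1 ≠ 0 := Nat.cast_add_one_ne_zero n
    simp only [kummerTerm]
    rw [e1, e2, e3, Nat.factorial_succ, pow_succ]
    push_cast
    field_simp
    ring
  have := (h2.sub h1).unique h3
  linear_combination -this

/-- The contiguous relation `(b - 1 - a) M(a, b) = (b - 1) M(a, b - 1) - a M(a + 1, b)`, written
with `b + 1` in place of `b`. -/
theorem kummerM_contiguous_right (a : ℂ) {b : ℂ} (hb : 0 < b.re) (z : ℂ) :
    (b - a) * kummerM a (b + 1) z = b * kummerM a b z - a * kummerM (a + 1) (b + 1) z := by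
  have hb1 : 0 < (b + 1).re := by simp; linarith
  have hb0 : b ≠ 0 := fun h => by simp [h] at hb
  have h1 := (hasSum_kummerM a hb1 z).mul_left (b - a)
  have h2 := (hasSum_kummerM a hb z).mul_left b
  have h3 := (hasSum_kummerM (a + 1) hb1 z).mul_left a
  refine h1.unique ((h2.sub h3).congr_fun fun n => ?_)
  have e1 := ascPochhammer_eval_shift b n
  have e2 := ascPochhammer_eval_shift a n
  have n1 := ascPochhammer_eval_ne_zero hb1 n
  have n2 := ascPochhammer_eval_ne_zero hb n
  have n3 := add_natCast_ne_zero_of_re_pos hb n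
  have n4 : (n.factorial : ℂ) ≠ 0 := Nat.cast_ne_zero.2 n.factorial_ne_zero
  have e3 : (ascPochhammer ℂ n).eval b = b * (ascPochhammer ℂ n).eval (b + 1) / (b + n) := by
    rw [e1]; field_simp
  simp only [kummerTerm]
  have e4 : a * ((ascPochhammer ℂ n).eval (a + 1) / (ascPochhammer ℂ n).eval (b + 1) * z ^ n
      / n.factorial) = (ascPochhammer ℂ n).eval a * (a + n) /
      (ascPochhammer ℂ n).eval (b + 1) * z ^ n / n.factorial := by
    rw [← e2]; ring
  rw [e4, e3]
  field_simp
  ring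

/-! ### The parabolic cylinder function without its exponential factor -/

/-- `e^{z²/4} D_p(z)`, which is asymptotic to `z ^ p` in the sector `|arg z| < 3π/4`. -/
def pcfE (p z : ℂ) : ℂ :=
  (2 : ℂ) ^ (p / 2) *
    ((Real.sqrt Real.pi : ℂ) / Gamma ((1 - p) / 2) * kummerM (-p / 2) (1 / 2) (z ^ 2 / 2)
      - (Real.sqrt (2 * Real.pi) : ℂ) * z / Gamma (-p / 2) *
          kummerM ((1 - p) / 2) (3 / 2) (z ^ 2 / 2))

theorem pcfD_eq_exp_mul_pcfE (p z : ℂ) : pcfD p z = exp (-z ^ 2 / 4) * pcfE p z := by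
  unfold pcfD pcfE; ring

theorem differentiable_pcfE (p : ℂ) : Differentiable ℂ (pcfE p) := by
  have h1 : Differentiable ℂ (kummerM (-p / 2) (1 / 2)) :=
    differentiable_kummerM _ (by norm_num)
  have h2 : Differentiable ℂ (kummerM ((1 - p) / 2) (3 / 2)) :=
    differentiable_kummerM _ (by norm_num)
  have hq : Differentiable ℂ (fun z : ℂ => z ^ 2 / 2) := by fun_prop
  have h3 := h1.comp hq
  have h4 := h2.comp hq
  unfold pcfE
  simp only [Function.comp_def] at h3 h4
  fun_prop

theorem differentiable_pcfD (p : ℂ) : Differentiable ℂ (pcfD p) := by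
  have h := differentiable_pcfE p
  have : pcfD p = fun z => exp (-z ^ 2 / 4) * pcfE p z := funext (pcfD_eq_exp_mul_pcfE p)
  rw [this]
  fun_prop

/-- The three-term recurrence in the order. -/
theorem pcfE_recurrence {p : ℂ} (hp0 : p ≠ 0) (hp1 : p ≠ 1) (z : ℂ) :
    pcfE p z = z * pcfE (p - 1) z - (p - 1) * pcfE (p - 2) z := by
  have hp1' : (1 - p) / 2 ≠ 0 := div_ne_zero (sub_ne_zero.2 hp1.symm) two_ne_zero
  have hp0' : -p / 2 ≠ 0 := div_ne_zero (neg_ne_zero.2 hp0) two_ne_zero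
  have hs : (Real.sqrt (2 * Real.pi) : ℂ) = Real.sqrt 2 * Real.sqrt Real.pi := by
    rw [Real.sqrt_mul (by norm_num)]; push_cast; rfl
  have hs2 : (Real.sqrt 2 : ℂ) * Real.sqrt 2 = 2 := by
    rw [← ofReal_mul, Real.mul_self_sqrt (by norm_num)]; norm_num
  have hs2' : (Real.sqrt 2 : ℂ) = (2 : ℂ) ^ ((1 : ℂ) / 2) := by
    rw [Real.sqrt_eq_rpow, ofReal_cpow (by norm_num)]; norm_num
  have e1 : (2 : ℂ) ^ (p / 2) = (2 : ℂ) ^ ((p - 1) / 2) * Real.sqrt 2 := by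
    rw [hs2', ← cpow_add _ _ two_ne_zero]; congr 1; ring
  have e2 : (2 : ℂ) ^ ((p - 2) / 2) * 2 = (2 : ℂ) ^ (p / 2) := by
    have : p / 2 = (p - 2) / 2 + 1 := by ring
    rw [this, cpow_add _ _ two_ne_zero, cpow_one]
  have g1 : Gamma ((1 - (p - 2)) / 2) = (1 - p) / 2 * Gamma ((1 - p) / 2) := by
    rw [← Gamma_add_one _ hp1']; congr 1; ring
  have g2 : Gamma (-(p - 2) / 2) = -p / 2 * Gamma (-p / 2) := by
    rw [← Gamma_add_one _ hp0']; congr 1; ring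
  have g3 : Gamma ((1 - (p - 1)) / 2) = -p / 2 * Gamma (-p / 2) := by
    rw [← Gamma_add_one _ hp0']; congr 1; ring
  have g4 : Gamma (-(p - 1) / 2) = Gamma ((1 - p) / 2) := by congr 1; ring
  set w := z ^ 2 / 2 with hw
  have k1 := kummerM_contiguous_left (-p / 2) (b := 1 / 2) (by norm_num) w
  have k2 := kummerM_contiguous_right ((1 - p) / 2) (b := 1 / 2) (by norm_num) w
  have a1 : -p / 2 + 1 = (1 - (p - 1)) / 2 := by ring
  have a2 : (1 - p) / 2 + 1 = (1 - (p - 2)) / 2 := by ring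
  have a3 : (1 : ℂ) / 2 + 1 = 3 / 2 := by norm_num
  have a4 : -(p - 2) / 2 = (1 - (p - 1)) / 2 := by ring
  have a5 : -(p - 1) / 2 = (1 - p) / 2 := by ring
  rw [a1, a3] at k1
  rw [a2, a3] at k2
  unfold pcfE
  rw [← hw, g1, g2, g3, g4, a4, a5, hs, e1]
  rw [e1] at e2
  have e2' : (2 : ℂ) ^ ((p - 2) / 2) = (2 : ℂ) ^ ((p - 1) / 2) * Real.sqrt 2 / 2 := by
    rw [← e2]; ring
  rw [e2']
  generalize kummerM ((1 - (p - 1)) / 2) (1 / 2) w = M1 at *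
  generalize kummerM ((1 - (p - 1)) / 2) (3 / 2) w = M2 at *
  generalize kummerM ((1 - p) / 2) (1 / 2) w = M3 at *
  generalize kummerM ((1 - (p - 2)) / 2) (3 / 2) w = M4 at *
  generalize kummerM (-p / 2) (1 / 2) w = M5 at *
  generalize kummerM ((1 - p) / 2) (3 / 2) w = M6 at *
  have f5 : M5 = M1 - 2 * w * M2 := by linear_combination 2 * k1
  have f3 : M3 = p * M6 + (1 - p) * M4 := by linear_combination -2 * k2
  rw [f5, f3, hw]
  generalize (2 : ℂ) ^ ((p - 1) / 2) = P at *
  generalize (Real.sqrt Real.pi : ℂ) = s at *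
  generalize (Real.sqrt 2 : ℂ) = r at *
  have hp1'' : 1 - p ≠ 0 := sub_ne_zero.2 hp1.symm
  simp only [div_eq_mul_inv (_ : ℂ) (_ * Gamma _), div_eq_mul_inv (_ : ℂ) (Gamma _), mul_inv ((1 - p) / 2),
    mul_inv (-p / 2)]
  generalize (Gamma ((1 - p) / 2))⁻¹ = G1 at *
  generalize (Gamma (-p / 2))⁻¹ = G2 at *
  have i1 : ((1 - p) / 2)⁻¹ = 2 / (1 - p) := inv_div _ _
  have i2 : (-p / 2)⁻¹ = 2 / (-p) := inv_div _ _
  rw [i1, i2]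
  have key : P * s * z * G2 * (-M6 + (p - 1) / p * M4) * (r * r - 2) = 0 := by rw [hs2]; ring
  rw [← sub_eq_zero, ← key]
  field_simp
  ring

/-! ### The integral representation of the parabolic cylinder function -/

theorem norm_cpow_mul_exp_neg_mul (a b : ℂ) {r : ℝ} (hr : 0 < r) :
    ‖(r : ℂ) ^ (a - 1) * exp (-(b * r))‖ = r ^ (a.re - 1) * Real.exp (-b.re * r) := by
  rw [norm_mul, norm_cpow_eq_rpow_re_of_pos hr, Complex.norm_exp]
  simp

theorem integrableOn_rpow_mul_exp_neg_mul {a c : ℝ} (ha : 0 < a) (hc : 0 < c) :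
    IntegrableOn (fun r : ℝ => r ^ (a - 1) * Real.exp (-c * r)) (Set.Ioi 0) := by
  have := integrableOn_rpow_mul_exp_neg_mul_rpow (p := 1) (s := a - 1) (b := c) (by linarith)
    one_pos hc
  simpa using this

theorem continuousOn_ofReal_cpow (a : ℂ) : ContinuousOn (fun r : ℝ => (r : ℂ) ^ a) (Set.Ioi 0) :=
  fun r hr => (continuousAt_ofReal_cpow_const r a (Or.inr (ne_of_gt hr))).continuousWithinAt

/-- The Gamma integral with a complex rate, by analytic continuation from the positive axis. -/
theorem integral_cpow_mul_exp_neg_mul_of_re_pos {a b : ℂ} (ha : 0 < a.re) (hb : 0 < b.re) :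
    ∫ r : ℝ in Set.Ioi 0, (r : ℂ) ^ (a - 1) * exp (-(b * r)) = exp (-a * log b) * Gamma a := by
  let U : Set ℂ := {b | 0 < b.re}
  have hU : IsOpen U := isOpen_lt continuous_const continuous_re
  have hUc : IsPreconnected U := (convex_halfSpace_re_gt 0).isPreconnected
  have hf : DifferentiableOn ℂ
      (fun b => ∫ r : ℝ in Set.Ioi 0, (r : ℂ) ^ (a - 1) * exp (-(b * r))) U := by
    intro b₀ (hb₀ : 0 < b₀.re)
    have hmeas : ∀ b : ℂ, AEStronglyMeasurable (fun r : ℝ => (r : ℂ) ^ (a - 1) * exp (-(b * r)))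
        (volume.restrict (Set.Ioi 0)) := fun b =>
      ((continuousOn_ofReal_cpow _).mul (by fun_prop)).aestronglyMeasurable measurableSet_Ioi
    have := (hasDerivAt_integral_of_dominated_loc_of_deriv_le
      (μ := volume.restrict (Set.Ioi 0)) (x₀ := b₀) (s := {b | b₀.re / 2 < b.re})
      (F := fun b r => (r : ℂ) ^ (a - 1) * exp (-(b * r)))
      (F' := fun b r => (r : ℂ) ^ (a - 1) * (exp (-(b * r)) * -(r : ℂ)))
      (bound := fun r => r ^ ((a.re + 1) - 1) * Real.exp (-(b₀.re / 2) * r))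
      ((isOpen_lt continuous_const continuous_re).mem_nhds (by simp; linarith))
      (Eventually.of_forall hmeas) ?_ ?_ ?_ ?_ ?_).2
    · exact this.differentiableAt.differentiableWithinAt
    · refine (integrableOn_rpow_mul_exp_neg_mul ha hb₀).mono' (hmeas b₀) ?_
      filter_upwards [ae_restrict_mem measurableSet_Ioi] with r hr
      rw [norm_cpow_mul_exp_neg_mul a b₀ hr]
    · exact ((continuousOn_ofReal_cpow _).mul (by fun_prop)).aestronglyMeasurable
        measurableSet_Ioi
    · filter_upwards [ae_restrict_mem measurableSet_Ioi] with r hr b hb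
      have hr0 : (0 : ℝ) < r := hr
      rw [← mul_assoc, norm_mul, norm_cpow_mul_exp_neg_mul a b hr, norm_neg, norm_real,
        Real.norm_of_nonneg hr0.le, add_sub_right_comm, Real.rpow_add_one hr0.ne', mul_right_comm]
      have : b₀.re / 2 < b.re := hb
      gcongr
    · exact integrableOn_rpow_mul_exp_neg_mul (by linarith) (by linarith)
    · filter_upwards with r b _
      refine HasDerivAt.const_mul _ ?_
      have : HasDerivAt (fun b : ℂ => -(b * r)) (-(r : ℂ)) b := by
        simpa using ((hasDerivAt_id b).mul_const (r : ℂ)).fun_neg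
      exact this.cexp
  have hg : DifferentiableOn ℂ (fun b => exp (-a * log b) * Gamma a) U := by
    intro b hb
    have : DifferentiableAt ℂ log b := differentiableAt_log (Or.inl hb)
    exact DifferentiableAt.differentiableWithinAt (by fun_prop)
  have h1 : (1 : ℂ) ∈ U := by simp [U]
  refine (hf.analyticOnNhd hU).eqOn_of_preconnected_of_frequently_eq (hg.analyticOnNhd hU)
    hUc h1 ?_ hb
  -- the positive real numbers accumulate at `1`
  have hseq : Tendsto (fun n : ℕ => ((1 + 1 / ((n : ℝ) + 1) : ℝ) : ℂ)) atTop (𝓝[≠] 1) := by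
    refine tendsto_nhdsWithin_iff.2 ⟨?_, Eventually.of_forall fun n => ?_⟩
    · have : Tendsto (fun n : ℕ => (1 + 1 / ((n : ℝ) + 1) : ℝ)) atTop (𝓝 (1 + 0)) :=
        tendsto_const_nhds.add tendsto_one_div_add_atTop_nhds_zero_nat
      rw [add_zero] at this
      simpa [Function.comp_def] using (continuous_ofReal.tendsto 1).comp this
    · have : (0 : ℝ) < 1 / ((n : ℝ) + 1) := by positivity
      simp only [Set.mem_compl_iff, Set.mem_singleton_iff]
      intro h
      have h' : (1 + 1 / ((n : ℝ) + 1) : ℝ) = 1 := by exact_mod_cast h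
      linarith
  refine hseq.frequently (Eventually.of_forall fun n => ?_).frequently
  have hpos : (0 : ℝ) < 1 + 1 / ((n : ℝ) + 1) := by positivity
  generalize 1 + 1 / ((n : ℝ) + 1) = c at hpos
  have hc0 : (c : ℂ) ≠ 0 := ofReal_ne_zero.2 hpos.ne'
  rw [integral_cpow_mul_exp_neg_mul_Ioi ha hpos, one_div, inv_cpow, cpow_def_of_ne_zero hc0,
    ← exp_neg]
  · ring_nf
  · rw [arg_ofReal_of_nonneg hpos.le]; exact Real.pi_pos.ne

/-- Moments of a complex Gaussian on the half line. -/
theorem integral_cpow_mul_exp_neg_mul_sq {a b : ℂ} (ha : 0 < a.re) (hb : 0 < b.re) :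
    ∫ r : ℝ in Set.Ioi 0, (r : ℂ) ^ (a - 1) * exp (-(b * r ^ 2)) =
      exp (-(a / 2) * log b) * Gamma (a / 2) / 2 := by
  have ha2 : 0 < (a / 2).re := by simpa using ha
  have h := integral_comp_rpow_Ioi_of_pos
    (g := fun r : ℝ => (r : ℂ) ^ (a / 2 - 1) * exp (-(b * r))) (p := 2) two_pos
  rw [integral_cpow_mul_exp_neg_mul_of_re_pos ha2 hb] at h
  rw [← h, div_eq_inv_mul _ (2 : ℂ), ← integral_const_mul]
  refine setIntegral_congr_fun measurableSet_Ioi fun r hr => ?_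
  have hr0 : (0 : ℝ) < r := hr
  have hrc : (r : ℂ) ≠ 0 := ofReal_ne_zero.2 hr0.ne'
  have e1 : ((r ^ (2 : ℝ) : ℝ) : ℂ) = (r : ℂ) ^ 2 := by norm_cast
  have e2 : ((r : ℂ) ^ 2) ^ (a / 2 - 1) * r = (r : ℂ) ^ (a - 1) := by
    rw [← ofReal_pow, cpow_def_of_ne_zero (ofReal_ne_zero.2 (pow_pos hr0 2).ne'),
      cpow_def_of_ne_zero hrc, ← ofReal_log (pow_pos hr0 2).le, Real.log_pow]
    calc _ = exp (↑(((2 : ℕ) : ℝ) * Real.log r) * (a / 2 - 1)) * exp (log r) := by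
          rw [exp_log hrc]
      _ = _ := by
          rw [← exp_add, ofReal_mul, ofReal_log hr0.le]
          congr 1
          push_cast
          ring
  have e3 : (r : ℝ) ^ ((2 : ℝ) - 1) = r := by norm_num
  simp only [e1, e3, real_smul]
  rw [← e2]
  push_cast
  ring

theorem Gamma_add_natCast {s : ℂ} (hs : 0 < s.re) (k : ℕ) :
    Gamma (s + k) = (ascPochhammer ℂ k).eval s * Gamma s := by
  induction k with
  | zero => simp
  | succ k ih =>
    rw [Nat.cast_succ, ← add_assoc, Gamma_add_one _ (add_natCast_ne_zero_of_re_pos hs k), ih,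
      ascPochhammer_eval_succ_right]
    ring

theorem factorial_two_mul_eq (k : ℕ) :
    ((2 * k).factorial : ℂ) = 4 ^ k * k.factorial * (ascPochhammer ℂ k).eval (1 / 2) := by
  induction k with
  | zero => simp
  | succ k ih =>
    rw [show 2 * (k + 1) = 2 * k + 1 + 1 by ring, Nat.factorial_succ, Nat.factorial_succ,
      ascPochhammer_eval_succ_right, Nat.factorial_succ]
    push_cast
    rw [ih]
    ring

theorem factorial_two_mul_add_one_eq (k : ℕ) :
    ((2 * k + 1).factorial : ℂ) = 4 ^ k * k.factorial * (ascPochhammer ℂ k).eval (3 / 2) := by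
  induction k with
  | zero => simp
  | succ k ih =>
    rw [show 2 * (k + 1) + 1 = 2 * k + 1 + 1 + 1 by ring, Nat.factorial_succ (2 * k + 1 + 1),
      Nat.factorial_succ (2 * k + 1), ascPochhammer_eval_succ_right, Nat.factorial_succ k]
    push_cast
    rw [ih]
    ring

/-- The Taylor series of `Γ(q) e^{x²/4} D_{-q}(x)`. -/
theorem hasSum_pcfE_neg {q : ℂ} (hq : 0 < q.re) (x : ℂ) :
    HasSum (fun n : ℕ => (-x) ^ n / n.factorial *
      ((2 : ℂ) ^ ((q + n) / 2) * Gamma ((q + n) / 2) / 2)) (Gamma q * pcfE (-q) x) := by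
  have hq2 : 0 < (q / 2).re := by simpa using hq
  have hq3 : 0 < ((q + 1) / 2).re := by simp; linarith
  have hd := Gamma_mul_Gamma_add_half (q / 2)
  rw [mul_div_cancel₀ _ two_ne_zero, ← add_div] at hd
  have g1 : Gamma (q / 2) ≠ 0 := Gamma_ne_zero_of_re_pos hq2
  have g2 : Gamma ((q + 1) / 2) ≠ 0 := Gamma_ne_zero_of_re_pos hq3
  have hs : (Real.sqrt (2 * Real.pi) : ℂ) = (2 : ℂ) ^ ((1 : ℂ) / 2) * Real.sqrt Real.pi := by
    rw [Real.sqrt_mul (by norm_num), ofReal_mul, Real.sqrt_eq_rpow 2, ofReal_cpow (by norm_num)]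
    norm_num
  have hpow : ∀ k : ℕ, (2 : ℂ) ^ (q / 2 + k) = 2 ^ (q / 2) * 2 ^ k := fun k => by
    rw [cpow_add _ _ two_ne_zero, cpow_natCast]
  have hpow' : ∀ k : ℕ, (2 : ℂ) ^ ((q + 1) / 2 + k) = 2 ^ ((q + 1) / 2) * 2 ^ k := fun k => by
    rw [cpow_add _ _ two_ne_zero, cpow_natCast]
  have hsum : Gamma q * pcfE (-q) x =
      2 ^ (q / 2) * Gamma (q / 2) / 2 * kummerM (q / 2) (1 / 2) (x ^ 2 / 2) +
      -x * (2 ^ ((q + 1) / 2) * Gamma ((q + 1) / 2) / 2) *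
        kummerM ((q + 1) / 2) (3 / 2) (x ^ 2 / 2) := by
    have hπ : (Real.sqrt Real.pi : ℂ) ≠ 0 :=
      ofReal_ne_zero.2 (Real.sqrt_pos.2 Real.pi_pos).ne'
    have c1 : (2 : ℂ) ^ (-q / 2) * 2 ^ (q / 2) = 1 := by
      rw [← cpow_add _ _ two_ne_zero]; simp [neg_div]
    have c2 : (2 : ℂ) ^ (1 - q) * (2 ^ (q / 2) * 2 ^ (q / 2)) = 2 := by
      rw [← cpow_add _ _ two_ne_zero, ← cpow_add _ _ two_ne_zero]
      ring_nf; simp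
    have c3 : (2 : ℂ) ^ ((q + 1) / 2) = 2 ^ (q / 2) * 2 ^ ((1 : ℂ) / 2) := by
      rw [← cpow_add _ _ two_ne_zero]; congr 1; ring
    have hQ : (2 : ℂ) ^ (q / 2) ≠ 0 := by simp [cpow_eq_zero_iff]
    have hΓ : Gamma q * (Real.sqrt Real.pi : ℂ) =
        Gamma (q / 2) * Gamma ((q + 1) / 2) * (2 ^ (q / 2) * 2 ^ (q / 2)) / 2 := by
      rw [hd]
      linear_combination (-(Gamma q * (Real.sqrt Real.pi : ℂ)) / 2) * c2
    have c1' : (2 : ℂ) ^ (-q / 2) = (2 ^ (q / 2))⁻¹ := eq_inv_of_mul_eq_one_left c1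
    unfold pcfE
    rw [neg_neg, show (1 - -q) / 2 = (q + 1) / 2 by ring, hs, c3, c1']
    generalize kummerM (q / 2) (1 / 2) (x ^ 2 / 2) = M1
    generalize kummerM ((q + 1) / 2) (3 / 2) (x ^ 2 / 2) = M2
    have : Gamma q = Gamma (q / 2) * Gamma ((q + 1) / 2) * (2 ^ (q / 2) * 2 ^ (q / 2)) / 2 /
        (Real.sqrt Real.pi : ℂ) := by rw [← hΓ]; field_simp
    rw [this]
    generalize (2 : ℂ) ^ (q / 2) = Q at *
    generalize (2 : ℂ) ^ ((1 : ℂ) / 2) = r at *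
    generalize Gamma (q / 2) = G1 at *
    generalize Gamma ((q + 1) / 2) = G2 at *
    field_simp
    ring
  rw [hsum]
  refine HasSum.even_add_odd ?_ ?_
  · refine ((hasSum_kummerM (q / 2) (b := 1 / 2) (by norm_num) (x ^ 2 / 2)).mul_left
      (2 ^ (q / 2) * Gamma (q / 2) / 2)).congr_fun fun k => ?_
    have hk : (q + ((2 * k : ℕ) : ℂ)) / 2 = q / 2 + k := by push_cast; ring
    have n1 := ascPochhammer_eval_ne_zero (b := 1 / 2) (by norm_num) k
    have n2 : (k.factorial : ℂ) ≠ 0 := Nat.cast_ne_zero.2 k.factorial_ne_zero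
    have h4 : (4 : ℂ) ^ k = 2 ^ k * 2 ^ k := by rw [← mul_pow]; norm_num
    rw [hk, hpow, Gamma_add_natCast hq2, factorial_two_mul_eq, kummerTerm, pow_mul, neg_sq,
      div_pow, h4]
    field_simp
  · refine ((hasSum_kummerM ((q + 1) / 2) (b := 3 / 2) (by norm_num) (x ^ 2 / 2)).mul_left
      (-x * (2 ^ ((q + 1) / 2) * Gamma ((q + 1) / 2) / 2))).congr_fun fun k => ?_
    have hk : (q + ((2 * k + 1 : ℕ) : ℂ)) / 2 = (q + 1) / 2 + k := by push_cast; ring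
    have n1 := ascPochhammer_eval_ne_zero (b := 3 / 2) (by norm_num) k
    have n2 : (k.factorial : ℂ) ≠ 0 := Nat.cast_ne_zero.2 k.factorial_ne_zero
    have h4 : (4 : ℂ) ^ k = 2 ^ k * 2 ^ k := by rw [← mul_pow]; norm_num
    rw [hk, hpow', Gamma_add_natCast hq3, factorial_two_mul_add_one_eq, kummerTerm, pow_succ,
      pow_mul, neg_sq, div_pow, h4]
    field_simp

theorem re_exp_mul_I (θ : ℝ) : (exp (θ * I)).re = Real.cos θ := exp_ofReal_mul_I_re θ

theorem integrableOn_exp_mul_sub_sq {q c : ℝ} (hq : 0 < q) (hc : 0 < c) (m : ℝ) :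
    IntegrableOn (fun r : ℝ => Real.exp (m * r) * (r ^ (q - 1) * Real.exp (-c * r ^ 2)))
      (Set.Ioi 0) := by
  have h := (integrableOn_rpow_mul_exp_neg_mul_sq (b := c / 2) (by linarith)
    (s := q - 1) (by linarith)).const_mul (Real.exp (m ^ 2 / (2 * c)))
  refine h.mono' ?_ ?_
  · refine ContinuousOn.aestronglyMeasurable ?_ measurableSet_Ioi
    have : ContinuousOn (fun r : ℝ => r ^ (q - 1)) (Set.Ioi 0) :=
      fun r hr => (Real.continuousAt_rpow_const r _ (Or.inl (ne_of_gt hr))).continuousWithinAt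
    fun_prop
  · filter_upwards [ae_restrict_mem measurableSet_Ioi] with r hr
    have hr0 : (0 : ℝ) < r := hr
    rw [Real.norm_of_nonneg (by positivity)]
    have e : Real.exp (m * r) * Real.exp (-c * r ^ 2) ≤
        Real.exp (m ^ 2 / (2 * c)) * Real.exp (-(c / 2) * r ^ 2) := by
      rw [← Real.exp_add, ← Real.exp_add, Real.exp_le_exp]
      have : m ^ 2 / (2 * c) + -(c / 2) * r ^ 2 - (m * r + -c * r ^ 2) =
          (m - c * r) ^ 2 / (2 * c) := by field_simp; ring
      have : 0 ≤ (m - c * r) ^ 2 / (2 * c) := by positivity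
      linarith
    have hp : 0 ≤ r ^ (q - 1) := by positivity
    nlinarith [mul_le_mul_of_nonneg_left e hp]

/-- The integral representation
`Γ(q) e^{x²/4} D_{-q}(x) = ∫₀^∞ s^{q-1} e^{-xs-s²/2} ds`, `Re q > 0`, with the ray of integration
rotated by the angle `θ`, `|θ| < π/4`. Both sides are expanded in powers of `x`. -/
theorem integral_representation_pcfE {q : ℂ} (hq : 0 < q.re) {θ : ℝ} (hθ : |θ| < Real.pi / 4)
    (x : ℂ) :
    ∫ r : ℝ in Set.Ioi 0, (r : ℂ) ^ (q - 1) *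
        exp (-(x * exp (θ * I) * r) - exp (2 * θ * I) / 2 * r ^ 2) =
      exp (-(θ * I) * q) * (Gamma q * pcfE (-q) x) := by
  obtain ⟨hθ1, hθ2⟩ := abs_lt.1 hθ
  have hcos : 0 < Real.cos (2 * θ) := Real.cos_pos_of_mem_Ioo ⟨by linarith, by linarith⟩
  have h2θ : (2 * θ * I : ℂ) = ((2 * θ : ℝ) : ℂ) * I := by push_cast; ring
  have hre : (exp (2 * θ * I) / 2).re = Real.cos (2 * θ) / 2 := by
    rw [h2θ, ← re_exp_mul_I]; simp
  set b : ℂ := exp (2 * θ * I) / 2 with hb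
  have hbre : 0 < b.re := by rw [hre]; positivity
  have hlog : log b = 2 * θ * I - log 2 := by
    have h : b = exp (2 * θ * I - log 2) := by
      rw [exp_sub, exp_log two_ne_zero]
    have him : (2 * θ * I - log 2 : ℂ).im = 2 * θ := by
      have : (log 2 : ℂ).im = 0 := by
        simp [log_im]
      simp [this]
    rw [h, log_exp] <;> rw [him] <;> linarith [Real.pi_pos]
  set u : ℂ := exp (θ * I) with hu
  have hunorm : ‖u‖ = 1 := norm_exp_ofReal_mul_I θ
  -- the integral of the series, term by term
  have hseries := hasSum_integral_of_dominated_convergence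
    (μ := volume.restrict (Set.Ioi (0 : ℝ)))
    (F := fun (n : ℕ) (r : ℝ) => (-(x * u * r)) ^ n / n.factorial *
      ((r : ℂ) ^ (q - 1) * exp (-(b * r ^ 2))))
    (f := fun r : ℝ => (r : ℂ) ^ (q - 1) * exp (-(x * u * r) - b * r ^ 2))
    (bound := fun n r => (‖x‖ * r) ^ n / n.factorial *
      (r ^ (q.re - 1) * Real.exp (-b.re * r ^ 2))) ?_ ?_ ?_ ?_ ?_
  · refine hseries.unique ?_
    refine ((hasSum_pcfE_neg hq x).mul_left (exp (-(θ * I) * q))).congr_fun fun n => ?_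
    have hterm : ∀ r ∈ Set.Ioi (0 : ℝ), (-(x * u * r)) ^ n / n.factorial *
        ((r : ℂ) ^ (q - 1) * exp (-(b * r ^ 2))) =
        (-(x * u)) ^ n / n.factorial * ((r : ℂ) ^ ((q + n) - 1) * exp (-(b * r ^ 2))) := by
      intro r hr
      have hr0 : (r : ℂ) ≠ 0 := ofReal_ne_zero.2 (ne_of_gt hr)
      rw [add_sub_right_comm, cpow_add _ _ hr0, cpow_natCast, ← neg_mul, mul_pow]
      ring
    have hqn : 0 < (q + n).re := by
      have : (0 : ℝ) ≤ n := n.cast_nonneg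
      simp; linarith
    rw [setIntegral_congr_fun measurableSet_Ioi hterm, integral_const_mul,
      integral_cpow_mul_exp_neg_mul_sq hqn hbre, hlog]
    have e1 : (-(x * u)) ^ n = (-x) ^ n * exp (n * (θ * I)) := by
      rw [exp_nat_mul, ← mul_pow, neg_mul]
    have e2 : exp (-((q + n) / 2) * (2 * θ * I - log 2)) =
        exp (-(θ * I) * q) * exp (-(n * (θ * I))) * (2 : ℂ) ^ ((q + n) / 2) := by
      rw [cpow_def_of_ne_zero two_ne_zero, ← exp_add, ← exp_add]
      congr 1; ring
    rw [e1, e2, exp_neg (n * (θ * I))]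
    have := exp_ne_zero ((n : ℂ) * (θ * I))
    field_simp
  · intro n
    refine ContinuousOn.aestronglyMeasurable ?_ measurableSet_Ioi
    exact ContinuousOn.mul (by fun_prop) ((continuousOn_ofReal_cpow _).mul (by fun_prop))
  · intro n
    filter_upwards [ae_restrict_mem measurableSet_Ioi] with r hr
    have hr0 : (0 : ℝ) < r := hr
    rw [norm_mul, norm_mul, norm_div, norm_pow, norm_neg, norm_mul, norm_mul, hunorm, mul_one,
      norm_cpow_eq_rpow_re_of_pos hr0, norm_real, Real.norm_of_nonneg hr0.le, norm_natCast,
      Complex.norm_exp]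
    have : (-(b * (r : ℂ) ^ 2)).re = -b.re * r ^ 2 := by
      rw [← ofReal_pow, neg_re, re_mul_ofReal, neg_mul]
    rw [this, sub_re, one_re]
  · filter_upwards with r
    exact (Real.summable_pow_div_factorial _).mul_right _
  · refine (integrableOn_exp_mul_sub_sq hq hbre ‖x‖).congr_fun (fun r _ => ?_) measurableSet_Ioi
    simp only
    rw [tsum_mul_right, Real.exp_eq_exp_ℝ, NormedSpace.exp_eq_tsum_div]
  · filter_upwards with r
    have h := (NormedSpace.expSeries_div_hasSum_exp (𝔸 := ℂ) (-(x * u * r))).mul_right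
      ((r : ℂ) ^ (q - 1) * exp (-(b * r ^ 2)))
    rw [← Complex.exp_eq_exp_ℂ] at h
    convert! h using 1
    rw [sub_eq_add_neg (-(x * u * r)), exp_add]
    ring

/-! ### Asymptotics of the parabolic cylinder function -/

theorem norm_exp_neg_sub_one_le {w : ℂ} (hw : 0 ≤ w.re) : ‖exp (-w) - 1‖ ≤ ‖w‖ := by
  have h := Convex.norm_image_sub_le_of_norm_deriv_le (𝕜 := ℂ) (f := fun w : ℂ => exp (-w))
    (s := {w | 0 ≤ w.re}) (C := 1) (x := 0) (y := w) (fun z _ => by fun_prop) (fun z hz => ?_)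
    (convex_halfSpace_re_ge 0) (by simp) hw
  · simpa using h
  · have : HasDerivAt (fun w : ℂ => exp (-w)) (exp (-z) * (-1)) z := (hasDerivAt_neg z).cexp
    rw [this.deriv]
    have hz' : 0 ≤ z.re := hz
    simp [Complex.norm_exp, hz']

/-- The asymptotics for negative real part of the order, on one half plane of the logarithm of
the argument. -/
theorem norm_pcfE_neg_sub_le_of_angle {q : ℂ} (hq : 0 < q.re) {θ η : ℝ}
    (hθ : |θ| < Real.pi / 4) (hη : 0 < η) :
    ∃ C : ℝ, ∀ l : ℂ, |l.im + θ| ≤ Real.pi / 2 - η →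
      ‖pcfE (-q) (exp l) - exp (-q * l)‖ ≤ C * Real.exp ((-q.re - 2) * l.re) := by
  obtain ⟨hθ1, hθ2⟩ := abs_lt.1 hθ
  have hΓ : Gamma q ≠ 0 := Gamma_ne_zero_of_re_pos hq
  have hcos : 0 < Real.cos (2 * θ) := Real.cos_pos_of_mem_Ioo ⟨by linarith, by linarith⟩
  have h2θ : (2 * θ * I : ℂ) = ((2 * θ : ℝ) : ℂ) * I := by push_cast; ring
  have hre : (exp (2 * θ * I)).re = Real.cos (2 * θ) := by rw [h2θ, ← re_exp_mul_I]
  have hnorm2 : ‖exp (2 * θ * I)‖ = 1 := by rw [h2θ, norm_exp_ofReal_mul_I]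
  set κ : ℝ := Real.sin η with hκ
  refine ⟨‖exp (-(θ * I) * q)‖⁻¹ * ‖Gamma q‖⁻¹ *
    ((1 / κ) ^ (q.re + 2) * Real.Gamma (q.re + 2)), fun l hl => ?_⟩
  obtain ⟨hl1, hl2⟩ := abs_le.1 hl
  have hη2 : η ≤ Real.pi / 2 := by
    have := abs_nonneg (l.im + θ); linarith
  have hκ0 : 0 < κ := Real.sin_pos_of_pos_of_lt_pi hη (by linarith [Real.pi_pos])
  -- the rate `β = e^{l+iθ}` has real part at least `κ |e^l|`
  set β : ℂ := exp l * exp (θ * I) with hβ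
  have hβ' : β = exp (l + θ * I) := by rw [hβ, exp_add]
  have hβre : κ * Real.exp l.re ≤ β.re := by
    rw [hβ', exp_re]
    have : (l + θ * I).im = l.im + θ := by simp
    rw [this]
    have h1 : (l + θ * I).re = l.re := by simp
    rw [h1, mul_comm]
    refine mul_le_mul_of_nonneg_left ?_ (Real.exp_pos _).le
    rw [hκ, ← Real.cos_pi_div_two_sub, ← Real.cos_abs (l.im + θ)]
    exact Real.cos_le_cos_of_nonneg_of_le_pi (abs_nonneg _) (by linarith [Real.pi_pos]) hl
  have hβpos : 0 < β.re := lt_of_lt_of_le (by positivity) hβre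
  have hlogβ : log β = l + θ * I := by
    rw [hβ', log_exp] <;> simp <;> linarith [Real.pi_pos]
  have hI1 := integral_representation_pcfE hq hθ (exp l)
  have hI2 := integral_cpow_mul_exp_neg_mul_of_re_pos hq hβpos
  have hint2 : IntegrableOn (fun r : ℝ => (r : ℂ) ^ (q - 1) * exp (-(β * r))) (Set.Ioi 0) := by
    refine (integrableOn_rpow_mul_exp_neg_mul hq hβpos).mono'
      (((continuousOn_ofReal_cpow _).mul (by fun_prop)).aestronglyMeasurable measurableSet_Ioi) ?_
    filter_upwards [ae_restrict_mem measurableSet_Ioi] with r hr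
    rw [norm_cpow_mul_exp_neg_mul q β hr]
  have hfact : ∀ r : ℝ, (r : ℂ) ^ (q - 1) *
      exp (-(exp l * exp (θ * I) * r) - exp (2 * θ * I) / 2 * r ^ 2) =
      (r : ℂ) ^ (q - 1) * exp (-(β * r)) * exp (-(exp (2 * θ * I) / 2 * r ^ 2)) := by
    intro r
    rw [sub_eq_add_neg (-(exp l * exp (θ * I) * r)), exp_add, ← mul_assoc]
  have hre2 : ∀ r : ℝ, (exp (2 * θ * I) / 2 * (r : ℂ) ^ 2).re = Real.cos (2 * θ) / 2 * r ^ 2 := by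
    intro r
    rw [← ofReal_pow, re_mul_ofReal, ← hre]; simp
  have hre2' : ∀ r : ℝ, 0 ≤ (exp (2 * θ * I) / 2 * (r : ℂ) ^ 2).re := by
    intro r; rw [hre2]; positivity
  have hint1 : IntegrableOn (fun r : ℝ => (r : ℂ) ^ (q - 1) *
      exp (-(exp l * exp (θ * I) * r) - exp (2 * θ * I) / 2 * r ^ 2)) (Set.Ioi 0) := by
    refine Integrable.mono hint2 (((continuousOn_ofReal_cpow _).mul (by fun_prop)).aestronglyMeasurable
      measurableSet_Ioi) ?_
    filter_upwards with r
    rw [hfact, norm_mul _ (exp (-(exp (2 * θ * I) / 2 * (r : ℂ) ^ 2)))]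
    refine mul_le_of_le_one_right (norm_nonneg _) ?_
    rw [Complex.norm_exp, Real.exp_le_one_iff, neg_re]
    linarith [hre2' r]
  have hdiff : exp (-(θ * I) * q) * Gamma q * (pcfE (-q) (exp l) - exp (-q * l)) =
      ∫ r : ℝ in Set.Ioi 0, ((r : ℂ) ^ (q - 1) *
        exp (-(exp l * exp (θ * I) * r) - exp (2 * θ * I) / 2 * r ^ 2) -
        (r : ℂ) ^ (q - 1) * exp (-(β * r))) := by
    rw [integral_sub hint1 hint2, hI1, hI2, hlogβ, mul_add, exp_add]
    ring_nf
  have hbound : ‖∫ r : ℝ in Set.Ioi 0, ((r : ℂ) ^ (q - 1) *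
        exp (-(exp l * exp (θ * I) * r) - exp (2 * θ * I) / 2 * r ^ 2) -
        (r : ℂ) ^ (q - 1) * exp (-(β * r)))‖ ≤
      ∫ r : ℝ in Set.Ioi 0, r ^ ((q.re + 2) - 1) * Real.exp (-(κ * Real.exp l.re * r)) := by
    have hc : 0 < κ * Real.exp l.re := by positivity
    have hint := integrableOn_rpow_mul_exp_neg_mul (a := q.re + 2) (by linarith) hc
    simp only [neg_mul] at hint
    refine norm_integral_le_of_norm_le hint ?_
    filter_upwards [ae_restrict_mem measurableSet_Ioi] with r hr
    have hr0 : (0 : ℝ) < r := hr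
    rw [hfact, ← mul_sub_one, norm_mul, norm_cpow_mul_exp_neg_mul q β hr0]
    have h1 := norm_exp_neg_sub_one_le (hre2' r)
    have h2 : ‖exp (2 * θ * I) / 2 * (r : ℂ) ^ 2‖ ≤ r ^ 2 := by
      rw [norm_mul, norm_div, hnorm2, norm_pow, norm_real, Real.norm_of_nonneg hr0.le]
      norm_num
      nlinarith [sq_nonneg r]
    have h3 : r ^ ((q.re + 2) - 1) = r ^ (q.re - 1) * r ^ 2 := by
      rw [← Real.rpow_natCast, ← Real.rpow_add hr0]; congr 1; push_cast; ring
    have h4 : Real.exp (-β.re * r) ≤ Real.exp (-(κ * Real.exp l.re * r)) := by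
      rw [Real.exp_le_exp, neg_mul]
      exact neg_le_neg (mul_le_mul_of_nonneg_right hβre hr0.le)
    have h5 := h1.trans h2
    rw [h3, mul_assoc (r ^ (q.re - 1)) (r ^ 2), mul_comm (r ^ 2),
      mul_assoc (r ^ (q.re - 1)) (Real.exp _)]
    gcongr
  rw [Real.integral_rpow_mul_exp_neg_mul_Ioi (by linarith) (by positivity), ← hdiff, norm_mul,
    norm_mul] at hbound
  have hpow : (1 / (κ * Real.exp l.re)) ^ (q.re + 2) =
      (1 / κ) ^ (q.re + 2) * Real.exp ((-q.re - 2) * l.re) := by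
    rw [show 1 / (κ * Real.exp l.re) = (1 / κ) / Real.exp l.re by field_simp, Real.div_rpow (by positivity) (Real.exp_pos _).le, ← Real.exp_mul,
      div_eq_mul_inv, ← Real.exp_neg]
    ring_nf
  rw [hpow] at hbound
  have n1 : 0 < ‖exp (-(θ * I) * q)‖ := norm_pos_iff.2 (exp_ne_zero _)
  have n2 : 0 < ‖Gamma q‖ := norm_pos_iff.2 hΓ
  calc ‖pcfE (-q) (exp l) - exp (-q * l)‖ =
      ‖exp (-(θ * I) * q)‖⁻¹ * ‖Gamma q‖⁻¹ *
        (‖exp (-(θ * I) * q)‖ * ‖Gamma q‖ * ‖pcfE (-q) (exp l) - exp (-q * l)‖) := by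
        field_simp
    _ ≤ _ := mul_le_mul_of_nonneg_left hbound (by positivity)
    _ = _ := by ring

/-- The asymptotics for negative real part of the order. -/
theorem norm_pcfE_neg_sub_le {q : ℂ} (hq : 0 < q.re) {η : ℝ} (hη : 0 < η) :
    ∃ C : ℝ, 0 ≤ C ∧ ∀ l : ℂ, |l.im| ≤ 3 * Real.pi / 4 - η →
      ‖pcfE (-q) (exp l) - exp (-q * l)‖ ≤ C * Real.exp ((-q.re - 2) * l.re) := by
  wlog hηs : η < Real.pi / 2 generalizing η
  · obtain ⟨C, h0, hC⟩ := this (η := Real.pi / 4) (by positivity) (by linarith [Real.pi_pos])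
    exact ⟨C, h0, fun l hl => hC l (by linarith [Real.pi_pos])⟩
  -- the two rotations of the ray by `±(π/4 - η/2)` cover the sector
  obtain ⟨C₁, h₁⟩ := norm_pcfE_neg_sub_le_of_angle hq (θ := Real.pi / 4 - η / 2) (η := η / 2)
    (by rw [abs_lt]; constructor <;> linarith [Real.pi_pos]) (by linarith)
  obtain ⟨C₂, h₂⟩ := norm_pcfE_neg_sub_le_of_angle hq (θ := -(Real.pi / 4 - η / 2)) (η := η / 2)
    (by rw [abs_lt]; constructor <;> linarith [Real.pi_pos]) (by linarith)
  refine ⟨max (max C₁ C₂) 0, le_max_right _ _, fun l hl => ?_⟩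
  obtain ⟨hl1, hl2⟩ := abs_le.1 hl
  rcases le_total l.im 0 with hl0 | hl0
  · refine (h₁ l ?_).trans ?_
    · rw [abs_le]; constructor <;> linarith
    · gcongr; exact (le_max_left _ _).trans (le_max_left _ _)
  · refine (h₂ l ?_).trans ?_
    · rw [abs_le]; constructor <;> linarith
    · gcongr; exact (le_max_right _ _).trans (le_max_left _ _)

/-- `e^{x²/4} D_p(x) = x^p (1 + O(x⁻²))` in every closed subsector of `|arg x| < 3π/4`, in terms of
the logarithm `l` of `x`. -/
theorem norm_pcfE_sub_le {p : ℂ} (hp : p.re < 1) (hp0 : p ≠ 0) {η : ℝ} (hη : 0 < η) :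
    ∃ C : ℝ, 0 ≤ C ∧ ∀ l : ℂ, |l.im| ≤ 3 * Real.pi / 4 - η → 0 ≤ l.re →
      ‖pcfE p (exp l) - exp (p * l)‖ ≤ C * Real.exp ((p.re - 2) * l.re) := by
  obtain ⟨C₁, h₁, H₁⟩ := norm_pcfE_neg_sub_le (q := -(p - 1)) (by simpa using hp) hη
  obtain ⟨C₂, h₂, H₂⟩ := norm_pcfE_neg_sub_le (q := -(p - 2)) (by simp; linarith) hη
  have hp1 : p ≠ 1 := fun h => by simp [h] at hp
  refine ⟨C₁ + ‖p - 1‖ * (Real.exp (|p.im| * (Real.pi)) + C₂), by positivity, fun l hl hl0 => ?_⟩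
  have k₁ := H₁ l hl
  have k₂ := H₂ l hl
  simp only [neg_neg, neg_re, sub_re, one_re] at k₁ k₂
  have e2 : (p - 2 : ℂ).re = p.re - 2 := by simp
  have hre2 : (2 : ℂ).re = 2 := rfl
  rw [hre2] at k₂
  have hx : exp (p * l) = exp l * exp ((p - 1) * l) := by rw [← exp_add]; congr 1; ring
  rw [pcfE_recurrence hp0 hp1]
  have hdec : exp l * pcfE (p - 1) (exp l) - (p - 1) * pcfE (p - 2) (exp l) - exp (p * l) =
      exp l * (pcfE (p - 1) (exp l) - exp ((p - 1) * l)) -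
        (p - 1) * (exp ((p - 2) * l) + (pcfE (p - 2) (exp l) - exp ((p - 2) * l))) := by
    rw [hx]; ring
  rw [hdec]
  have b1 : ‖exp l * (pcfE (p - 1) (exp l) - exp ((p - 1) * l))‖ ≤
      C₁ * Real.exp ((p.re - 2) * l.re) := by
    rw [norm_mul, Complex.norm_exp]
    calc _ ≤ Real.exp l.re * (C₁ * Real.exp ((p.re - 1 - 2) * l.re)) := by gcongr
      _ = C₁ * (Real.exp l.re * Real.exp ((p.re - 1 - 2) * l.re)) := by ring
      _ = _ := by rw [← Real.exp_add]; ring_nf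
  have b2 : ‖exp ((p - 2) * l)‖ ≤ Real.exp (|p.im| * Real.pi) * Real.exp ((p.re - 2) * l.re) := by
    rw [Complex.norm_exp, ← Real.exp_add, Real.exp_le_exp, mul_re, e2]
    have : (p - 2 : ℂ).im = p.im := by simp
    rw [this]
    have h3 : -(p.im * l.im) ≤ |p.im| * Real.pi := by
      refine (neg_le_abs _).trans ?_
      rw [abs_mul]
      gcongr
      linarith [Real.pi_pos]
    linarith
  have b3 : ‖pcfE (p - 2) (exp l) - exp ((p - 2) * l)‖ ≤ C₂ * Real.exp ((p.re - 2) * l.re) := by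
    refine k₂.trans ?_
    gcongr
    linarith
  calc _ ≤ C₁ * Real.exp ((p.re - 2) * l.re) + ‖p - 1‖ *
        (Real.exp (|p.im| * Real.pi) * Real.exp ((p.re - 2) * l.re) +
          C₂ * Real.exp ((p.re - 2) * l.re)) := by
        refine (norm_sub_le _ _).trans (add_le_add b1 ?_)
        rw [norm_mul]
        gcongr
        exact (norm_add_le _ _).trans (add_le_add b2 b3)
    _ = _ := by ring

/-! ### The jump matrix near infinity -/

theorem zeta_eq_exp {z t : ℂ} (hz : z ≠ 1 / 2) :
    zeta z t = exp ((Real.log (4 / Real.sqrt 3) : ℂ) + 3 * Real.pi * I / 4 + log t / 2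
      + log (z - 1 / 2) + log (z + 1) / 2) := by
  have hp : (0 : ℝ) < 4 / Real.sqrt 3 := by positivity
  unfold zeta
  rw [exp_add, exp_add, exp_add, exp_add, exp_log (sub_ne_zero.2 hz), ← ofReal_exp,
    Real.exp_log hp]

theorem log_neg_of_im_pos {w : ℂ} (hw : 0 < w.im) : log (-w) = log w - Real.pi * I := by
  rw [log, log, norm_neg, arg_neg_eq_arg_sub_pi_of_im_pos hw]
  push_cast
  ring

/-- The logarithm of `ζ(z,t)` for `z` in the upper half plane, continuous up to `i∞`. -/
def logZeta (z t : ℂ) : ℂ :=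
  (Real.log (4 / Real.sqrt 3) : ℂ) + 3 * Real.pi * I / 4 + log t / 2
    + log (z - 1 / 2) + log (z + 1) / 2

/-- The logarithm of `ξ(z,t)` for `z` in the upper half plane, continuous up to `i∞`. -/
def logXi (z t : ℂ) : ℂ :=
  (Real.log (4 / Real.sqrt 3) : ℂ) + 3 * Real.pi * I / 4 + log t / 2
    + (log (z + 1 / 2) - Real.pi * I) + (log (z - 1) - Real.pi * I) / 2

theorem ne_of_im_pos {z : ℂ} (hz : 0 < z.im) {a : ℂ} (ha : a.im = 0) : z ≠ a :=
  fun h => by rw [h, ha] at hz; exact lt_irrefl _ hz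

theorem exp_logZeta {z : ℂ} (hz : 0 < z.im) (t : ℂ) : exp (logZeta z t) = zeta z t :=
  (zeta_eq_exp (ne_of_im_pos hz (by simp))).symm

theorem exp_logXi {z : ℂ} (hz : 0 < z.im) (t : ℂ) : exp (logXi z t) = xi z t := by
  have h1 : -z ≠ 1 / 2 := fun h => by
    have := congrArg Complex.im h
    simp at this; exact hz.ne' this
  rw [xi, zeta_eq_exp h1, show -z - 1 / 2 = -(z + 1 / 2) by ring, show -z + 1 = -(z - 1) by ring,
    log_neg_of_im_pos (by simpa using hz), log_neg_of_im_pos (by simpa using hz), logXi]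

theorem logRight_eq {z : ℂ} (t : ℂ) :
    logRight z t = logZeta z t + (log (z + 1 / 2) - log (z - 1 / 2)) := by
  unfold logRight logZeta; ring

theorem logRight_neg_eq {z : ℂ} (hz : 0 < z.im) (t : ℂ) :
    logRight (-z) t = logXi z t - (log (z + 1 / 2) - log (z - 1 / 2)) := by
  unfold logRight logXi
  rw [show -z + 1 / 2 = -(z - 1 / 2) by ring, show -z + 1 = -(z - 1) by ring,
    log_neg_of_im_pos (by simpa using hz), log_neg_of_im_pos (by simpa using hz)]
  ring

/-- The part of a sector around the positive imaginary axis that lies above the height `R`. -/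
def upperSector (κ R : ℝ) : Set ℂ := {z | R ≤ z.im ∧ |z.re| ≤ κ * z.im}

theorem exists_slope_log_im {η : ℝ} (hη : 0 < η) :
    ∃ κ > 0, ∀ w : ℂ, 0 < w.im → |w.re| ≤ κ * w.im → |(log w).im - Real.pi / 2| ≤ η := by
  have hc : ContinuousAt arg I := continuousAt_arg (by simp [slitPlane])
  obtain ⟨δ, hδ, h⟩ := Metric.continuousAt_iff.1 hc η hη
  refine ⟨δ / 2, by positivity, fun w hw hr => ?_⟩
  have h1 : dist ((w.im⁻¹ : ℝ) * w) I < δ := by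
    have e : ((w.im⁻¹ : ℝ) : ℂ) * w - I = ((w.re / w.im : ℝ) : ℂ) := by
      apply Complex.ext
      · rw [sub_re, re_ofReal_mul, ofReal_re, I_re, sub_zero]; field_simp
      · rw [sub_im, im_ofReal_mul, ofReal_im, I_im]; field_simp; simp
    rw [dist_eq_norm, e, norm_real, Real.norm_eq_abs, abs_div, abs_of_pos hw, div_lt_iff₀ hw]
    nlinarith
  have h2 := h h1
  rw [arg_real_mul _ (inv_pos.2 hw), arg_I, Real.dist_eq] at h2
  rw [log_im]
  exact h2.le

theorem abs_log_norm_sub_le {z a : ℂ} (h : 2 * ‖a‖ ≤ ‖z‖) (hz : z ≠ 0) :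
    |Real.log ‖z - a‖ - Real.log ‖z‖| ≤ Real.log 2 := by
  have hz' : 0 < ‖z‖ := norm_pos_iff.2 hz
  have h1 : ‖z‖ / 2 ≤ ‖z - a‖ := by
    have := norm_sub_norm_le z a; linarith
  have h2 : ‖z - a‖ ≤ 2 * ‖z‖ := by
    have := norm_sub_le z a; linarith
  have k1 := Real.log_le_log (by positivity) h1
  have k2 := Real.log_le_log (lt_of_lt_of_le (by positivity) h1) h2
  rw [Real.log_div hz'.ne' two_ne_zero] at k1
  rw [Real.log_mul two_ne_zero hz'.ne'] at k2
  rw [abs_le]; constructor <;> linarith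

/-- What is needed about the logarithms of `ζ` and `ξ` in a sector around the positive imaginary
axis, uniformly for times near `t`. -/
structure SectorBounds (t : ℂ) (ρ κ R η K : ℝ) : Prop where
  ρ_pos : 0 < ρ
  κ_pos : 0 < κ
  R_ge : 2 ≤ R
  η_pos : 0 < η
  K_nonneg : 0 ≤ K
  re_pos : ∀ τ ∈ Metric.closedBall t ρ, 0 < τ.re
  im_zeta : ∀ τ ∈ Metric.closedBall t ρ, ∀ z ∈ upperSector κ R,
    |(logZeta z τ).im - 3 * Real.pi / 2| ≤ Real.pi / 4 - η
  im_xi : ∀ τ ∈ Metric.closedBall t ρ, ∀ z ∈ upperSector κ R,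
    |(logXi z τ).im| ≤ Real.pi / 4 - η
  re_zeta : ∀ τ ∈ Metric.closedBall t ρ, ∀ z ∈ upperSector κ R,
    |(logZeta z τ).re - 3 / 2 * Real.log ‖z‖| ≤ K
  re_xi : ∀ τ ∈ Metric.closedBall t ρ, ∀ z ∈ upperSector κ R,
    |(logXi z τ).re - 3 / 2 * Real.log ‖z‖| ≤ K
  re_zeta_nonneg : ∀ τ ∈ Metric.closedBall t ρ, ∀ z ∈ upperSector κ R, 0 ≤ (logZeta z τ).re
  re_xi_nonneg : ∀ τ ∈ Metric.closedBall t ρ, ∀ z ∈ upperSector κ R, 0 ≤ (logXi z τ).re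

theorem exists_sectorBounds {t : ℂ} (ht : 0 < t.re) :
    ∃ ρ κ R η K : ℝ, SectorBounds t ρ κ R η K := by
  have harg : |arg t| < Real.pi / 2 := abs_arg_lt_pi_div_two_iff.2 (Or.inl ht)
  set η : ℝ := (Real.pi / 2 - |arg t|) / 8 with hη
  have hη0 : 0 < η := by rw [hη]; linarith
  have hts : t ∈ slitPlane := Or.inl ht
  -- times near `t`
  have hev : ∀ᶠ τ in 𝓝 t, 0 < τ.re ∧ |arg τ| < |arg t| + η ∧
      |Real.log ‖τ‖| < |Real.log ‖t‖| + 1 := by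
    have h1 : ∀ᶠ τ in 𝓝 t, 0 < τ.re := (isOpen_lt continuous_const continuous_re).mem_nhds ht
    have h2 : ∀ᶠ τ in 𝓝 t, |arg τ| < |arg t| + η :=
      (continuousAt_arg hts).abs.eventually_lt continuousAt_const (by linarith)
    have h3 : ∀ᶠ τ in 𝓝 t, |Real.log ‖τ‖| < |Real.log ‖t‖| + 1 := by
      have : ContinuousAt (fun τ : ℂ => |Real.log ‖τ‖|) t :=
        ((continuousAt_id.norm).log (norm_ne_zero_iff.2 (slitPlane_ne_zero hts))).abs
      exact this.eventually_lt continuousAt_const (by linarith)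
    exact h1.and (h2.and h3)
  obtain ⟨ρ, hρ, hball⟩ := Metric.nhds_basis_closedBall.eventually_iff.1 hev
  obtain ⟨κ, hκ, hlog⟩ := exists_slope_log_im hη0
  set c : ℝ := |Real.log (4 / Real.sqrt 3)| + (|Real.log ‖t‖| + 1) / 2 + 3 / 2 * Real.log 2 with hc
  have hl2 : 0 < Real.log 2 := Real.log_pos one_lt_two
  have hc0 : 0 ≤ c := by positivity
  set R : ℝ := max (max 2 (2 / κ)) (Real.exp c) with hR
  have hR2 : 2 ≤ R := (le_max_left _ _).trans (le_max_left _ _)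
  have hRκ : 2 / κ ≤ R := (le_max_right _ _).trans (le_max_left _ _)
  have hRc : Real.exp c ≤ R := le_max_right _ _
  -- shifts of `z` by at most `1`
  have hshift : ∀ z ∈ upperSector (κ / 2) R, ∀ a : ℝ, |a| ≤ 1 →
      |(log (z - a)).im - Real.pi / 2| ≤ η ∧ |Real.log ‖z - a‖ - Real.log ‖z‖| ≤ Real.log 2 := by
    intro z hz a ha
    have him : 2 ≤ z.im := hR2.trans hz.1
    have hnorm : 2 ≤ ‖z‖ := him.trans ((le_abs_self _).trans (abs_im_le_norm z))
    constructor
    · refine hlog _ (by simp; linarith) ?_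
      have h1 : |(z - a).re| ≤ |z.re| + |a| := by simpa using abs_sub z.re a
      have h2 : (z - a).im = z.im := by simp
      rw [h2]
      have h3 : 2 ≤ κ * z.im := by
        have := mul_le_mul_of_nonneg_left (hRκ.trans hz.1) hκ.le
        rwa [mul_div_cancel₀ _ hκ.ne'] at this
      have h4 := hz.2
      linarith
    · refine abs_log_norm_sub_le ?_ ?_
      · rw [norm_real, Real.norm_eq_abs]; linarith
      · exact norm_pos_iff.1 (by linarith)
  have hlogz : ∀ z ∈ upperSector (κ / 2) R, c ≤ Real.log ‖z‖ := by
    intro z hz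
    have h1 : Real.exp c ≤ ‖z‖ :=
      hRc.trans (hz.1.trans ((le_abs_self _).trans (abs_im_le_norm z)))
    have h2 := Real.log_le_log (Real.exp_pos c) h1
    rwa [Real.log_exp] at h2
  have e12 : ∀ z : ℂ, z + 1 / 2 = z - ((-(1 / 2) : ℝ) : ℂ) := fun z => by push_cast; ring
  have e12' : ∀ z : ℂ, z - 1 / 2 = z - ((1 / 2 : ℝ) : ℂ) := fun z => by push_cast; ring
  have e1 : ∀ z : ℂ, z + 1 = z - ((-1 : ℝ) : ℂ) := fun z => by push_cast; ring
  have e1' : ∀ z : ℂ, z - 1 = z - ((1 : ℝ) : ℂ) := fun z => by push_cast; ring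
  have p12 : |(1 / 2 : ℝ)| ≤ 1 := by rw [abs_of_pos] <;> norm_num
  have p12' : |(-(1 / 2) : ℝ)| ≤ 1 := by rw [abs_neg]; exact p12
  have p1 : |(1 : ℝ)| ≤ 1 := by simp
  have p1' : |(-1 : ℝ)| ≤ 1 := by simp
  have c3 : (3 * Real.pi * I / 4 : ℂ) = ((3 * Real.pi / 4 : ℝ) : ℂ) * I := by push_cast; ring
  have imZ : ∀ z τ : ℂ, (logZeta z τ).im = 3 * Real.pi / 4 + arg τ / 2 +
      (log (z - 1 / 2)).im + (log (z + 1)).im / 2 := by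
    intro z τ
    simp only [logZeta, c3, add_im, ofReal_im, div_ofNat_im, im_ofReal_mul, I_im, log_im]
    ring
  have imX : ∀ z τ : ℂ, (logXi z τ).im = 3 * Real.pi / 4 + arg τ / 2 +
      ((log (z + 1 / 2)).im - Real.pi) + ((log (z - 1)).im - Real.pi) / 2 := by
    intro z τ
    simp only [logXi, c3, add_im, sub_im, ofReal_im, div_ofNat_im, im_ofReal_mul, I_im, log_im]
    ring
  have reZ : ∀ z τ : ℂ, (logZeta z τ).re = Real.log (4 / Real.sqrt 3) + Real.log ‖τ‖ / 2 +
      Real.log ‖z - 1 / 2‖ + Real.log ‖z + 1‖ / 2 := by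
    intro z τ
    simp only [logZeta, c3, add_re, ofReal_re, div_ofNat_re, re_ofReal_mul, I_re, log_re]
    ring
  have reX : ∀ z τ : ℂ, (logXi z τ).re = Real.log (4 / Real.sqrt 3) + Real.log ‖τ‖ / 2 +
      Real.log ‖z + 1 / 2‖ + Real.log ‖z - 1‖ / 2 := by
    intro z τ
    simp only [logXi, c3, add_re, sub_re, ofReal_re, div_ofNat_re, re_ofReal_mul, I_re, log_re]
    ring
  have hrZ : ∀ τ ∈ Metric.closedBall t ρ, ∀ z ∈ upperSector (κ / 2) R,
      |(logZeta z τ).re - 3 / 2 * Real.log ‖z‖| ≤ c := by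
    intro τ hτ z hz
    have a1 := (abs_lt.1 (hball hτ).2.2)
    have a2 := abs_le.1 (hshift z hz _ p12).2
    have a3 := abs_le.1 (hshift z hz _ p1').2
    rw [← e12'] at a2
    rw [← e1] at a3
    have a4 := abs_le.1 (le_refl |Real.log (4 / Real.sqrt 3)|)
    rw [reZ, abs_le]
    constructor <;> linarith
  have hrX : ∀ τ ∈ Metric.closedBall t ρ, ∀ z ∈ upperSector (κ / 2) R,
      |(logXi z τ).re - 3 / 2 * Real.log ‖z‖| ≤ c := by
    intro τ hτ z hz
    have a1 := (abs_lt.1 (hball hτ).2.2)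
    have a2 := abs_le.1 (hshift z hz _ p12').2
    have a3 := abs_le.1 (hshift z hz _ p1).2
    rw [← e12] at a2
    rw [← e1'] at a3
    have a4 := abs_le.1 (le_refl |Real.log (4 / Real.sqrt 3)|)
    rw [reX, abs_le]
    constructor <;> linarith
  refine ⟨ρ, κ / 2, R, η, c, hρ, by positivity, hR2, hη0, hc0, fun τ hτ => (hball hτ).1,
    ?_, ?_, hrZ, hrX, ?_, ?_⟩
  · intro τ hτ z hz
    have a1 := (abs_lt.1 (hball hτ).2.1)
    have a2 := abs_le.1 (hshift z hz _ p12).1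
    have a3 := abs_le.1 (hshift z hz _ p1').1
    rw [← e12'] at a2
    rw [← e1] at a3
    rw [imZ, abs_le]
    constructor <;> linarith
  · intro τ hτ z hz
    have a1 := (abs_lt.1 (hball hτ).2.1)
    have a2 := abs_le.1 (hshift z hz _ p12').1
    have a3 := abs_le.1 (hshift z hz _ p1).1
    rw [← e12] at a2
    rw [← e1'] at a3
    rw [imX, abs_le]
    constructor <;> linarith
  · intro τ hτ z hz
    have a1 := abs_le.1 (hrZ τ hτ z hz)
    have a2 := hlogz z hz
    linarith
  · intro τ hτ z hz
    have a1 := abs_le.1 (hrX τ hτ z hz)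
    have a2 := hlogz z hz
    linarith

theorem norm_exp_mul_le (p l : ℂ) {θ : ℝ} (hl : |l.im| ≤ θ) :
    ‖exp (p * l)‖ ≤ Real.exp (|p.im| * θ) * Real.exp (p.re * l.re) := by
  rw [Complex.norm_exp, ← Real.exp_add, Real.exp_le_exp, mul_re]
  have h : -(p.im * l.im) ≤ |p.im| * θ := by
    refine (neg_le_abs _).trans ?_
    rw [abs_mul]
    gcongr
  linarith

/-- The size of `e^{x²/4} D_p(x)` in a closed subsector of `|arg x| < 3π/4`. -/
theorem norm_pcfE_le {p : ℂ} (hp : p.re < 1) (hp0 : p ≠ 0) {η : ℝ} (hη : 0 < η) :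
    ∃ C : ℝ, 0 ≤ C ∧ ∀ l : ℂ, |l.im| ≤ 3 * Real.pi / 4 - η → 0 ≤ l.re →
      ‖pcfE p (exp l)‖ ≤ C * Real.exp (p.re * l.re) := by
  obtain ⟨C, hC, H⟩ := norm_pcfE_sub_le hp hp0 hη
  refine ⟨C + Real.exp (|p.im| * (3 * Real.pi / 4 - η)), by positivity, fun l hl hl0 => ?_⟩
  have h1 := H l hl hl0
  have h2 := norm_exp_mul_le p l hl
  have h3 : Real.exp ((p.re - 2) * l.re) ≤ Real.exp (p.re * l.re) := by
    rw [Real.exp_le_exp]; nlinarith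
  calc _ = ‖(pcfE p (exp l) - exp (p * l)) + exp (p * l)‖ := by rw [sub_add_cancel]
    _ ≤ C * Real.exp ((p.re - 2) * l.re) + _ := (norm_add_le _ _).trans (add_le_add h1 h2)
    _ ≤ C * Real.exp (p.re * l.re) + _ := by gcongr
    _ = _ := by ring

/-- `x^{-p} e^{x²/4} D_p(x) - 1 = O(x⁻²)`. -/
theorem norm_exp_mul_pcfE_sub_one_le {p : ℂ} (hp : p.re < 1) (hp0 : p ≠ 0) {η : ℝ}
    (hη : 0 < η) :
    ∃ C : ℝ, 0 ≤ C ∧ ∀ l : ℂ, |l.im| ≤ 3 * Real.pi / 4 - η → 0 ≤ l.re →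
      ‖exp (-p * l) * pcfE p (exp l) - 1‖ ≤ C * Real.exp (-2 * l.re) := by
  obtain ⟨C, hC, H⟩ := norm_pcfE_sub_le hp hp0 hη
  refine ⟨Real.exp (|(-p).im| * (3 * Real.pi / 4 - η)) * C, by positivity, fun l hl hl0 => ?_⟩
  have h1 := H l hl hl0
  have h2 := norm_exp_mul_le (-p) l hl
  have e : exp (-p * l) * pcfE p (exp l) - 1 =
      exp (-p * l) * (pcfE p (exp l) - exp (p * l)) := by
    rw [mul_sub, ← exp_add]; simp
  rw [e, norm_mul]
  calc _ ≤ Real.exp (|(-p).im| * (3 * Real.pi / 4 - η)) * Real.exp ((-p).re * l.re) *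
        (C * Real.exp ((p.re - 2) * l.re)) := by gcongr
    _ = Real.exp (|(-p).im| * (3 * Real.pi / 4 - η)) * C *
        (Real.exp ((-p).re * l.re) * Real.exp ((p.re - 2) * l.re)) := by ring
    _ = _ := by rw [← Real.exp_add, neg_re]; ring_nf

/-- `ζ² + ξ²` does not depend on `z`: the cubic terms cancel. -/
theorem zeta_sq_add_xi_sq {z t : ℂ} (ht : t ≠ 0) (hz : 0 < z.im) :
    zeta z t ^ 2 + xi z t ^ 2 = -(8 * I * t / 3) := by
  have h1 : z ≠ -1 := ne_of_im_pos hz (by simp)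
  have h2 : -z ≠ -1 := fun h => ne_of_im_pos hz (a := 1) (by simp) (neg_injective h)
  rw [xi, zeta_sq z t ht h1, zeta_sq (-z) t ht h2]
  ring

namespace SectorBounds

variable {t τ z : ℂ} {ρ κ R η K : ℝ}

theorem im_pos (hS : SectorBounds t ρ κ R η K) (hz : z ∈ upperSector κ R) : 0 < z.im := by
  have := hS.R_ge; have := hz.1; linarith

theorem two_le_norm (hS : SectorBounds t ρ κ R η K) (hz : z ∈ upperSector κ R) : 2 ≤ ‖z‖ :=
  hS.R_ge.trans (hz.1.trans ((le_abs_self _).trans (abs_im_le_norm z)))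

theorem time_ne_zero (hS : SectorBounds t ρ κ R η K) (hτ : τ ∈ Metric.closedBall t ρ) : τ ≠ 0 := by
  have := hS.re_pos τ hτ
  intro h; simp [h] at this

/-- `D_p(iζ) D_q(iξ)`: the exponential factors combine to a function of `t`. -/
theorem pcfD_I_mul (hS : SectorBounds t ρ κ R η K) (hτ : τ ∈ Metric.closedBall t ρ) (hz : z ∈ upperSector κ R) (p q : ℂ) :
    pcfD p (I * zeta z τ) * pcfD q (I * xi z τ) = exp (-(2 * I / 3 * τ)) *
      (pcfE p (exp (logZeta z τ - 3 * Real.pi / 2 * I)) *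
        pcfE q (exp (logXi z τ + Real.pi / 2 * I))) := by
  have h1 : I * zeta z τ = exp (logZeta z τ - 3 * Real.pi / 2 * I) := by
    have : (3 * Real.pi / 2 * I : ℂ) = Real.pi * I + Real.pi / 2 * I := by ring
    rw [exp_sub, exp_logZeta (hS.im_pos hz), this, exp_add, exp_pi_mul_I, exp_pi_div_two_mul_I,
      neg_one_mul, div_neg, div_I]
    ring
  have h2 : I * xi z τ = exp (logXi z τ + Real.pi / 2 * I) := by
    rw [exp_add, exp_logXi (hS.im_pos hz), exp_pi_div_two_mul_I]; ring
  have h3 := zeta_sq_add_xi_sq (hS.time_ne_zero hτ) (hS.im_pos hz)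
  rw [pcfD_eq_exp_mul_pcfE, pcfD_eq_exp_mul_pcfE, ← h1, ← h2]
  have h4 : exp (-(I * zeta z τ) ^ 2 / 4) * exp (-(I * xi z τ) ^ 2 / 4) =
      exp (-(2 * I / 3 * τ)) := by
    rw [← exp_add]
    congr 1
    simp only [mul_pow, I_sq]
    linear_combination h3 / 4
  rw [← h4]; ring

/-- `D_p(ζ) D_q(ξ)`: the exponential factors combine to a function of `t`. -/
theorem pcfD_mul (hS : SectorBounds t ρ κ R η K) (hτ : τ ∈ Metric.closedBall t ρ) (hz : z ∈ upperSector κ R) (p q : ℂ) :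
    pcfD p (zeta z τ) * pcfD q (xi z τ) = exp (2 * I / 3 * τ) *
      (pcfE p (exp (logZeta z τ - 2 * Real.pi * I)) * pcfE q (exp (logXi z τ))) := by
  have h1 : zeta z τ = exp (logZeta z τ - 2 * Real.pi * I) := by
    rw [exp_sub, exp_logZeta (hS.im_pos hz), exp_two_pi_mul_I, div_one]
  have h2 : xi z τ = exp (logXi z τ) := (exp_logXi (hS.im_pos hz) τ).symm
  have h3 := zeta_sq_add_xi_sq (hS.time_ne_zero hτ) (hS.im_pos hz)
  rw [pcfD_eq_exp_mul_pcfE, pcfD_eq_exp_mul_pcfE, ← h1, ← h2]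
  have h4 : exp (-zeta z τ ^ 2 / 4) * exp (-xi z τ ^ 2 / 4) = exp (2 * I / 3 * τ) := by
    rw [← exp_add]
    congr 1
    linear_combination -h3 / 4
  rw [← h4]; ring

theorem im_logZeta_sub (hS : SectorBounds t ρ κ R η K) (hτ : τ ∈ Metric.closedBall t ρ) (hz : z ∈ upperSector κ R) :
    |(logZeta z τ - 3 * Real.pi / 2 * I).im| ≤ 3 * Real.pi / 4 - η ∧
    |(logZeta z τ - 2 * Real.pi * I).im| ≤ 3 * Real.pi / 4 - η ∧
    |(logXi z τ + Real.pi / 2 * I).im| ≤ 3 * Real.pi / 4 - η ∧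
    |(logXi z τ).im| ≤ 3 * Real.pi / 4 - η := by
  have a1 := abs_le.1 (hS.im_zeta τ hτ z hz)
  have a2 := abs_le.1 (hS.im_xi τ hτ z hz)
  have c1 : (3 * Real.pi / 2 * I : ℂ).im = 3 * Real.pi / 2 := by
    rw [show (3 * Real.pi / 2 * I : ℂ) = ((3 * Real.pi / 2 : ℝ) : ℂ) * I by push_cast; ring,
      im_ofReal_mul, I_im, mul_one]
  have c2 : (2 * Real.pi * I : ℂ).im = 2 * Real.pi := by
    rw [show (2 * Real.pi * I : ℂ) = ((2 * Real.pi : ℝ) : ℂ) * I by push_cast; ring,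
      im_ofReal_mul, I_im, mul_one]
  have c3 : (Real.pi / 2 * I : ℂ).im = Real.pi / 2 := by
    rw [show (Real.pi / 2 * I : ℂ) = ((Real.pi / 2 : ℝ) : ℂ) * I by push_cast; ring,
      im_ofReal_mul, I_im, mul_one]
  have := Real.pi_pos
  rw [sub_im, sub_im, add_im, c1, c2, c3]
  refine ⟨?_, ?_, ?_, ?_⟩ <;> rw [abs_le] <;> constructor <;> linarith

theorem re_logZeta_sub (τ z : ℂ) :
    (logZeta z τ - 3 * Real.pi / 2 * I).re = (logZeta z τ).re ∧
    (logZeta z τ - 2 * Real.pi * I).re = (logZeta z τ).re ∧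
    (logXi z τ + Real.pi / 2 * I).re = (logXi z τ).re := by
  refine ⟨?_, ?_, ?_⟩
  · rw [show (3 * Real.pi / 2 * I : ℂ) = ((3 * Real.pi / 2 : ℝ) : ℂ) * I by push_cast; ring]
    simp
  · rw [show (2 * Real.pi * I : ℂ) = ((2 * Real.pi : ℝ) : ℂ) * I by push_cast; ring]
    simp
  · rw [show (Real.pi / 2 * I : ℂ) = ((Real.pi / 2 : ℝ) : ℂ) * I by push_cast; ring]
    simp

theorem exp_mul_re_le (hS : SectorBounds t ρ κ R η K) (s : ℝ) {x : ℝ} (hz : z ∈ upperSector κ R)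
    (hx : |x - 3 / 2 * Real.log ‖z‖| ≤ K) :
    Real.exp (s * x) ≤ Real.exp (|s| * K) * ‖z‖ ^ (3 / 2 * s) := by
  have hz0 : 0 < ‖z‖ := by have := hS.two_le_norm hz; linarith
  rw [Real.rpow_def_of_pos hz0, ← Real.exp_add, Real.exp_le_exp]
  have : s * (x - 3 / 2 * Real.log ‖z‖) ≤ |s| * K := by
    refine (le_abs_self _).trans ?_
    rw [abs_mul]
    gcongr
  linarith

/-- Both products have the size `|z| ^ (3/2 (Re p + Re q))`. -/
theorem exists_norm_pcfD_mul_le (hS : SectorBounds t ρ κ R η K) {p q : ℂ} (hp : p.re < 1) (hp0 : p ≠ 0) (hq : q.re < 1)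
    (hq0 : q ≠ 0) :
    ∃ C : ℝ, 0 ≤ C ∧ ∀ τ ∈ Metric.closedBall t ρ, ∀ z ∈ upperSector κ R,
      ‖pcfD p (I * zeta z τ) * pcfD q (I * xi z τ)‖ ≤ C * ‖z‖ ^ (3 / 2 * (p.re + q.re)) ∧
      ‖pcfD p (zeta z τ) * pcfD q (xi z τ)‖ ≤ C * ‖z‖ ^ (3 / 2 * (p.re + q.re)) := by
  obtain ⟨C₁, h₁, H₁⟩ := norm_pcfE_le hp hp0 hS.η_pos
  obtain ⟨C₂, h₂, H₂⟩ := norm_pcfE_le hq hq0 hS.η_pos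
  set M : ℝ := Real.exp (‖t‖ + ρ) with hM
  refine ⟨M * ((C₁ * Real.exp (|p.re| * K)) * (C₂ * Real.exp (|q.re| * K))), by positivity,
    fun τ hτ z hz => ?_⟩
  obtain ⟨i1, i2, i3, i4⟩ := hS.im_logZeta_sub hτ hz
  obtain ⟨r1, r2, r3⟩ := re_logZeta_sub τ z
  have n1 := hS.re_zeta_nonneg τ hτ z hz
  have n2 := hS.re_xi_nonneg τ hτ z hz
  have z0 : 0 < ‖z‖ := by have := hS.two_le_norm hz; linarith
  have hτn : ‖τ‖ ≤ ‖t‖ + ρ := by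
    have := norm_sub_norm_le τ t
    have h2 : ‖τ - t‖ ≤ ρ := by simpa [dist_eq_norm] using hτ
    linarith
  have hexp : ∀ w : ℂ, ‖w‖ ≤ ‖τ‖ → ‖exp w‖ ≤ M := fun w hw =>
    (norm_exp_le_exp_norm w).trans (Real.exp_le_exp.2 (hw.trans hτn))
  have hcoef : ‖(2 * I / 3 * τ : ℂ)‖ ≤ ‖τ‖ := by
    rw [norm_mul, norm_div, norm_mul, norm_I]
    norm_num
    nlinarith [norm_nonneg τ]
  have m1 := hexp (-(2 * I / 3 * τ)) (by rw [norm_neg]; exact hcoef)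
  have m2 := hexp (2 * I / 3 * τ) hcoef
  have z1 := hS.exp_mul_re_le p.re hz (hS.re_zeta τ hτ z hz)
  have z2 := hS.exp_mul_re_le q.re hz (hS.re_xi τ hτ z hz)
  have hsplit : ‖z‖ ^ (3 / 2 * (p.re + q.re)) = ‖z‖ ^ (3 / 2 * p.re) * ‖z‖ ^ (3 / 2 * q.re) := by
    rw [← Real.rpow_add z0]; ring_nf
  have key : ∀ a e₁ e₂ : ℂ, ‖a‖ ≤ M → ‖e₁‖ ≤ C₁ * Real.exp (p.re * (logZeta z τ).re) →
      ‖e₂‖ ≤ C₂ * Real.exp (q.re * (logXi z τ).re) →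
      ‖a * (e₁ * e₂)‖ ≤ M * ((C₁ * Real.exp (|p.re| * K)) * (C₂ * Real.exp (|q.re| * K))) *
        ‖z‖ ^ (3 / 2 * (p.re + q.re)) := by
    intro a e₁ e₂ ha h1 h2
    rw [norm_mul, norm_mul, hsplit]
    calc _ ≤ M * ((C₁ * (Real.exp (|p.re| * K) * ‖z‖ ^ (3 / 2 * p.re))) *
          (C₂ * (Real.exp (|q.re| * K) * ‖z‖ ^ (3 / 2 * q.re)))) := by
          gcongr
          · exact h1.trans (by gcongr)
          · exact h2.trans (by gcongr)
      _ = _ := by ring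
  constructor
  · rw [hS.pcfD_I_mul hτ hz]
    refine key _ _ _ m1 ?_ ?_
    · have := H₁ _ i1 (by rw [r1]; exact n1); rwa [r1] at this
    · have := H₂ _ i3 (by rw [r3]; exact n2); rwa [r3] at this
  · rw [hS.pcfD_mul hτ hz]
    refine key _ _ _ m2 ?_ ?_
    · have := H₁ _ i2 (by rw [r2]; exact n1); rwa [r2] at this
    · exact H₂ _ i4 n2

end SectorBounds

/-! ### The order `ν` -/

theorem nu_re (s₁ s₃ : ℂ) : (nu s₁ s₃).re = -arg (1 - s₁ * s₃) / (2 * Real.pi) := by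
  have h : nu s₁ s₃ = ((1 / (2 * Real.pi) : ℝ) : ℂ) * (I * log (1 - s₁ * s₃)) := by
    have : (Real.pi : ℂ) ≠ 0 := ofReal_ne_zero.2 Real.pi_ne_zero
    unfold nu
    push_cast
    field_simp
    rw [I_sq, neg_one_mul]
  rw [h, re_ofReal_mul]
  simp [log_im]
  ring

theorem abs_nu_re_lt {s₁ s₃ : ℂ} (hs : 1 - s₁ * s₃ ∈ slitPlane) : |(nu s₁ s₃).re| < 1 / 2 := by
  have h1 : |arg (1 - s₁ * s₃)| < Real.pi := by
    rw [abs_lt]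
    exact ⟨neg_pi_lt_arg _, lt_of_le_of_ne (arg_le_pi _) (mem_slitPlane_iff_arg.1 hs).1⟩
  rw [nu_re, abs_div, abs_neg, abs_of_pos Real.two_pi_pos, div_lt_iff₀ Real.two_pi_pos]
  linarith

theorem nu_ne_zero {s₁ s₃ : ℂ} (hs₁ : s₁ ≠ 0) (hs₃ : s₃ ≠ 0) (hs : 1 - s₁ * s₃ ∈ slitPlane) :
    nu s₁ s₃ ≠ 0 := by
  intro h
  have h1 : log (1 - s₁ * s₃) = 0 := by
    have hc : -(1 / (2 * Real.pi * I) : ℂ) ≠ 0 :=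
      neg_ne_zero.2 (one_div_ne_zero two_pi_I_ne_zero)
    exact (mul_eq_zero.1 h).resolve_left hc
  have h2 := exp_log (slitPlane_ne_zero hs)
  rw [h1, exp_zero] at h2
  exact mul_ne_zero hs₁ hs₃ (by linear_combination h2)

theorem jumpA_neg (s₁ s₃ z t : ℂ) : jumpA s₁ s₃ (-z) t = jumpA s₁ s₃ z t := by
  simp only [jumpA, xi, neg_neg]
  ring_nf

theorem jumpC_neg (s₁ s₃ z t : ℂ) : jumpC s₁ s₃ (-z) t = jumpB s₁ s₃ z t := by
  rw [jumpC, neg_neg]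

/-- The decay exponent of the jumps. -/
def decay (s₁ s₃ : ℂ) : ℝ := 1 - 2 * |(nu s₁ s₃).re|

theorem decay_pos {s₁ s₃ : ℂ} (hs : 1 - s₁ * s₃ ∈ slitPlane) : 0 < decay s₁ s₃ := by
  have := abs_nu_re_lt hs
  unfold decay; linarith

theorem decay_le_one (s₁ s₃ : ℂ) : decay s₁ s₃ ≤ 1 := by
  have := abs_nonneg (nu s₁ s₃).re
  unfold decay; linarith

namespace SectorBounds

variable {s₁ s₃ t τ z : ℂ} {ρ κ R η K : ℝ}

theorem norm_exp_time_le (hτ : τ ∈ Metric.closedBall t ρ) :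
    ‖exp (2 * I / 3 * τ)‖ ≤ Real.exp (‖t‖ + ρ) := by
  have hτn : ‖τ‖ ≤ ‖t‖ + ρ := by
    have := norm_sub_norm_le τ t
    have h2 : ‖τ - t‖ ≤ ρ := by simpa [dist_eq_norm] using hτ
    linarith
  have hcoef : ‖(2 * I / 3 * τ : ℂ)‖ ≤ ‖τ‖ := by
    rw [norm_mul, norm_div, norm_mul, norm_I]
    norm_num
    nlinarith [norm_nonneg τ]
  exact (norm_exp_le_exp_norm _).trans (Real.exp_le_exp.2 (hcoef.trans hτn))

theorem logRight_add (hS : SectorBounds t ρ κ R η K) (hz : z ∈ upperSector κ R) (τ : ℂ) :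
    logRight z τ + logRight (-z) τ = logZeta z τ + logXi z τ := by
  rw [logRight_eq, logRight_neg_eq (hS.im_pos hz)]; ring

theorem rpow_le (hS : SectorBounds t ρ κ R η K) (hz : z ∈ upperSector κ R) {a b : ℝ}
    (h : a ≤ b) : ‖z‖ ^ a ≤ ‖z‖ ^ b :=
  Real.rpow_le_rpow_of_exponent_le (by have := hS.two_le_norm hz; linarith) h

theorem exists_norm_jumpA_sub_one_le (hS : SectorBounds t ρ κ R η K) (hs₁ : s₁ ≠ 0)
    (hs₃ : s₃ ≠ 0) (hs : 1 - s₁ * s₃ ∈ slitPlane) :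
    ∃ C : ℝ, 0 ≤ C ∧ ∀ τ ∈ Metric.closedBall t ρ, ∀ z ∈ upperSector κ R,
      ‖jumpA s₁ s₃ z τ - 1‖ ≤ C * ‖z‖ ^ (-decay s₁ s₃) := by
  have hν0 := nu_ne_zero hs₁ hs₃ hs
  have hδ1 : -decay s₁ s₃ = 2 * |(nu s₁ s₃).re| - 1 := by unfold decay; ring
  obtain ⟨hr1, hr2⟩ := abs_lt.1 (abs_nu_re_lt hs)
  have hr3 := le_abs_self (nu s₁ s₃).re
  have hr4 := neg_le_abs (nu s₁ s₃).re
  have hr5 := abs_nu_re_lt hs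
  have hν1 : nu s₁ s₃ - 1 ≠ 0 := fun h => by
    have := congrArg Complex.re h
    simp at this; linarith
  obtain ⟨C₁, h₁, H₁⟩ := norm_exp_mul_pcfE_sub_one_le (p := -nu s₁ s₃) (by simp; linarith)
    (neg_ne_zero.2 hν0) hS.η_pos
  obtain ⟨C₂, h₂, H₂⟩ := hS.exists_norm_pcfD_mul_le (p := nu s₁ s₃ - 1) (q := nu s₁ s₃ - 1)
    (by simp; linarith) hν1 (by simp; linarith) hν1
  set ν := nu s₁ s₃ with hν
  set D := C₁ * Real.exp (|(-2 : ℝ)| * K) with hD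
  have hD0 : 0 ≤ D := by positivity
  set k : ℂ := ν ^ 2 / hSq s₁ s₃ ^ 2 * exp (2 * Real.pi * I * ν) with hk
  set E := Real.exp (|ν.im| * (2 * Real.pi)) * (Real.exp (|ν.re| * K) * Real.exp (|ν.re| * K))
    with hE
  refine ⟨(D * D + D + D) + E * Real.exp (‖t‖ + ρ) * (‖k‖ * C₂), by positivity,
    fun τ hτ z hz => ?_⟩
  obtain ⟨i1, i2, i3, i4⟩ := hS.im_logZeta_sub hτ hz
  obtain ⟨r1, r2, r3⟩ := re_logZeta_sub τ z
  have n1 := hS.re_zeta_nonneg τ hτ z hz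
  have n2 := hS.re_xi_nonneg τ hτ z hz
  have z0 : 0 < ‖z‖ := by have := hS.two_le_norm hz; linarith
  set l₁ := logZeta z τ - 3 * Real.pi / 2 * I with hl₁
  set l₂ := logXi z τ + Real.pi / 2 * I with hl₂
  set X₁ := exp (- -ν * l₁) * pcfE (-ν) (exp l₁) with hX₁
  set X₂ := exp (- -ν * l₂) * pcfE (-ν) (exp l₂) with hX₂
  have hpow : ‖z‖ ^ (3 / 2 * (-2) : ℝ) ≤ ‖z‖ ^ (-decay s₁ s₃) := hS.rpow_le hz (by linarith)
  have hpow1 : ‖z‖ ^ (-decay s₁ s₃) ≤ 1 := by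
    have := hS.rpow_le hz (a := -decay s₁ s₃) (b := 0) (by linarith)
    simpa using this
  have b1 : ‖X₁ - 1‖ ≤ D * ‖z‖ ^ (-decay s₁ s₃) := by
    refine (H₁ l₁ i1 (by rw [r1]; exact n1)).trans ?_
    rw [r1, hD, mul_assoc]
    gcongr
    exact (hS.exp_mul_re_le (-2) hz (hS.re_zeta τ hτ z hz)).trans (by gcongr)
  have b2 : ‖X₂ - 1‖ ≤ D * ‖z‖ ^ (-decay s₁ s₃) := by
    refine (H₁ l₂ i3 (by rw [r3]; exact n2)).trans ?_
    rw [r3, hD, mul_assoc]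
    gcongr
    exact (hS.exp_mul_re_le (-2) hz (hS.re_xi τ hτ z hz)).trans (by gcongr)
  have b1' : ‖X₁ - 1‖ ≤ D := b1.trans (mul_le_of_le_one_right hD0 hpow1)
  -- the prefactor
  have bE : ‖exp (ν * (logRight z τ + logRight (-z) τ))‖ ≤ E * ‖z‖ ^ (3 * ν.re) := by
    rw [hS.logRight_add hz]
    have him : |(logZeta z τ + logXi z τ).im| ≤ 2 * Real.pi := by
      have a1 := abs_le.1 (hS.im_zeta τ hτ z hz)
      have a2 := abs_le.1 (hS.im_xi τ hτ z hz)
      have := hS.η_pos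
      rw [add_im, abs_le]
      constructor <;> linarith [Real.pi_pos]
    refine (norm_exp_mul_le ν _ him).trans ?_
    rw [add_re, mul_add, Real.exp_add, hE]
    have k1 := hS.exp_mul_re_le ν.re hz (hS.re_zeta τ hτ z hz)
    have k2 := hS.exp_mul_re_le ν.re hz (hS.re_xi τ hτ z hz)
    have k3 : ‖z‖ ^ (3 * ν.re) = ‖z‖ ^ (3 / 2 * ν.re) * ‖z‖ ^ (3 / 2 * ν.re) := by
      rw [← Real.rpow_add z0]; ring_nf
    calc _ ≤ Real.exp (|ν.im| * (2 * Real.pi)) * ((Real.exp (|ν.re| * K) *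
          ‖z‖ ^ (3 / 2 * ν.re)) * (Real.exp (|ν.re| * K) * ‖z‖ ^ (3 / 2 * ν.re))) := by gcongr
      _ = _ := by rw [k3]; ring
  -- the two terms
  have hterm1 : exp (ν * (logRight z τ + logRight (-z) τ)) * exp (2 * I / 3 * τ) *
      (exp (-Real.pi * I * ν) * pcfD (-ν) (I * zeta z τ) * pcfD (-ν) (I * xi z τ)) =
      X₁ * X₂ := by
    rw [mul_assoc (exp (-Real.pi * I * ν)), hS.pcfD_I_mul hτ hz, hS.logRight_add hz, hX₁, hX₂]
    have e1 : exp (ν * (logZeta z τ + logXi z τ)) * exp (-Real.pi * I * ν) =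
        exp (- -ν * l₁) * exp (- -ν * l₂) := by
      rw [← exp_add, ← exp_add, hl₁, hl₂]
      congr 1; ring
    have e2 : exp (2 * I / 3 * τ) * exp (-(2 * I / 3 * τ)) = 1 := by
      rw [← exp_add]; simp
    linear_combination (exp (2 * I / 3 * τ) * exp (-(2 * I / 3 * τ)) * pcfE (-ν) (exp l₁) *
      pcfE (-ν) (exp l₂)) * e1 + (exp (- -ν * l₁) * exp (- -ν * l₂) * pcfE (-ν) (exp l₁) *
      pcfE (-ν) (exp l₂)) * e2
  have hdec : jumpA s₁ s₃ z τ - 1 = ((X₁ - 1) * (X₂ - 1) + (X₁ - 1) + (X₂ - 1)) +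
      exp (ν * (logRight z τ + logRight (-z) τ)) * exp (2 * I / 3 * τ) *
        (k * (pcfD (ν - 1) (zeta z τ) * pcfD (ν - 1) (xi z τ))) := by
    rw [jumpA, mul_add, hterm1]
    ring
  rw [hdec]
  have b3 : ‖(X₁ - 1) * (X₂ - 1) + (X₁ - 1) + (X₂ - 1)‖ ≤
      (D * D + D + D) * ‖z‖ ^ (-decay s₁ s₃) := by
    refine (norm_add₃_le).trans ?_
    rw [norm_mul]
    calc _ ≤ D * (D * ‖z‖ ^ (-decay s₁ s₃)) + D * ‖z‖ ^ (-decay s₁ s₃) +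
          D * ‖z‖ ^ (-decay s₁ s₃) := by gcongr
      _ = _ := by ring
  have b4 : ‖exp (ν * (logRight z τ + logRight (-z) τ)) * exp (2 * I / 3 * τ) *
        (k * (pcfD (ν - 1) (zeta z τ) * pcfD (ν - 1) (xi z τ)))‖ ≤
      E * Real.exp (‖t‖ + ρ) * (‖k‖ * C₂) * ‖z‖ ^ (-decay s₁ s₃) := by
    rw [norm_mul, norm_mul, norm_mul]
    have hsum : ‖z‖ ^ (3 * ν.re) * ‖z‖ ^ (3 / 2 * ((ν - 1).re + (ν - 1).re)) ≤
        ‖z‖ ^ (-decay s₁ s₃) := by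
      rw [← Real.rpow_add z0]
      refine hS.rpow_le hz ?_
      rw [sub_re, one_re, hδ1]
      linarith
    calc _ ≤ (E * ‖z‖ ^ (3 * ν.re)) * Real.exp (‖t‖ + ρ) *
          (‖k‖ * (C₂ * ‖z‖ ^ (3 / 2 * ((ν - 1).re + (ν - 1).re)))) := by
          gcongr
          · exact norm_exp_time_le hτ
          · exact (H₂ τ hτ z hz).2
      _ = E * Real.exp (‖t‖ + ρ) * (‖k‖ * C₂) *
          (‖z‖ ^ (3 * ν.re) * ‖z‖ ^ (3 / 2 * ((ν - 1).re + (ν - 1).re))) := by ring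
      _ ≤ _ := by gcongr
  refine (norm_add_le _ _).trans ((add_le_add b3 b4).trans_eq ?_)
  ring

/-- The prefactor of the off-diagonal entries is bounded. -/
theorem exists_norm_logRight_sub_le (hS : SectorBounds t ρ κ R η K) :
    ∃ C : ℝ, 0 ≤ C ∧ ∀ τ ∈ Metric.closedBall t ρ, ∀ z ∈ upperSector κ R,
      ‖logRight z τ - logRight (-z) τ‖ ≤ C := by
  refine ⟨(2 * K + 4 * Real.log 2) + 7 * Real.pi, ?_, fun τ hτ z hz => ?_⟩
  · have := hS.K_nonneg
    have := Real.log_pos one_lt_two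
    positivity
  have e : logRight z τ - logRight (-z) τ =
      (logZeta z τ - logXi z τ) + ((2 : ℝ) : ℂ) * (log (z + 1 / 2) - log (z - 1 / 2)) := by
    rw [logRight_eq, logRight_neg_eq (hS.im_pos hz)]; push_cast; ring
  have a1 := abs_le.1 (hS.im_zeta τ hτ z hz)
  have a2 := abs_le.1 (hS.im_xi τ hτ z hz)
  have a3 := abs_le.1 (hS.re_zeta τ hτ z hz)
  have a4 := abs_le.1 (hS.re_xi τ hτ z hz)
  have h2 := hS.two_le_norm hz
  have hz0 : z ≠ 0 := norm_pos_iff.1 (by linarith)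
  have a5 := abs_le.1 (abs_log_norm_sub_le (z := z) (a := 1 / 2) (by norm_num; linarith) hz0)
  have a6 := abs_le.1 (abs_log_norm_sub_le (z := z) (a := -(1 / 2)) (by norm_num; linarith) hz0)
  rw [sub_neg_eq_add] at a6
  have a7 := abs_le.1 (abs_arg_le_pi (z + 1 / 2))
  have a8 := abs_le.1 (abs_arg_le_pi (z - 1 / 2))
  rw [e]
  refine (norm_le_abs_re_add_abs_im _).trans (add_le_add ?_ ?_)
  · rw [add_re, sub_re, re_ofReal_mul, sub_re, log_re, log_re, abs_le]
    constructor <;> linarith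
  · have := hS.η_pos
    have := Real.pi_pos
    rw [add_im, sub_im, im_ofReal_mul, sub_im, log_im, log_im, abs_le]
    constructor <;> linarith

theorem exists_norm_jumpB_le (hS : SectorBounds t ρ κ R η K) (hs₁ : s₁ ≠ 0)
    (hs₃ : s₃ ≠ 0) (hs : 1 - s₁ * s₃ ∈ slitPlane) :
    ∃ C : ℝ, 0 ≤ C ∧ ∀ τ ∈ Metric.closedBall t ρ, ∀ z ∈ upperSector κ R,
      ‖jumpB s₁ s₃ z τ‖ ≤ C * ‖z‖ ^ (-decay s₁ s₃) ∧
      ‖jumpC s₁ s₃ z τ‖ ≤ C * ‖z‖ ^ (-decay s₁ s₃) := by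
  have hν0 := nu_ne_zero hs₁ hs₃ hs
  have hδ1 : -decay s₁ s₃ = 2 * |(nu s₁ s₃).re| - 1 := by unfold decay; ring
  obtain ⟨hr1, hr2⟩ := abs_lt.1 (abs_nu_re_lt hs)
  have hr3 := le_abs_self (nu s₁ s₃).re
  have hr4 := neg_le_abs (nu s₁ s₃).re
  have hr5 := abs_nu_re_lt hs
  have hν1 : nu s₁ s₃ - 1 ≠ 0 := fun h => by
    have := congrArg Complex.re h
    simp at this; linarith
  have hν2 : -nu s₁ s₃ - 1 ≠ 0 := fun h => by
    have := congrArg Complex.re h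
    simp at this; linarith
  have q1 : (-nu s₁ s₃).re < 1 := by simp; linarith
  have q2 : (-nu s₁ s₃ - 1).re < 1 := by simp; linarith
  have q3 : (nu s₁ s₃).re < 1 := by linarith
  have q4 : (nu s₁ s₃ - 1).re < 1 := by simp; linarith
  obtain ⟨C₁, h₁, H₁⟩ := hS.exists_norm_pcfD_mul_le q1 (neg_ne_zero.2 hν0) q2 hν2
  obtain ⟨C₂, h₂, H₂⟩ := hS.exists_norm_pcfD_mul_le q4 hν1 q3 hν0
  obtain ⟨C₃, h₃, H₃⟩ := hS.exists_norm_pcfD_mul_le q2 hν2 q1 (neg_ne_zero.2 hν0)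
  obtain ⟨C₄, h₄, H₄⟩ := hS.exists_norm_pcfD_mul_le q3 hν0 q4 hν1
  obtain ⟨C₅, h₅, H₅⟩ := hS.exists_norm_logRight_sub_le
  set ν := nu s₁ s₃ with hν
  set k₁ : ℂ := I * hSq s₁ s₃ * exp (-Real.pi * I * ν) with hk₁
  set k₂ : ℂ := ν / hSq s₁ s₃ * exp (2 * Real.pi * I * ν) with hk₂
  refine ⟨Real.exp (‖ν‖ * C₅) * (‖k₁‖ * (C₁ + C₃) + ‖k₂‖ * (C₂ + C₄)), by positivity,
    fun τ hτ z hz => ?_⟩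
  have key : ∀ w a b : ℂ, ‖w‖ ≤ C₅ → ‖a‖ ≤ (C₁ + C₃) * ‖z‖ ^ (-decay s₁ s₃) →
      ‖b‖ ≤ (C₂ + C₄) * ‖z‖ ^ (-decay s₁ s₃) → ‖exp (ν * w) * (k₁ * a + k₂ * b)‖ ≤
      Real.exp (‖ν‖ * C₅) * (‖k₁‖ * (C₁ + C₃) + ‖k₂‖ * (C₂ + C₄)) * ‖z‖ ^ (-decay s₁ s₃) := by
    intro w a b hw ha hb
    rw [norm_mul]
    have e1 : ‖exp (ν * w)‖ ≤ Real.exp (‖ν‖ * C₅) := by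
      refine (norm_exp_le_exp_norm _).trans (Real.exp_le_exp.2 ?_)
      rw [norm_mul]; gcongr
    calc _ ≤ Real.exp (‖ν‖ * C₅) * (‖k₁‖ * ((C₁ + C₃) * ‖z‖ ^ (-decay s₁ s₃)) +
          ‖k₂‖ * ((C₂ + C₄) * ‖z‖ ^ (-decay s₁ s₃))) := by
          refine mul_le_mul e1 ?_ (norm_nonneg _) (Real.exp_pos _).le
          refine (norm_add_le _ _).trans ?_
          rw [norm_mul k₁, norm_mul k₂]
          gcongr
      _ = _ := by ring
  have hp1 : ∀ C C' x a : ℝ, 0 ≤ C' → 0 ≤ C → a ≤ -decay s₁ s₃ → x ≤ C * ‖z‖ ^ a →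
      x ≤ (C + C') * ‖z‖ ^ (-decay s₁ s₃) := by
    intro C C' x a hC' hC ha hx
    exact hx.trans (mul_le_mul (by linarith) (hS.rpow_le hz ha) (by positivity)
      (by linarith))
  constructor
  · have e : jumpB s₁ s₃ z τ = exp (ν * (logRight z τ - logRight (-z) τ)) *
        (k₁ * (pcfD (-ν) (I * zeta z τ) * pcfD (-ν - 1) (I * xi z τ)) +
          k₂ * (pcfD (ν - 1) (zeta z τ) * pcfD ν (xi z τ))) := by
      rw [jumpB]; ring
    rw [e]
    refine key _ _ _ (H₅ τ hτ z hz) (hp1 _ _ _ _ h₃ h₁ ?_ (H₁ τ hτ z hz).1)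
      (hp1 _ _ _ _ h₄ h₂ ?_ (H₂ τ hτ z hz).2)
    · simp only [sub_re, neg_re, one_re, hδ1]; linarith
    · simp only [sub_re, one_re, hδ1]; linarith
  · have e : jumpC s₁ s₃ z τ = exp (ν * (logRight (-z) τ - logRight z τ)) *
        (k₁ * (pcfD (-ν - 1) (I * zeta z τ) * pcfD (-ν) (I * xi z τ)) +
          k₂ * (pcfD ν (zeta z τ) * pcfD (ν - 1) (xi z τ))) := by
      simp only [jumpC, jumpB, xi, neg_neg]; ring
    rw [e]
    refine key _ _ _ ?_ (hp1 C₃ C₁ _ _ h₁ h₃ ?_ (H₃ τ hτ z hz).1 |>.trans_eq (by ring))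
      (hp1 C₄ C₂ _ _ h₂ h₄ ?_ (H₄ τ hτ z hz).2 |>.trans_eq (by ring))
    · rw [norm_sub_rev]; exact H₅ τ hτ z hz
    · simp only [sub_re, neg_re, one_re, hδ1]; linarith
    · simp only [sub_re, one_re, hδ1]; linarith

end SectorBounds

/-- The part of a double sector around the imaginary axis with `|Im z| ≥ R`. -/
def farSector (κ R : ℝ) : Set ℂ := {z | R ≤ |z.im| ∧ |z.re| ≤ κ * |z.im|}

theorem farSector_subset {κ R : ℝ} {z : ℂ} (hz : z ∈ farSector κ R) :
    z ∈ upperSector κ R ∨ -z ∈ upperSector κ R := by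
  rcases le_total 0 z.im with h | h
  · left
    obtain ⟨h1, h2⟩ := hz
    rw [abs_of_nonneg h] at h1 h2
    exact ⟨h1, h2⟩
  · right
    obtain ⟨h1, h2⟩ := hz
    rw [abs_of_nonpos h] at h1 h2
    exact ⟨by simpa using h1, by simpa using h2⟩

/-- The jump matrix tends to the identity at a power rate in a double sector around the
imaginary axis, uniformly for times near `t`. -/
theorem exists_jump_bounds {s₁ s₃ t : ℂ} (hs₁ : s₁ ≠ 0) (hs₃ : s₃ ≠ 0)
    (hs : 1 - s₁ * s₃ ∈ slitPlane) (ht : 0 < t.re) :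
    ∃ ρ κ R C : ℝ, 0 < ρ ∧ 0 < κ ∧ 2 ≤ R ∧ 0 ≤ C ∧
      (∀ τ ∈ Metric.closedBall t ρ, 0 < τ.re) ∧
      ∀ τ ∈ Metric.closedBall t ρ, ∀ z ∈ farSector κ R,
        ‖jumpA s₁ s₃ z τ - 1‖ ≤ C * ‖z‖ ^ (-decay s₁ s₃) ∧
        ‖jumpB s₁ s₃ z τ‖ ≤ C * ‖z‖ ^ (-decay s₁ s₃) ∧
        ‖jumpC s₁ s₃ z τ‖ ≤ C * ‖z‖ ^ (-decay s₁ s₃) := by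
  obtain ⟨ρ, κ, R, η, K, hS⟩ := exists_sectorBounds ht
  obtain ⟨C₁, h₁, H₁⟩ := hS.exists_norm_jumpA_sub_one_le hs₁ hs₃ hs
  obtain ⟨C₂, h₂, H₂⟩ := hS.exists_norm_jumpB_le hs₁ hs₃ hs
  refine ⟨ρ, κ, R, C₁ + C₂, hS.ρ_pos, hS.κ_pos, hS.R_ge, by positivity, hS.re_pos,
    fun τ hτ z hz => ?_⟩
  have key : ∀ w ∈ upperSector κ R, ‖jumpA s₁ s₃ w τ - 1‖ ≤ (C₁ + C₂) * ‖w‖ ^ (-decay s₁ s₃) ∧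
        ‖jumpB s₁ s₃ w τ‖ ≤ (C₁ + C₂) * ‖w‖ ^ (-decay s₁ s₃) ∧
        ‖jumpC s₁ s₃ w τ‖ ≤ (C₁ + C₂) * ‖w‖ ^ (-decay s₁ s₃) := by
    intro w hw
    have hp : 0 ≤ ‖w‖ ^ (-decay s₁ s₃) := by positivity
    have a := H₁ τ hτ w hw
    have b := H₂ τ hτ w hw
    have c1 := mul_nonneg h₁ hp
    have c2 := mul_nonneg h₂ hp
    rw [add_mul]
    exact ⟨by linarith, by linarith [b.1], by linarith [b.2]⟩
  rcases farSector_subset hz with h | h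
  · exact key z h
  · have := key (-z) h
    rw [jumpA_neg, jumpC_neg, norm_neg] at this
    have e : jumpB s₁ s₃ (-z) τ = jumpC s₁ s₃ z τ := rfl
    rw [e] at this
    exact ⟨this.1, this.2.2, this.2.1⟩

/-! ### Analyticity of the jump matrix -/

/-- The plane without the two rays of the real axis on which the jump matrix has its cuts. -/
def cutPlane : Set ℂ := {z | z + 1 / 2 ∈ slitPlane ∧ -z + 1 / 2 ∈ slitPlane}

theorem mem_cutPlane_iff {z : ℂ} : z ∈ cutPlane ↔ z.im ≠ 0 ∨ |z.re| < 1 / 2 := by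
  simp only [cutPlane, Set.mem_ofPred_eq, mem_slitPlane_iff, add_re, add_im, neg_re, neg_im,
    one_div, inv_re, inv_im, re_ofNat, im_ofNat, normSq_ofNat, neg_zero, zero_div, add_zero,
    abs_lt]
  norm_num
  constructor
  · rintro ⟨h1 | h1, h2 | h2⟩
    · right; constructor <;> linarith
    all_goals exact Or.inl (by assumption)
  · rintro (h | ⟨h1, h2⟩)
    · exact ⟨Or.inr h, Or.inr h⟩
    · exact ⟨Or.inl (by linarith), Or.inl (by linarith)⟩

theorem isOpen_cutPlane : IsOpen cutPlane :=
  (isOpen_slitPlane.preimage (by fun_prop : Continuous fun z : ℂ => z + 1 / 2)).inter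
    (isOpen_slitPlane.preimage (by fun_prop : Continuous fun z : ℂ => -z + 1 / 2))

theorem neg_mem_cutPlane {z : ℂ} (hz : z ∈ cutPlane) : -z ∈ cutPlane :=
  ⟨hz.2, by simpa using hz.1⟩

theorem add_one_mem_slitPlane {z : ℂ} (hz : z ∈ cutPlane) : z + 1 ∈ slitPlane := by
  rcases mem_slitPlane_iff.1 hz.1 with h | h
  · refine mem_slitPlane_iff.2 (Or.inl ?_)
    simp at h ⊢; linarith
  · refine mem_slitPlane_iff.2 (Or.inr ?_)
    simpa using h

section Joint

variable {p : ℂ × ℂ}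

theorem differentiableAt_zeta (hz : p.1 ∈ cutPlane) (ht : p.2 ∈ slitPlane) :
    DifferentiableAt ℂ (fun p : ℂ × ℂ => zeta p.1 p.2) p := by
  have h1 : DifferentiableAt ℂ (fun p : ℂ × ℂ => log p.2) p := differentiableAt_snd.clog ht
  have h2 : DifferentiableAt ℂ (fun p : ℂ × ℂ => log (p.1 + 1)) p :=
    (differentiableAt_fst.add_const 1).clog (add_one_mem_slitPlane hz)
  unfold zeta
  fun_prop

theorem differentiableAt_logRight (hz : p.1 ∈ cutPlane) (ht : p.2 ∈ slitPlane) :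
    DifferentiableAt ℂ (fun p : ℂ × ℂ => logRight p.1 p.2) p := by
  have h1 : DifferentiableAt ℂ (fun p : ℂ × ℂ => log p.2) p := differentiableAt_snd.clog ht
  have h2 : DifferentiableAt ℂ (fun p : ℂ × ℂ => log (p.1 + 1)) p :=
    (differentiableAt_fst.add_const 1).clog (add_one_mem_slitPlane hz)
  have h3 : DifferentiableAt ℂ (fun p : ℂ × ℂ => log (p.1 + 1 / 2)) p :=
    (differentiableAt_fst.add_const (1 / 2)).clog hz.1
  unfold logRight
  fun_prop

theorem differentiableAt_comp_neg {f : ℂ → ℂ → ℂ}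
    (h : DifferentiableAt ℂ (fun p : ℂ × ℂ => f p.1 p.2) (-p.1, p.2)) :
    DifferentiableAt ℂ (fun p : ℂ × ℂ => f (-p.1) p.2) p := by
  have hg : DifferentiableAt ℂ (fun p : ℂ × ℂ => ((-p.1, p.2) : ℂ × ℂ)) p := by fun_prop
  exact DifferentiableAt.comp p (g := fun p : ℂ × ℂ => f p.1 p.2)
    (f := fun p : ℂ × ℂ => ((-p.1, p.2) : ℂ × ℂ)) h hg

theorem differentiableAt_jumpA (s₁ s₃ : ℂ) (hz : p.1 ∈ cutPlane) (ht : p.2 ∈ slitPlane) :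
    DifferentiableAt ℂ (fun p : ℂ × ℂ => jumpA s₁ s₃ p.1 p.2) p := by
  have h1 := differentiableAt_zeta hz ht
  have h2 : DifferentiableAt ℂ (fun p : ℂ × ℂ => xi p.1 p.2) p :=
    differentiableAt_comp_neg (differentiableAt_zeta (p := (-p.1, p.2)) (neg_mem_cutPlane hz) ht)
  have h3 := differentiableAt_logRight hz ht
  have h4 : DifferentiableAt ℂ (fun p : ℂ × ℂ => logRight (-p.1) p.2) p :=
    differentiableAt_comp_neg
      (differentiableAt_logRight (p := (-p.1, p.2)) (neg_mem_cutPlane hz) ht)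
  have hD : ∀ (q : ℂ) {g : ℂ × ℂ → ℂ}, DifferentiableAt ℂ g p →
      DifferentiableAt ℂ (fun p => pcfD q (g p)) p := fun q g hg =>
    (differentiable_pcfD q (g p)).comp p hg
  have d1 := hD (-nu s₁ s₃) (h1.const_mul I)
  have d2 := hD (-nu s₁ s₃) (h2.const_mul I)
  have d3 := hD (nu s₁ s₃ - 1) h1
  have d4 := hD (nu s₁ s₃ - 1) h2
  unfold jumpA
  fun_prop

theorem differentiableAt_jumpB (s₁ s₃ : ℂ) (hz : p.1 ∈ cutPlane) (ht : p.2 ∈ slitPlane) :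
    DifferentiableAt ℂ (fun p : ℂ × ℂ => jumpB s₁ s₃ p.1 p.2) p := by
  have h1 := differentiableAt_zeta hz ht
  have h2 : DifferentiableAt ℂ (fun p : ℂ × ℂ => xi p.1 p.2) p :=
    differentiableAt_comp_neg (differentiableAt_zeta (p := (-p.1, p.2)) (neg_mem_cutPlane hz) ht)
  have h3 := differentiableAt_logRight hz ht
  have h4 : DifferentiableAt ℂ (fun p : ℂ × ℂ => logRight (-p.1) p.2) p :=
    differentiableAt_comp_neg
      (differentiableAt_logRight (p := (-p.1, p.2)) (neg_mem_cutPlane hz) ht)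
  have hD : ∀ (q : ℂ) {g : ℂ × ℂ → ℂ}, DifferentiableAt ℂ g p →
      DifferentiableAt ℂ (fun p => pcfD q (g p)) p := fun q g hg =>
    (differentiable_pcfD q (g p)).comp p hg
  have d1 := hD (-nu s₁ s₃) (h1.const_mul I)
  have d2 := hD (-nu s₁ s₃ - 1) (h2.const_mul I)
  have d3 := hD (nu s₁ s₃ - 1) h1
  have d4 := hD (nu s₁ s₃) h2
  unfold jumpB
  fun_prop

theorem differentiableAt_jumpC (s₁ s₃ : ℂ) (hz : p.1 ∈ cutPlane) (ht : p.2 ∈ slitPlane) :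
    DifferentiableAt ℂ (fun p : ℂ × ℂ => jumpC s₁ s₃ p.1 p.2) p :=
  differentiableAt_comp_neg
    (differentiableAt_jumpB s₁ s₃ (p := (-p.1, p.2)) (neg_mem_cutPlane hz) ht)

end Joint

/-! ### Decay at a power rate and integrals over vertical lines -/

/-- `f = O((1 + |z|)^{-r})` on `S`. -/
def DecaysOn (f : ℂ → ℂ) (r : ℝ) (S : Set ℂ) : Prop :=
  ∃ C : ℝ, ∀ z ∈ S, ‖f z‖ ≤ C * (1 + ‖z‖) ^ (-r)

/-- The closed strip `a ≤ Re z ≤ b`. -/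
def vstrip (a b : ℝ) : Set ℂ := {z | a ≤ z.re ∧ z.re ≤ b}

/-- The line `Re z = c`. -/
def vline (c : ℝ) : Set ℂ := {z | z.re = c}

theorem one_add_norm_pos (z : ℂ) : 0 < 1 + ‖z‖ := by positivity

theorem vline_subset_vstrip {a b c : ℝ} (h1 : a ≤ c) (h2 : c ≤ b) : vline c ⊆ vstrip a b := by
  intro z hz
  have : z.re = c := hz
  exact ⟨by rw [this]; exact h1, by rw [this]; exact h2⟩

theorem linePoint_mem (c y : ℝ) : (c + y * I : ℂ) ∈ vline c := by simp [vline]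

namespace DecaysOn

variable {f g : ℂ → ℂ} {r r' : ℝ} {S S' : Set ℂ}

theorem mono_set (h : DecaysOn f r S) (hS : S' ⊆ S) : DecaysOn f r S' :=
  let ⟨C, hC⟩ := h
  ⟨C, fun z hz => hC z (hS hz)⟩

theorem exists_nonneg (h : DecaysOn f r S) :
    ∃ C : ℝ, 0 ≤ C ∧ ∀ z ∈ S, ‖f z‖ ≤ C * (1 + ‖z‖) ^ (-r) := by
  obtain ⟨C, hC⟩ := h
  refine ⟨max C 0, le_max_right _ _, fun z hz => (hC z hz).trans ?_⟩
  gcongr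
  exact le_max_left _ _

theorem mono (h : DecaysOn f r S) (hr : r' ≤ r) : DecaysOn f r' S := by
  obtain ⟨C, hC0, hC⟩ := h.exists_nonneg
  refine ⟨C, fun z hz => (hC z hz).trans ?_⟩
  gcongr
  linarith [norm_nonneg z]

theorem congr (h : DecaysOn f r S) (hfg : ∀ z ∈ S, g z = f z) : DecaysOn g r S :=
  let ⟨C, hC⟩ := h
  ⟨C, fun z hz => by rw [hfg z hz]; exact hC z hz⟩

theorem mul (hf : DecaysOn f r S) (hg : DecaysOn g r' S) :
    DecaysOn (fun z => f z * g z) (r + r') S := by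
  obtain ⟨C, hC⟩ := hf
  obtain ⟨D, hD⟩ := hg
  refine ⟨C * D, fun z hz => ?_⟩
  rw [norm_mul, neg_add, Real.rpow_add (one_add_norm_pos z)]
  calc _ ≤ (C * (1 + ‖z‖) ^ (-r)) * (D * (1 + ‖z‖) ^ (-r')) :=
        mul_le_mul (hC z hz) (hD z hz) (norm_nonneg _) ((norm_nonneg _).trans (hC z hz))
    _ = _ := by ring

theorem add (hf : DecaysOn f r S) (hg : DecaysOn g r S) :
    DecaysOn (fun z => f z + g z) r S := by
  obtain ⟨C, hC⟩ := hf
  obtain ⟨D, hD⟩ := hg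
  refine ⟨C + D, fun z hz => (norm_add_le _ _).trans ?_⟩
  rw [add_mul]
  exact add_le_add (hC z hz) (hD z hz)

theorem neg (hf : DecaysOn f r S) : DecaysOn (fun z => -f z) r S :=
  let ⟨C, hC⟩ := hf
  ⟨C, fun z hz => by rw [norm_neg]; exact hC z hz⟩

theorem sub (hf : DecaysOn f r S) (hg : DecaysOn g r S) :
    DecaysOn (fun z => f z - g z) r S := by
  simpa only [sub_eq_add_neg] using hf.add hg.neg

theorem const (c : ℂ) (S : Set ℂ) : DecaysOn (fun _ => c) 0 S :=
  ⟨‖c‖, fun z _ => by simp⟩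

theorem const_mul (c : ℂ) (hf : DecaysOn f r S) : DecaysOn (fun z => c * f z) r S := by
  simpa using (const c S).mul hf

theorem inv_sub {w : ℂ} {d : ℝ} (hd : 0 < d) (hS : ∀ z ∈ S, d ≤ ‖z - w‖) :
    DecaysOn (fun z => (z - w)⁻¹) 1 S := by
  refine ⟨(1 + ‖w‖) / d + 1, fun z hz => ?_⟩
  have h1 := hS z hz
  have h2 : 0 < ‖z - w‖ := lt_of_lt_of_le hd h1
  rw [norm_inv, Real.rpow_neg_one, ← div_eq_mul_inv, inv_eq_one_div,
    div_le_div_iff₀ h2 (one_add_norm_pos z)]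
  have h3 : ‖z‖ ≤ ‖w‖ + ‖z - w‖ := by
    have := norm_add_le w (z - w); rwa [add_sub_cancel] at this
  have h4 : 1 + ‖w‖ ≤ (1 + ‖w‖) / d * ‖z - w‖ := by
    rw [div_mul_eq_mul_div, le_div_iff₀ hd]
    exact mul_le_mul_of_nonneg_left h1 (by positivity)
  linarith

/-- On a strip it is enough to control a continuous function for large imaginary part. -/
theorem of_far {a b R : ℝ} (hc : ContinuousOn f (vstrip a b))
    (h : DecaysOn f r (vstrip a b ∩ {z | R ≤ |z.im|})) : DecaysOn f r (vstrip a b) := by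
  have hcomp : IsCompact ((Set.Icc a b) ×ℂ (Set.Icc (-R) R)) := isCompact_Icc.reProdIm isCompact_Icc
  have hsub : ((Set.Icc a b) ×ℂ (Set.Icc (-R) R)) ⊆ vstrip a b := fun z hz => (mem_reProdIm.1 hz).1
  have hcg : ContinuousOn (fun z => ‖f z‖ * (1 + ‖z‖) ^ r) ((Set.Icc a b) ×ℂ (Set.Icc (-R) R)) := by
    refine (hc.mono hsub).norm.mul ?_
    refine ContinuousOn.rpow_const (by fun_prop) fun z _ => Or.inl (one_add_norm_pos z).ne'
  obtain ⟨M, hM⟩ := hcomp.bddAbove_image hcg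
  obtain ⟨C, hC0, hC⟩ := h.exists_nonneg
  refine ⟨max C M, fun z hz => ?_⟩
  by_cases hz' : R ≤ |z.im|
  · refine (hC z ⟨hz, hz'⟩).trans ?_
    gcongr
    exact le_max_left _ _
  · have h1 : z ∈ (Set.Icc a b) ×ℂ (Set.Icc (-R) R) :=
      mem_reProdIm.2 ⟨hz, abs_le.1 (not_le.1 hz').le⟩
    have h2 := hM (Set.mem_image_of_mem _ h1)
    have h3 : ‖f z‖ = ‖f z‖ * (1 + ‖z‖) ^ r * (1 + ‖z‖) ^ (-r) := by
      rw [mul_assoc, ← Real.rpow_add (one_add_norm_pos z)]; simp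
    rw [h3]
    gcongr
    exact h2.trans (le_max_right _ _)

end DecaysOn

theorem integrable_one_add_abs {r : ℝ} (hr : 1 < r) :
    Integrable (fun y : ℝ => (1 + |y|) ^ (-r)) := by
  have := integrable_one_add_norm (E := ℝ) (μ := volume) (r := r) (by simpa using hr)
  simpa using this

theorem one_add_abs_le (c y : ℝ) : 1 + |y| ≤ 1 + ‖(c + y * I : ℂ)‖ := by
  have := abs_im_le_norm (c + y * I : ℂ)
  simp at this
  linarith

theorem one_add_norm_rpow_le (c y : ℝ) {r : ℝ} (hr : 0 ≤ r) :
    (1 + ‖(c + y * I : ℂ)‖) ^ (-r) ≤ (1 + |y|) ^ (-r) :=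
  Real.rpow_le_rpow_of_nonpos (by positivity) (one_add_abs_le c y) (by linarith)

theorem lineIntegrable_of_decaysOn {f : ℂ → ℂ} {c r : ℝ} (hr : 1 < r)
    (hm : AEStronglyMeasurable (fun y : ℝ => f (c + y * I))) (h : DecaysOn f r (vline c)) :
    LineIntegrable c f := by
  obtain ⟨C, hC0, hC⟩ := h.exists_nonneg
  refine ((integrable_one_add_abs hr).const_mul C).mono' hm (Eventually.of_forall fun y => ?_)
  refine (hC _ (linePoint_mem c y)).trans ?_
  have := one_add_norm_rpow_le c y (r := r) (by linarith)
  gcongr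

theorem continuous_linePoint (c : ℝ) : Continuous (fun y : ℝ => (c + y * I : ℂ)) := by fun_prop

theorem aestronglyMeasurable_line {f : ℂ → ℂ} {c : ℝ} (h : ContinuousOn f (vline c)) :
    AEStronglyMeasurable (fun y : ℝ => f (c + y * I)) :=
  (h.comp_continuous (continuous_linePoint c) (linePoint_mem c)).aestronglyMeasurable

theorem LineIntegrable.add {f g : ℂ → ℂ} {c : ℝ} (hf : LineIntegrable c f)
    (hg : LineIntegrable c g) : LineIntegrable c (fun z => f z + g z) := Integrable.add hf hg

theorem LineIntegrable.sub {f g : ℂ → ℂ} {c : ℝ} (hf : LineIntegrable c f)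
    (hg : LineIntegrable c g) : LineIntegrable c (fun z => f z - g z) := Integrable.sub hf hg

theorem lineInt_add {f g : ℂ → ℂ} {c : ℝ} (hf : LineIntegrable c f) (hg : LineIntegrable c g) :
    lineInt c (fun z => f z + g z) = lineInt c f + lineInt c g := by
  unfold lineInt
  rw [← mul_add, ← integral_add (hf.mul_const I) (hg.mul_const I)]
  simp only [add_mul]

theorem lineInt_sub {f g : ℂ → ℂ} {c : ℝ} (hf : LineIntegrable c f) (hg : LineIntegrable c g) :
    lineInt c (fun z => f z - g z) = lineInt c f - lineInt c g := by
  unfold lineInt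
  rw [← mul_sub, ← integral_sub (hf.mul_const I) (hg.mul_const I)]
  simp only [sub_mul]

theorem lineInt_const_mul (a : ℂ) (f : ℂ → ℂ) (c : ℝ) :
    lineInt c (fun z => a * f z) = a * lineInt c f := by
  unfold lineInt
  simp only [mul_assoc, integral_const_mul]
  ring

theorem lineInt_congr {f g : ℂ → ℂ} {c : ℝ} (h : ∀ z ∈ vline c, f z = g z) :
    lineInt c f = lineInt c g := by
  unfold lineInt
  congr 2
  funext y
  rw [h _ (linePoint_mem c y)]

theorem LineIntegrable.congr {f g : ℂ → ℂ} {c : ℝ} (hf : LineIntegrable c f)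
    (h : ∀ z ∈ vline c, g z = f z) : LineIntegrable c g := by
  have : (fun y : ℝ => g (c + y * I)) = fun y : ℝ => f (c + y * I) :=
    funext fun y => h _ (linePoint_mem c y)
  unfold LineIntegrable
  rw [this]
  exact hf

/-- The line integral does not change when the line is moved through a strip of analyticity in
which the integrand decays. -/
theorem lineInt_eq_of_decaysOn {f : ℂ → ℂ} {a b r : ℝ} (hab : a ≤ b) (hr : 1 < r)
    (hd : ∀ z ∈ vstrip a b, DifferentiableAt ℂ f z) (h : DecaysOn f r (vstrip a b)) :
    lineInt a f = lineInt b f := by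
  have hcont : ContinuousOn f (vstrip a b) := fun z hz => (hd z hz).continuousAt.continuousWithinAt
  have hint : ∀ c, a ≤ c → c ≤ b → LineIntegrable c f := fun c h1 h2 =>
    lineIntegrable_of_decaysOn hr
      (aestronglyMeasurable_line (hcont.mono (vline_subset_vstrip h1 h2)))
      (h.mono_set (vline_subset_vstrip h1 h2))
  obtain ⟨C, hC0, hC⟩ := h.exists_nonneg
  have hrect : ∀ T : ℝ, (∫ x : ℝ in a..b, f (x + (-T : ℝ) * I)) - (∫ x : ℝ in a..b, f (x + T * I)) +
      I • (∫ y : ℝ in (-T)..T, f (b + y * I)) - I • (∫ y : ℝ in (-T)..T, f (a + y * I)) = 0 := by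
    intro T
    have := integral_boundary_rect_eq_zero_of_differentiableOn f (a + (-T : ℝ) * I) (b + T * I) ?_
    · simpa using this
    · intro z hz
      refine (hd z ?_).differentiableWithinAt
      have h1 := (mem_reProdIm.1 hz).1
      simp only [add_re, ofReal_re, re_ofReal_mul, I_re, mul_zero, add_zero,
        Set.uIcc_of_le hab] at h1
      exact h1
  have hhor : ∀ s : ℝ, |s| = 1 →
      Tendsto (fun T : ℝ => ∫ x : ℝ in a..b, f (x + (s * T : ℝ) * I)) atTop (𝓝 0) := by
    intro s hs
    have hb : ∀ T : ℝ, 0 ≤ T → ‖∫ x : ℝ in a..b, f (x + (s * T : ℝ) * I)‖ ≤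
        C * (1 + T) ^ (-r) * |b - a| := by
      intro T hT
      refine intervalIntegral.norm_integral_le_of_norm_le_const fun x hx => ?_
      rw [Set.uIoc_of_le hab] at hx
      refine (hC _ ⟨?_, ?_⟩).trans ?_
      · simpa using hx.1.le
      · simpa using hx.2
      · have h1 := one_add_norm_rpow_le x (s * T) (r := r) (by linarith)
        rw [abs_mul, hs, one_mul, abs_of_nonneg hT] at h1
        gcongr
    have hlim : Tendsto (fun T : ℝ => C * (1 + T) ^ (-r) * |b - a|) atTop (𝓝 0) := by
      have h1 : Tendsto (fun T : ℝ => (1 + T) ^ (-r)) atTop (𝓝 0) :=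
        (tendsto_rpow_neg_atTop (by linarith : 0 < r)).comp
          (tendsto_atTop_add_const_left _ 1 tendsto_id)
      have := (h1.const_mul C).mul_const |b - a|
      simpa using this
    refine squeeze_zero_norm' ?_ hlim
    filter_upwards [eventually_ge_atTop 0] with T hT using hb T hT
  have hver : ∀ c, a ≤ c → c ≤ b →
      Tendsto (fun T : ℝ => ∫ y : ℝ in (-T)..T, f (c + y * I)) atTop (𝓝 (∫ y : ℝ, f (c + y * I))) :=
    fun c h1 h2 => intervalIntegral_tendsto_integral (hint c h1 h2) tendsto_neg_atTop_atBot
      tendsto_id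
  have hl := (((hhor (-1) (by simp)).sub (hhor 1 (by simp))).add
    ((hver b hab le_rfl).const_smul I)).sub ((hver a le_rfl hab).const_smul I)
  have h0 : I • (∫ y : ℝ, f (b + y * I)) - I • (∫ y : ℝ, f (a + y * I)) = 0 := by
    have := tendsto_nhds_unique hl ((tendsto_const_nhds (x := (0 : ℂ))).congr fun T => by
      simp only [neg_one_mul, one_mul]; exact (hrect T).symm)
    simpa using this
  have h1 : (∫ y : ℝ, f (b + y * I)) = ∫ y : ℝ, f (a + y * I) := by
    rw [← smul_sub] at h0
    exact sub_eq_zero.1 ((smul_eq_zero.1 h0).resolve_left I_ne_zero)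
  unfold lineInt
  rw [integral_mul_const, integral_mul_const, h1]

/-- Closing the contour in the right half plane. -/
theorem lineInt_eq_zero_of_right {f : ℂ → ℂ} {a r : ℝ} (hr : 1 < r)
    (hd : ∀ z : ℂ, a ≤ z.re → DifferentiableAt ℂ f z) (h : DecaysOn f r {z | a ≤ z.re}) :
    lineInt a f = 0 := by
  obtain ⟨C, hC0, hC⟩ := h.exists_nonneg
  have hshift : ∀ b, a ≤ b → lineInt a f = lineInt b f := fun b hab =>
    lineInt_eq_of_decaysOn hab hr (fun z hz => hd z hz.1) (h.mono_set fun z hz => hz.1)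
  set s : ℝ := (r - 1) / 2 with hs
  set J : ℝ := ∫ y : ℝ, (1 + |y|) ^ (-(r + 1) / 2) with hJ
  have hJint : Integrable (fun y : ℝ => (1 + |y|) ^ (-(r + 1) / 2)) := by
    have := integrable_one_add_abs (r := (r + 1) / 2) (by linarith)
    simpa only [neg_div] using this
  have hbound : ∀ b, a ≤ b → 0 ≤ b →
      ‖lineInt b f‖ ≤ ‖(1 / (2 * Real.pi * I) : ℂ)‖ * (C * (1 + b) ^ (-s) * J) := by
    intro b hab hb
    unfold lineInt
    rw [norm_mul]
    gcongr
    rw [hJ, ← integral_const_mul]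
    refine norm_integral_le_of_norm_le (hJint.const_mul _) (Eventually.of_forall fun y => ?_)
    rw [norm_mul, norm_I, mul_one]
    refine (hC (b + y * I) (by simpa using hab)).trans ?_
    have e : (1 + ‖(b + y * I : ℂ)‖) ^ (-r) =
        (1 + ‖(b + y * I : ℂ)‖) ^ (-s) * (1 + ‖(b + y * I : ℂ)‖) ^ (-(r + 1) / 2) := by
      rw [← Real.rpow_add (one_add_norm_pos _), hs]; congr 1; ring
    have h1 : (1 + ‖(b + y * I : ℂ)‖) ^ (-s) ≤ (1 + b) ^ (-s) := by
      refine Real.rpow_le_rpow_of_nonpos (by positivity) ?_ (by linarith)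
      have := re_le_norm (b + y * I : ℂ)
      simp at this; linarith
    have h2 : (1 + ‖(b + y * I : ℂ)‖) ^ (-(r + 1) / 2) ≤ (1 + |y|) ^ (-(r + 1) / 2) :=
      Real.rpow_le_rpow_of_nonpos (by positivity) (one_add_abs_le b y) (by linarith)
    rw [e, mul_assoc]
    gcongr
  have hlim : Tendsto (fun b : ℝ => ‖(1 / (2 * Real.pi * I) : ℂ)‖ * (C * (1 + b) ^ (-s) * J))
      atTop (𝓝 0) := by
    have h1 : Tendsto (fun T : ℝ => (1 + T) ^ (-s)) atTop (𝓝 0) :=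
      (tendsto_rpow_neg_atTop (by linarith : 0 < s)).comp
        (tendsto_atTop_add_const_left _ 1 tendsto_id)
    have := ((h1.const_mul C).mul_const J).const_mul ‖(1 / (2 * Real.pi * I) : ℂ)‖
    simpa using this
  have : Tendsto (fun _ : ℝ => lineInt a f) atTop (𝓝 0) := by
    refine squeeze_zero_norm' ?_ hlim
    filter_upwards [eventually_ge_atTop 0, eventually_ge_atTop a] with b hb hab
    rw [hshift b hab]
    exact hbound b hab hb
  exact tendsto_nhds_unique tendsto_const_nhds this

theorem lineInt_neg_eq (c : ℝ) (f : ℂ → ℂ) :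
    lineInt (-c) f = lineInt c (fun z => f (-z)) := by
  unfold lineInt
  congr 1
  rw [← integral_neg_eq_self]
  congr 1
  funext y
  push_cast
  ring_nf

/-- Closing the contour in the left half plane. -/
theorem lineInt_eq_zero_of_left {f : ℂ → ℂ} {a r : ℝ} (hr : 1 < r)
    (hd : ∀ z : ℂ, z.re ≤ a → DifferentiableAt ℂ f z) (h : DecaysOn f r {z | z.re ≤ a}) :
    lineInt a f = 0 := by
  have e := lineInt_neg_eq (-a) f
  rw [neg_neg] at e
  rw [e]
  refine lineInt_eq_zero_of_right hr (fun z hz => ?_) ?_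
  · have : DifferentiableAt ℂ f (-z) := hd _ (by simp; linarith)
    exact DifferentiableAt.comp z this (by fun_prop : DifferentiableAt ℂ (fun z : ℂ => -z) z)
  · obtain ⟨C, hC⟩ := h
    refine ⟨C, fun z hz => ?_⟩
    have hz' : -a ≤ z.re := hz
    have := hC (-z) (by simp; linarith)
    rwa [norm_neg] at this

/-! ### Cauchy's formula in a strip and the Cauchy transform -/

theorem abs_re_sub_le_norm (z w : ℂ) : |z.re - w.re| ≤ ‖z - w‖ := by
  simpa using abs_re_le_norm (z - w)

theorem integral_inv_sq_add_sq {d : ℝ} (hd : 0 < d) (v : ℝ) :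
    ∫ y : ℝ, 2 * d / (d ^ 2 + (y - v) ^ 2) = 2 * Real.pi := by
  rw [integral_sub_right_eq_self (fun s : ℝ => 2 * d / (d ^ 2 + s ^ 2)) v]
  have h : ∀ s : ℝ, 2 * d / (d ^ 2 + s ^ 2) = 2 / d * (1 + (s / d) ^ 2)⁻¹ := by
    intro s
    have : d ^ 2 + s ^ 2 ≠ 0 := by positivity
    field_simp
  simp only [h]
  rw [integral_const_mul, Measure.integral_comp_div (fun x : ℝ => (1 + x ^ 2)⁻¹) d,
    integral_univ_inv_one_add_sq, abs_of_pos hd, smul_eq_mul]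
  field_simp

/-- **Cauchy's integral formula** in a strip. -/
theorem lineInt_div_sub_sub_lineInt_div_sub {f : ℂ → ℂ} {a b δ : ℝ} {w : ℂ} (ha : a < w.re)
    (hb : w.re < b) (hδ : 0 < δ) (hd : ∀ z ∈ vstrip a b, DifferentiableAt ℂ f z)
    (h : DecaysOn f δ (vstrip a b)) :
    lineInt b (fun z => f z / (z - w)) - lineInt a (fun z => f z / (z - w)) = f w := by
  -- subtract a multiple of a kernel with a pole at the mirror image `p` of `w`
  set d : ℝ := w.re - a with hdd
  have hd0 : 0 < d := sub_pos.2 ha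
  set p : ℂ := w - 2 * d with hp
  have hpre : p.re = a - d := by simp [hp, hdd]; ring
  have hzp : ∀ z : ℂ, a ≤ z.re → d ≤ ‖z - p‖ := fun z hz => by
    refine le_trans ?_ ((le_abs_self _).trans (abs_re_sub_le_norm z p))
    rw [hpre]; linarith
  have hzp0 : ∀ z : ℂ, a ≤ z.re → z - p ≠ 0 := fun z hz h0 => by
    have := hzp z hz
    rw [h0, norm_zero] at this; linarith
  set k : ℂ → ℂ := fun z => 2 * d * (z - p)⁻¹ with hk
  have hkd : ∀ z : ℂ, a ≤ z.re → DifferentiableAt ℂ k z := fun z hz => by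
    have := hzp0 z hz
    rw [hk]
    fun_prop (disch := assumption)
  have hkdec : DecaysOn k 1 {z | a ≤ z.re} :=
    (DecaysOn.inv_sub hd0 fun z hz => hzp z hz).const_mul _
  have hkw : k w = 1 := by
    have : (d : ℂ) ≠ 0 := ofReal_ne_zero.2 hd0.ne'
    simp only [hk, hp, sub_sub_cancel]
    exact mul_inv_cancel₀ (mul_ne_zero two_ne_zero this)
  set F : ℂ → ℂ := fun z => f z - f w * k z with hF
  have hFw : F w = 0 := by simp only [hF, hkw, mul_one, sub_self]
  have hFd : ∀ z ∈ vstrip a b, DifferentiableAt ℂ F z := fun z hz =>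
    (hd z hz).sub ((hkd z hz.1).const_mul _)
  set r : ℝ := min δ 1 with hr
  have hr0 : 0 < r := lt_min hδ one_pos
  have hFdec : DecaysOn F r (vstrip a b) :=
    (h.mono (min_le_left _ _)).sub
      (((hkdec.mono_set fun z hz => hz.1).mono (min_le_right _ _)).const_mul _)
  have hslope : ∀ z, z ≠ w → dslope F w z = f z / (z - w) - f w * (k z / (z - w)) := by
    intro z hz
    rw [dslope_of_ne _ hz, slope_def_field, hFw, sub_zero, hF]
    ring
  have hsd : ∀ z ∈ vstrip a b, DifferentiableAt ℂ (dslope F w) z := by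
    intro z hz
    by_cases hzw : z = w
    · have hopen : IsOpen {z : ℂ | a < z.re ∧ z.re < b} :=
        (isOpen_lt continuous_const continuous_re).inter (isOpen_lt continuous_re continuous_const)
      have hmem : {z : ℂ | a < z.re ∧ z.re < b} ∈ 𝓝 w := hopen.mem_nhds ⟨ha, hb⟩
      have hon : DifferentiableOn ℂ (dslope F w) {z : ℂ | a < z.re ∧ z.re < b} :=
        (differentiableOn_dslope hmem).2 fun z hz =>
          (hFd z ⟨hz.1.le, hz.2.le⟩).differentiableWithinAt
      rw [hzw]
      exact hon.differentiableAt hmem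
    · exact (differentiableAt_dslope_of_ne hzw).2 (hFd z hz)
  have hsdec : DecaysOn (dslope F w) (r + 1) (vstrip a b) := by
    refine DecaysOn.of_far (R := |w.im| + 1)
      (fun z hz => (hsd z hz).continuousAt.continuousWithinAt) ?_
    have hfar : ∀ z ∈ vstrip a b ∩ {z | |w.im| + 1 ≤ |z.im|}, (1 : ℝ) ≤ ‖z - w‖ := by
      intro z hz
      have h1 : |w.im| + 1 ≤ |z.im| := hz.2
      have h2 := abs_im_le_norm (z - w)
      have h3 := abs_sub_abs_le_abs_sub z.im w.im
      rw [sub_im] at h2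
      linarith
    refine ((hFdec.mono_set Set.inter_subset_left).mul (DecaysOn.inv_sub one_pos hfar)).congr ?_
    intro z hz
    have hzw : z ≠ w := fun h0 => by
      have := hfar z hz
      rw [h0, sub_self, norm_zero] at this; linarith
    rw [dslope_of_ne _ hzw, slope_def_field, hFw, sub_zero, div_eq_mul_inv]
  have hmain := lineInt_eq_of_decaysOn (by linarith : a ≤ b) (by linarith : 1 < r + 1) hsd hsdec
  -- the two lines
  have hline : ∀ c, a ≤ c → c ≤ b → c ≠ w.re →
      lineInt c (dslope F w) =
        lineInt c (fun z => f z / (z - w)) - f w * lineInt c (fun z => k z / (z - w)) := by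
    intro c h1 h2 hc
    have hsub := vline_subset_vstrip h1 h2
    have hcw : ∀ z ∈ vline c, |c - w.re| ≤ ‖z - w‖ := fun z hz => by
      have hz' : z.re = c := hz
      rw [← hz']; exact abs_re_sub_le_norm z w
    have hpos : 0 < |c - w.re| := abs_pos.2 (sub_ne_zero.2 hc)
    have hne : ∀ z ∈ vline c, z ≠ w := fun z hz h0 => by
      have := hcw z hz
      rw [h0, sub_self, norm_zero] at this; linarith
    have hinv := DecaysOn.inv_sub hpos hcw
    have hinvc : ContinuousOn (fun z => (z - w)⁻¹) (vline c) := fun z hz => by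
      have := sub_ne_zero.2 (hne z hz)
      exact ContinuousAt.continuousWithinAt (by fun_prop (disch := assumption))
    have i1 : LineIntegrable c (fun z => f z / (z - w)) := by
      simp only [div_eq_mul_inv]
      refine lineIntegrable_of_decaysOn (r := δ + 1) (by linarith)
        (aestronglyMeasurable_line (f := fun z => f z * (z - w)⁻¹) ?_)
        ((h.mono_set hsub).mul hinv)
      exact ContinuousOn.mul
        (fun z hz => (hd z (hsub hz)).continuousAt.continuousWithinAt) hinvc
    have i2 : LineIntegrable c (fun z => f w * (k z / (z - w))) := by
      simp only [div_eq_mul_inv]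
      refine lineIntegrable_of_decaysOn (r := 1 + 1) (by norm_num)
        (aestronglyMeasurable_line (f := fun z => f w * (k z * (z - w)⁻¹)) ?_)
        (((hkdec.mono_set fun z hz => (hsub hz).1).mul hinv).const_mul _)
      exact continuousOn_const.mul (ContinuousOn.mul
        (fun z hz => (hkd z (hsub hz).1).continuousAt.continuousWithinAt) hinvc)
    rw [← lineInt_const_mul, ← lineInt_sub i1 i2]
    exact lineInt_congr fun z hz => hslope z (hne z hz)
  have hKb : lineInt b (fun z => k z / (z - w)) = 0 := by
    have hbw : ∀ z ∈ {z : ℂ | b ≤ z.re}, b - w.re ≤ ‖z - w‖ := fun z hz => by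
      have hz' : b ≤ z.re := hz
      refine le_trans ?_ ((le_abs_self _).trans (abs_re_sub_le_norm z w))
      linarith
    refine lineInt_eq_zero_of_right (r := 1 + 1) (by norm_num) (fun z hz => ?_) ?_
    · have h1 : z - w ≠ 0 := fun h0 => by
        have := hbw z hz
        rw [h0, norm_zero] at this; linarith
      exact (hkd z (by linarith)).div (by fun_prop) h1
    · simp only [div_eq_mul_inv]
      refine (hkdec.mono_set fun z hz => ?_).mul (DecaysOn.inv_sub (sub_pos.2 hb) hbw)
      have hz' : b ≤ z.re := hz
      exact (by linarith : a ≤ z.re)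
  have hKa : lineInt a (fun z => k z / (z - w)) = -1 := by
    have hval : ∀ y : ℝ, k (a + y * I) / ((a + y * I : ℂ) - w) * I =
        ((2 * d / (d ^ 2 + (y - w.im) ^ 2) : ℝ) : ℂ) * (-I) := by
      intro y
      have e1 : (a + y * I : ℂ) - w = -d + (y - w.im : ℝ) * I := by
        apply Complex.ext <;> simp [hdd]
      have e2 : (a + y * I : ℂ) - p = d + (y - w.im : ℝ) * I := by
        apply Complex.ext <;> simp [hp, hdd] ; ring
      have e3 : (d + (y - w.im : ℝ) * I : ℂ) * (-d + (y - w.im : ℝ) * I) =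
          -((d ^ 2 + (y - w.im) ^ 2 : ℝ) : ℂ) := by
        push_cast
        linear_combination ((y : ℂ) - w.im) ^ 2 * I_sq
      have e4 : ((d ^ 2 + (y - w.im) ^ 2 : ℝ) : ℂ) ≠ 0 := by
        rw [ofReal_ne_zero]; positivity
      simp only [hk]
      rw [e1, e2, mul_div_assoc, inv_eq_one_div, div_div, e3, ofReal_div]
      push_cast at e4 ⊢
      field_simp
    unfold lineInt
    simp only [hval]
    rw [integral_mul_const, integral_complex_ofReal, integral_inv_sq_add_sq hd0]
    have : (Real.pi : ℂ) ≠ 0 := ofReal_ne_zero.2 Real.pi_ne_zero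
    push_cast
    field_simp
  rw [hline a le_rfl (by linarith) (by linarith), hline b (by linarith) le_rfl (by linarith),
    hKa, hKb] at hmain
  linear_combination -hmain

/-- The Cauchy transform of a function on the line `Re w = c`. -/
def cauchyTr (c : ℝ) (g : ℂ → ℂ) (z : ℂ) : ℂ := lineInt c (fun w => g w / (w - z))

theorem abs_sub_re_le_of_mem_vline {c : ℝ} {w z : ℂ} (hw : w ∈ vline c) :
    |c - z.re| ≤ ‖w - z‖ := by
  have hw' : w.re = c := hw
  rw [← hw']; exact abs_re_sub_le_norm w z

theorem aestronglyMeasurable_mul_inv {g : ℂ → ℂ} {c : ℝ}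
    (hm : AEStronglyMeasurable (fun y : ℝ => g (c + y * I))) (z : ℂ) :
    AEStronglyMeasurable (fun y : ℝ => g (c + y * I) / ((c + y * I : ℂ) - z)) := by
  simp only [div_eq_mul_inv]
  refine hm.mul (Measurable.aestronglyMeasurable ?_)
  fun_prop

theorem lineIntegrable_div_sub {g : ℂ → ℂ} {c δ : ℝ} (hδ : 0 < δ)
    (hm : AEStronglyMeasurable (fun y : ℝ => g (c + y * I))) (h : DecaysOn g δ (vline c)) {z : ℂ}
    (hz : z.re ≠ c) : LineIntegrable c (fun w => g w / (w - z)) := by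
  refine lineIntegrable_of_decaysOn (r := δ + 1) (by linarith)
    (aestronglyMeasurable_mul_inv hm z) ?_
  simp only [div_eq_mul_inv]
  exact h.mul (DecaysOn.inv_sub (abs_pos.2 (sub_ne_zero.2 hz.symm))
    fun w hw => abs_sub_re_le_of_mem_vline hw)

/-- The Cauchy transform is analytic off the line. -/
theorem differentiableAt_cauchyTr {g : ℂ → ℂ} {c δ : ℝ} (hδ : 0 < δ)
    (hm : AEStronglyMeasurable (fun y : ℝ => g (c + y * I))) (h : DecaysOn g δ (vline c)) {z : ℂ}
    (hz : z.re ≠ c) : DifferentiableAt ℂ (cauchyTr c g) z := by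
  set d : ℝ := |c - z.re| with hd
  have hd0 : 0 < d := abs_pos.2 (sub_ne_zero.2 hz.symm)
  have hdz : ∀ w ∈ vline c, d ≤ ‖w - z‖ := fun w hw => abs_sub_re_le_of_mem_vline hw
  have hinv := DecaysOn.inv_sub hd0 hdz
  have hG : LineIntegrable c (fun w => g w * ((w - z)⁻¹ * (w - z)⁻¹)) := by
    refine lineIntegrable_of_decaysOn (r := δ + (1 + 1)) (by linarith) ?_ (h.mul (hinv.mul hinv))
    refine hm.mul (Measurable.aestronglyMeasurable ?_)
    fun_prop
  have hball : ∀ z' ∈ Metric.ball z (d / 2), ∀ w ∈ vline c, ‖w - z‖ / 2 ≤ ‖w - z'‖ := by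
    intro z' hz' w hw
    have h1 : ‖z' - z‖ < d / 2 := by simpa [dist_eq_norm] using hz'
    have h2 := hdz w hw
    have h3 : ‖w - z‖ ≤ ‖w - z'‖ + ‖z' - z‖ := by
      have := norm_add_le (w - z') (z' - z); rwa [sub_add_sub_cancel] at this
    linarith
  have hpos : ∀ z' ∈ Metric.ball z (d / 2), ∀ w ∈ vline c, 0 < ‖w - z'‖ := fun z' hz' w hw => by
    have h1 := hball z' hz' w hw
    have h2 := hdz w hw
    linarith
  have hder := (hasDerivAt_integral_of_dominated_loc_of_deriv_le (μ := (volume : Measure ℝ))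
    (x₀ := z) (s := Metric.ball z (d / 2))
    (F := fun z' y => g (c + y * I) / ((c + y * I : ℂ) - z') * I)
    (F' := fun z' y => g (c + y * I) / ((c + y * I : ℂ) - z') ^ 2 * I)
    (bound := fun y => 4 * ‖g (c + y * I) * (((c + y * I : ℂ) - z)⁻¹ * ((c + y * I : ℂ) - z)⁻¹)‖)
    (Metric.ball_mem_nhds z (by positivity)) ?_ ?_ ?_ ?_ ?_ ?_).2
  · have : DifferentiableAt ℂ
        (fun z' => ∫ y : ℝ, g (c + y * I) / ((c + y * I : ℂ) - z') * I) z := hder.differentiableAt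
    unfold cauchyTr lineInt
    exact this.const_mul _
  · exact Eventually.of_forall fun z' => (aestronglyMeasurable_mul_inv hm z').mul_const I
  · exact (lineIntegrable_div_sub hδ hm h hz).mul_const I
  · simp only [div_eq_mul_inv]
    refine (hm.mul (Measurable.aestronglyMeasurable ?_)).mul_const I
    fun_prop
  · refine Eventually.of_forall fun y z' hz' => ?_
    have hw := linePoint_mem c y
    have h1 := hball z' hz' _ hw
    have h2 := hdz _ hw
    have h3 := hpos z' hz' _ hw
    rw [norm_mul, norm_I, mul_one, norm_div, norm_pow, norm_mul, norm_mul, norm_inv,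
      div_eq_mul_inv]
    have h4 : (‖(c + y * I : ℂ) - z'‖ ^ 2)⁻¹ ≤ 4 * (‖(c + y * I : ℂ) - z‖⁻¹ *
        ‖(c + y * I : ℂ) - z‖⁻¹) := by
      have h5 : (‖(c + y * I : ℂ) - z'‖ ^ 2)⁻¹ ≤ ((‖(c + y * I : ℂ) - z‖ / 2) ^ 2)⁻¹ := by
        have : 0 < ‖(c + y * I : ℂ) - z‖ / 2 := by linarith
        gcongr
      refine h5.trans_eq ?_
      field_simp
      norm_num
    calc _ ≤ ‖g (c + y * I)‖ * (4 * (‖(c + y * I : ℂ) - z‖⁻¹ * ‖(c + y * I : ℂ) - z‖⁻¹)) := by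
          gcongr
      _ = _ := by ring
  · exact hG.norm.const_mul 4
  · refine Eventually.of_forall fun y z' hz' => ?_
    have h3 : (c + y * I : ℂ) - z' ≠ 0 := norm_pos_iff.1 (hpos z' hz' _ (linePoint_mem c y))
    have h4 : HasDerivAt (fun z' : ℂ => (c + y * I : ℂ) - z') (-1) z' := by
      simpa using (hasDerivAt_id z').const_sub (c + y * I : ℂ)
    have h5 := ((h4.fun_inv h3).const_mul (g (c + y * I))).mul_const I
    simp only [neg_neg] at h5
    convert! h5 using 1
    · ring

/-- The elementary inequality behind the decay of Cauchy transforms: it moves a quarter of the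
decay from the variable of integration to the other variable. -/
theorem kernel_rpow_le {A B Z δ : ℝ} (hA : 1 ≤ A) (hB : 1 ≤ B) (hZ : 0 < Z) (hZAB : Z ≤ A * B)
    (hδ : 0 < δ) (hδ1 : δ ≤ 1) :
    A ^ (-δ) * B⁻¹ ≤ Z ^ (-(δ / 4)) * (A ^ (-(1 + δ / 2)) + B ^ (-(1 + δ / 2))) := by
  have hA0 : 0 < A := by linarith
  have hB0 : 0 < B := by linarith
  have h1 : (A * B) ^ (-(δ / 4)) ≤ Z ^ (-(δ / 4)) :=
    Real.rpow_le_rpow_of_nonpos hZ hZAB (by linarith)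
  rw [Real.mul_rpow hA0.le hB0.le] at h1
  have e1 : A ^ (-δ) = A ^ (-(δ / 4)) * A ^ (-(3 * δ / 4)) := by
    rw [← Real.rpow_add hA0]; congr 1; ring
  have e2 : B⁻¹ = B ^ (-(δ / 4)) * B ^ (-(1 - δ / 4)) := by
    rw [← Real.rpow_add hB0, ← Real.rpow_neg_one]; congr 1; ring
  have h2 : A ^ (-(3 * δ / 4)) * B ^ (-(1 - δ / 4)) ≤
      A ^ (-(1 + δ / 2)) + B ^ (-(1 + δ / 2)) := by
    rcases le_total A B with h | h
    · have : B ^ (-(1 - δ / 4)) ≤ A ^ (-(1 - δ / 4)) :=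
        Real.rpow_le_rpow_of_nonpos hA0 h (by linarith)
      calc _ ≤ A ^ (-(3 * δ / 4)) * A ^ (-(1 - δ / 4)) := by gcongr
        _ = A ^ (-(1 + δ / 2)) := by rw [← Real.rpow_add hA0]; congr 1; ring
        _ ≤ _ := le_add_of_nonneg_right (by positivity)
    · have : A ^ (-(3 * δ / 4)) ≤ B ^ (-(3 * δ / 4)) :=
        Real.rpow_le_rpow_of_nonpos hB0 h (by linarith)
      calc _ ≤ B ^ (-(3 * δ / 4)) * B ^ (-(1 - δ / 4)) := by gcongr
        _ = B ^ (-(1 + δ / 2)) := by rw [← Real.rpow_add hB0]; congr 1; ring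
        _ ≤ _ := le_add_of_nonneg_left (by positivity)
  calc A ^ (-δ) * B⁻¹ = (A ^ (-(δ / 4)) * B ^ (-(δ / 4))) *
        (A ^ (-(3 * δ / 4)) * B ^ (-(1 - δ / 4))) := by rw [e1, e2]; ring
    _ ≤ _ := by gcongr

/-- The bound for the integrand of a Cauchy transform at distance at least `d` from the line. -/
theorem norm_div_sub_le {g : ℂ → ℂ} {C δ d : ℝ} (hδ : 0 < δ) (hδ1 : δ ≤ 1) (hd : 0 < d)
    (hC : 0 ≤ C) {w z : ℂ} (hg : ‖g w‖ ≤ C * (1 + ‖w‖) ^ (-δ)) (hdz : d ≤ ‖w - z‖) :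
    ‖g w / (w - z)‖ ≤ C * (1 / d + 1) * ((1 + ‖z‖) ^ (-(δ / 4)) *
      ((1 + |w.im|) ^ (-(1 + δ / 2)) + (1 + |w.im - z.im|) ^ (-(1 + δ / 2)))) := by
  have hB : ‖w - z‖⁻¹ ≤ (1 / d + 1) * (1 + ‖w - z‖)⁻¹ := by
    rw [← div_eq_mul_inv, inv_eq_one_div, div_le_div_iff₀ (by linarith) (by positivity)]
    have : 1 ≤ 1 / d * ‖w - z‖ := by rw [one_div_mul_eq_div, one_le_div hd]; exact hdz
    linarith
  have hZ : 1 + ‖z‖ ≤ (1 + ‖w‖) * (1 + ‖w - z‖) := by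
    have h3 : ‖z‖ ≤ ‖w‖ + ‖w - z‖ := by
      have := norm_sub_le w (w - z); rwa [sub_sub_cancel] at this
    nlinarith [norm_nonneg w, norm_nonneg (w - z), mul_nonneg (norm_nonneg w) (norm_nonneg (w - z))]
  have key := kernel_rpow_le (A := 1 + ‖w‖) (B := 1 + ‖w - z‖)
    (le_add_of_nonneg_right (norm_nonneg w)) (le_add_of_nonneg_right (norm_nonneg _))
    (one_add_norm_pos z) hZ hδ hδ1
  have hw1 : (1 + ‖w‖) ^ (-(1 + δ / 2)) ≤ (1 + |w.im|) ^ (-(1 + δ / 2)) :=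
    Real.rpow_le_rpow_of_nonpos (by positivity)
      (by have := abs_im_le_norm w; linarith) (by linarith)
  have hw2 : (1 + ‖w - z‖) ^ (-(1 + δ / 2)) ≤ (1 + |w.im - z.im|) ^ (-(1 + δ / 2)) :=
    Real.rpow_le_rpow_of_nonpos (by positivity)
      (by have := abs_im_le_norm (w - z); rw [sub_im] at this; linarith) (by linarith)
  rw [norm_div, div_eq_mul_inv]
  calc _ ≤ (C * (1 + ‖w‖) ^ (-δ)) * ((1 / d + 1) * (1 + ‖w - z‖)⁻¹) := by gcongr
    _ = C * (1 / d + 1) * ((1 + ‖w‖) ^ (-δ) * (1 + ‖w - z‖)⁻¹) := by ring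
    _ ≤ C * (1 / d + 1) * ((1 + ‖z‖) ^ (-(δ / 4)) *
      ((1 + ‖w‖) ^ (-(1 + δ / 2)) + (1 + ‖w - z‖) ^ (-(1 + δ / 2)))) := by gcongr
    _ ≤ _ := by gcongr

/-- The Cauchy transform of a function that decays at a power rate decays at a power rate, at a
positive distance from the line. -/
theorem decaysOn_cauchyTr {g : ℂ → ℂ} {c δ d : ℝ} (hδ : 0 < δ) (hδ1 : δ ≤ 1) (hd : 0 < d)
    (h : DecaysOn g δ (vline c)) :
    DecaysOn (cauchyTr c g) (δ / 4) {z | d ≤ |c - z.re|} := by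
  obtain ⟨C, hC0, hC⟩ := h.exists_nonneg
  set J : ℝ := ∫ y : ℝ, (1 + |y|) ^ (-(1 + δ / 2)) with hJ
  have hJi : Integrable (fun y : ℝ => (1 + |y|) ^ (-(1 + δ / 2))) :=
    integrable_one_add_abs (by linarith)
  refine ⟨‖(1 / (2 * Real.pi * I) : ℂ)‖ * (C * (1 / d + 1) * (J + J)), fun z hz => ?_⟩
  have hJi2 : Integrable (fun y : ℝ => (1 + |y - z.im|) ^ (-(1 + δ / 2))) :=
    hJi.comp_sub_right z.im
  have hJ2 : ∫ y : ℝ, (1 + |y - z.im|) ^ (-(1 + δ / 2)) = J :=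
    integral_sub_right_eq_self (fun y : ℝ => (1 + |y|) ^ (-(1 + δ / 2))) z.im
  have hb : ∀ y : ℝ, ‖g (c + y * I) / ((c + y * I : ℂ) - z) * I‖ ≤ C * (1 / d + 1) *
      ((1 + ‖z‖) ^ (-(δ / 4)) *
        ((1 + |y|) ^ (-(1 + δ / 2)) + (1 + |y - z.im|) ^ (-(1 + δ / 2)))) := fun y => by
    have hw := linePoint_mem c y
    have hdz : d ≤ ‖(c + y * I : ℂ) - z‖ := le_trans hz (abs_sub_re_le_of_mem_vline hw)
    have := norm_div_sub_le hδ hδ1 hd hC0 (hC _ hw) hdz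
    have him : (c + y * I : ℂ).im = y := by simp
    rw [him] at this
    rw [norm_mul, norm_I, mul_one]
    exact this
  have hI : ‖∫ y : ℝ, g (c + y * I) / ((c + y * I : ℂ) - z) * I‖ ≤
      C * (1 / d + 1) * ((1 + ‖z‖) ^ (-(δ / 4)) * (J + J)) := by
    refine (norm_integral_le_of_norm_le
      (((hJi.add hJi2).const_mul ((1 + ‖z‖) ^ (-(δ / 4)))).const_mul (C * (1 / d + 1)))
      (Eventually.of_forall hb)).trans_eq ?_
    rw [integral_const_mul, integral_const_mul]
    simp only [Pi.add_apply]
    rw [integral_add hJi hJi2, hJ2]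
  have e : ‖cauchyTr c g z‖ = ‖(1 / (2 * Real.pi * I) : ℂ)‖ *
      ‖∫ y : ℝ, g (c + y * I) / ((c + y * I : ℂ) - z) * I‖ := norm_mul _ _
  rw [e]
  calc _ ≤ ‖(1 / (2 * Real.pi * I) : ℂ)‖ *
        (C * (1 / d + 1) * ((1 + ‖z‖) ^ (-(δ / 4)) * (J + J))) :=
        mul_le_mul_of_nonneg_left hI (norm_nonneg _)
    _ = _ := by ring

/-! ### Interchanging two line integrals -/

/-- The double integral of `T(z) g(w) / (w - z)` over two different vertical lines converges
absolutely. -/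
theorem integrable_prod_kernel {T g : ℂ → ℂ} {c c' δ : ℝ} (hc : c ≠ c') (hδ : 0 < δ) (hδ1 : δ ≤ 1)
    (hTm : AEStronglyMeasurable (fun y : ℝ => T (c + y * I))) (hT : DecaysOn T 1 (vline c))
    (hgm : AEStronglyMeasurable (fun y : ℝ => g (c' + y * I))) (hg : DecaysOn g δ (vline c')) :
    Integrable (fun p : ℝ × ℝ => T (c + p.1 * I) *
      (g (c' + p.2 * I) / ((c' + p.2 * I : ℂ) - (c + p.1 * I)))) (volume.prod volume) := by
  obtain ⟨C, hC0, hC⟩ := hg.exists_nonneg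
  obtain ⟨D, hD0, hD⟩ := hT.exists_nonneg
  set d : ℝ := |c' - c| with hd
  have hd0 : 0 < d := abs_pos.2 (sub_ne_zero.2 hc.symm)
  have hJ1 : Integrable (fun y : ℝ => (1 + |y|) ^ (-(1 + δ / 4))) :=
    integrable_one_add_abs (by linarith)
  have hJ2 : Integrable (fun y : ℝ => (1 + |y|) ^ (-(1 + δ / 2))) :=
    integrable_one_add_abs (by linarith)
  have hb1 := hJ1.mul_prod hJ2
  have hb2 : Integrable (fun p : ℝ × ℝ => (1 + |p.1|) ^ (-(1 + δ / 4)) *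
      (1 + |p.2 - p.1|) ^ (-(1 + δ / 2))) (volume.prod volume) :=
    (measurePreserving_prod_sub (volume : Measure ℝ) (volume : Measure ℝ)).integrable_comp_of_integrable
      hb1
  refine ((hb1.add hb2).const_mul (D * (C * (1 / d + 1)))).mono' ?_ (Eventually.of_forall fun p => ?_)
  · simp only [div_eq_mul_inv]
    refine hTm.comp_fst.mul (hgm.comp_snd.mul (Measurable.aestronglyMeasurable ?_))
    fun_prop
  · have hz := linePoint_mem c p.1
    have hw := linePoint_mem c' p.2
    have hdz : d ≤ ‖(c' + p.2 * I : ℂ) - (c + p.1 * I)‖ := by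
      have := abs_sub_re_le_of_mem_vline (z := (c + p.1 * I : ℂ)) hw
      simpa [hd] using this
    have k1 := norm_div_sub_le hδ hδ1 hd0 hC0 (hC _ hw) hdz
    have k2 := hD _ hz
    have i1 : (c' + p.2 * I : ℂ).im = p.2 := by simp
    have i2 : (c + p.1 * I : ℂ).im = p.1 := by simp
    rw [i1, i2] at k1
    rw [norm_mul]
    have e : (1 + ‖(c + p.1 * I : ℂ)‖) ^ (-(1 : ℝ)) * (1 + ‖(c + p.1 * I : ℂ)‖) ^ (-(δ / 4)) =
        (1 + ‖(c + p.1 * I : ℂ)‖) ^ (-(1 + δ / 4)) := by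
      rw [← Real.rpow_add (one_add_norm_pos _)]; congr 1; ring
    have k3 := one_add_norm_rpow_le c p.1 (r := 1 + δ / 4) (by linarith)
    calc _ ≤ (D * (1 + ‖(c + p.1 * I : ℂ)‖) ^ (-(1 : ℝ))) * (C * (1 / d + 1) *
          ((1 + ‖(c + p.1 * I : ℂ)‖) ^ (-(δ / 4)) *
          ((1 + |p.2|) ^ (-(1 + δ / 2)) + (1 + |p.2 - p.1|) ^ (-(1 + δ / 2))))) := by gcongr
      _ = D * (C * (1 / d + 1)) * ((1 + ‖(c + p.1 * I : ℂ)‖) ^ (-(1 + δ / 4)) *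
          ((1 + |p.2|) ^ (-(1 + δ / 2)) + (1 + |p.2 - p.1|) ^ (-(1 + δ / 2)))) := by
          rw [← e]; ring
      _ ≤ D * (C * (1 / d + 1)) * ((1 + |p.1|) ^ (-(1 + δ / 4)) *
          ((1 + |p.2|) ^ (-(1 + δ / 2)) + (1 + |p.2 - p.1|) ^ (-(1 + δ / 2)))) := by gcongr
      _ = _ := by simp only [Pi.add_apply]; ring

/-- Interchange of the order of integration for a product with a Cauchy transform. -/
theorem lineInt_mul_cauchyTr {T g : ℂ → ℂ} {c c' δ : ℝ} (hc : c ≠ c') (hδ : 0 < δ) (hδ1 : δ ≤ 1)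
    (hTm : AEStronglyMeasurable (fun y : ℝ => T (c + y * I))) (hT : DecaysOn T 1 (vline c))
    (hgm : AEStronglyMeasurable (fun y : ℝ => g (c' + y * I))) (hg : DecaysOn g δ (vline c')) :
    LineIntegrable c (fun z => T z * cauchyTr c' g z) ∧
    LineIntegrable c' (fun w => g w * cauchyTr c T w) ∧
    lineInt c (fun z => T z * cauchyTr c' g z) = -lineInt c' (fun w => g w * cauchyTr c T w) := by
  have hI := integrable_prod_kernel hc hδ hδ1 hTm hT hgm hg
  have h2 : (1 / (2 * Real.pi * I) * I : ℂ) ≠ 0 :=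
    mul_ne_zero (one_div_ne_zero two_pi_I_ne_zero) I_ne_zero
  have e1 : ∀ y : ℝ, T (c + y * I) * cauchyTr c' g (c + y * I) =
      1 / (2 * Real.pi * I) * I * ∫ v : ℝ, T (c + y * I) *
        (g (c' + v * I) / ((c' + v * I : ℂ) - (c + y * I))) := by
    intro y
    unfold cauchyTr lineInt
    rw [integral_mul_const, integral_const_mul]
    ring
  have e2 : ∀ v : ℝ, g (c' + v * I) * cauchyTr c T (c' + v * I) =
      -(1 / (2 * Real.pi * I) * I * ∫ y : ℝ, T (c + y * I) *
        (g (c' + v * I) / ((c' + v * I : ℂ) - (c + y * I)))) := by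
    intro v
    unfold cauchyTr lineInt
    have : ∀ y : ℝ, T (c + y * I) * (g (c' + v * I) / ((c' + v * I : ℂ) - (c + y * I))) =
        -g (c' + v * I) * (T (c + y * I) / ((c + y * I : ℂ) - (c' + v * I))) := by
      intro y
      rw [← neg_sub (c + y * I : ℂ), div_neg]
      ring
    simp only [this]
    rw [integral_mul_const, integral_const_mul]
    ring
  refine ⟨?_, ?_, ?_⟩
  · unfold LineIntegrable
    simp only [e1]
    exact hI.integral_prod_left.const_mul _
  · unfold LineIntegrable
    simp only [e2]
    exact (hI.integral_prod_right.const_mul _).neg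
  · have hswap := integral_integral_swap (f := fun y v : ℝ => T (c + y * I) *
        (g (c' + v * I) / ((c' + v * I : ℂ) - (c + y * I)))) hI
    unfold lineInt
    simp only [e1, e2, integral_mul_const, integral_neg]
    rw [integral_const_mul, integral_const_mul, hswap]
    ring

/-! ### Continuous logarithms, gluing along a vertical line, Cauchy estimates -/

/-- Two continuous logarithms of the same function on a connected set differ by a constant. -/
theorem sub_eq_sub_of_exp_eq {X : Type*} [TopologicalSpace X] {S : Set X} (hS : IsPreconnected S)
    {f g : X → ℂ} (hf : ContinuousOn f S) (hg : ContinuousOn g S)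
    (h : ∀ x ∈ S, exp (f x) = exp (g x)) {x y : X} (hx : x ∈ S) (hy : y ∈ S) :
    f x - g x = f y - g y := by
  refine hS.constant_of_mapsTo (T := Set.range fun n : ℤ => (n : ℂ) * (2 * Real.pi * I)) ?_
    (hf.sub hg) (fun x hx => ?_) hx hy
  · have hne : ‖(2 * Real.pi * I : ℂ)‖ = 2 * Real.pi := by simp [abs_of_pos Real.pi_pos]
    rw [isDiscrete_iff_forall_mem_exists_isOpen]
    rintro _ ⟨n, rfl⟩
    refine ⟨Metric.ball ((n : ℂ) * (2 * Real.pi * I)) 1, Metric.isOpen_ball, ?_⟩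
    ext w
    constructor
    · rintro ⟨hw, m, rfl⟩
      rw [Metric.mem_ball, dist_eq_norm] at hw
      simp only [← sub_mul, norm_mul, hne] at hw
      have h1 : ‖((m : ℂ) - n)‖ < 1 := by
        have := Real.pi_gt_three
        nlinarith [norm_nonneg ((m : ℂ) - n)]
      rw [← Int.cast_sub, Complex.norm_intCast, ← Int.cast_abs] at h1
      have h2 : |m - n| < 1 := by exact_mod_cast h1
      have h3 : m = n := by have := Int.abs_lt_one_iff.1 h2; omega
      simp [h3]
    · rintro rfl
      exact ⟨Metric.mem_ball_self one_pos, n, rfl⟩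
  · obtain ⟨n, hn⟩ := exp_eq_exp_iff_exists_int.1 (h x hx)
    exact ⟨n, by simp only [Pi.sub_apply]; rw [hn]; ring⟩

/-- Two functions that are analytic at a point of a vertical line and agree on the line agree near
the point. -/
theorem eventuallyEq_of_eq_on_line {f g : ℂ → ℂ} {z : ℂ} (hf : AnalyticAt ℂ f z)
    (hg : AnalyticAt ℂ g z) (h : ∀ w : ℂ, w.re = z.re → f w = g w) : f =ᶠ[𝓝 z] g := by
  refine (hf.frequently_eq_iff_eventually_eq hg).1 ?_
  have ht : Tendsto (fun y : ℝ => z + y * I) (𝓝[≠] 0) (𝓝[≠] z) := by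
    refine tendsto_nhdsWithin_iff.2 ⟨?_, ?_⟩
    · have : ContinuousAt (fun y : ℝ => z + y * I) 0 := by fun_prop
      have := this.tendsto
      simp only [ofReal_zero, zero_mul, add_zero] at this
      exact this.mono_left nhdsWithin_le_nhds
    · filter_upwards [self_mem_nhdsWithin] with y hy
      simpa using hy
  exact ht.frequently (Eventually.frequently (Eventually.of_forall fun y => h _ (by simp)))

/-- Cauchy's estimate on discs of radius proportional to `|z|`. -/
theorem decaysOn_deriv {f g : ℂ → ℂ} {S : Set ℂ} {s R M : ℝ} (hS : IsClosed S) (hs : 0 < s)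
    (hf : AnalyticOnNhd ℂ f S)
    (hfar : ∀ z ∈ S, R ≤ ‖z‖ → f =ᶠ[𝓝 z] g ∧
      ∀ w ∈ Metric.closedBall z (s * ‖z‖), DifferentiableAt ℂ g w ∧ ‖g w‖ ≤ M) :
    DecaysOn (deriv f) 1 S := by
  set R' : ℝ := max R 1
  have hcomp : IsCompact (S ∩ Metric.closedBall 0 R') :=
    (isCompact_closedBall 0 R').inter_left hS
  have hcont : ContinuousOn (fun z => ‖deriv f z‖ * (1 + ‖z‖)) (S ∩ Metric.closedBall 0 R') :=
    fun z hz => by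
      have := (hf z hz.1).deriv.continuousAt
      exact ContinuousAt.continuousWithinAt (by fun_prop)
  obtain ⟨N, hN⟩ := hcomp.bddAbove_image hcont
  refine ⟨max N (2 * M / s), fun z hz => ?_⟩
  have hp := one_add_norm_pos z
  rw [Real.rpow_neg_one, ← div_eq_mul_inv, le_div_iff₀ hp]
  by_cases hzR : ‖z‖ ≤ R'
  · exact (hN ⟨z, ⟨hz, by simpa using hzR⟩, rfl⟩).trans (le_max_left _ _)
  · rw [not_le] at hzR
    have h1 : 1 ≤ ‖z‖ := (le_max_right R 1).trans hzR.le
    obtain ⟨he, hd⟩ := hfar z hz ((le_max_left R 1).trans hzR.le)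
    have h0 : 0 < s * ‖z‖ := by positivity
    have hder : ‖deriv g z‖ ≤ M / (s * ‖z‖) := by
      refine norm_deriv_le_of_forall_mem_sphere_norm_le h0 ?_
        (fun w hw => (hd w (Metric.sphere_subset_closedBall hw)).2)
      refine DifferentiableOn.diffContOnCl fun w hw => ?_
      rw [closure_ball _ h0.ne'] at hw
      exact (hd w hw).1.differentiableWithinAt
    have hM : 0 ≤ M := (norm_nonneg _).trans (hd z (Metric.mem_closedBall_self h0.le)).2
    rw [he.deriv_eq]
    refine le_trans ?_ (le_max_right _ _)
    calc _ ≤ M / (s * ‖z‖) * (2 * ‖z‖) := by gcongr; linarith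
      _ = _ := by field_simp

theorem isClosed_vstrip (a b : ℝ) : IsClosed (vstrip a b) :=
  (isClosed_le continuous_const continuous_re).inter (isClosed_le continuous_re continuous_const)

/-- Discs of radius proportional to `|z|` about points near the imaginary axis stay in the
sector. -/
theorem mem_farSector_of_mem_closedBall {κ R s c : ℝ} {z w : ℂ} (hκ0 : 0 ≤ κ) (hκ : s ≤ κ / 6)
    (hs : s ≤ 1 / 6) (hR : 2 * R ≤ ‖z‖)
    (hc : c ≤ s * ‖z‖) (hz : |z.re| ≤ c + s * ‖z‖) (hw : w ∈ Metric.closedBall z (s * ‖z‖)) :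
    w ∈ farSector κ R := by
  rw [Metric.mem_closedBall, dist_eq_norm] at hw
  have h1 := abs_re_le_norm (w - z)
  have h2 := abs_im_le_norm (w - z)
  rw [sub_re] at h1
  rw [sub_im] at h2
  have h3 := norm_le_abs_re_add_abs_im z
  have h4 := abs_sub_abs_le_abs_sub w.re z.re
  have h5 := abs_sub_abs_le_abs_sub z.im w.im
  rw [abs_sub_comm z.im] at h5
  have h6 : s * ‖z‖ ≤ 1 / 6 * ‖z‖ := by gcongr
  have h7 : s * ‖z‖ ≤ κ / 6 * ‖z‖ := by gcongr
  have h8 : ‖z‖ / 2 ≤ |w.im| := by linarith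
  refine ⟨by linarith, ?_⟩
  have : κ * (‖z‖ / 2) ≤ κ * |w.im| := by gcongr
  linarith

/-! ### The jump matrix on the strip -/

theorem one_add_norm_rpow_of_one_le {z : ℂ} (hz : 1 ≤ ‖z‖) {r : ℝ} (hr : 0 ≤ r) :
    ‖z‖ ^ (-r) ≤ 2 ^ r * (1 + ‖z‖) ^ (-r) := by
  have h : (2 * ‖z‖) ^ (-r) ≤ (1 + ‖z‖) ^ (-r) :=
    Real.rpow_le_rpow_of_nonpos (one_add_norm_pos z) (by linarith) (by linarith)
  rw [Real.mul_rpow zero_le_two (norm_nonneg z)] at h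
  calc ‖z‖ ^ (-r) = 2 ^ r * (2 ^ (-r) * ‖z‖ ^ (-r)) := by
        rw [← mul_assoc, ← Real.rpow_add zero_lt_two, add_neg_cancel, Real.rpow_zero, one_mul]
    _ ≤ _ := by gcongr

/-- A power decay that holds in the sectors around the imaginary axis holds in every strip of
continuity, uniformly in a compact set of parameters. -/
theorem exists_bound_vstrip {f : ℂ → ℂ → ℂ} {K : Set ℂ} (hK : IsCompact K) {a b κ R C r : ℝ}
    (hκ : 0 < κ) (hr : 0 ≤ r) (hC : 0 ≤ C)
    (hc : ContinuousOn (fun p : ℂ × ℂ => f p.1 p.2) (vstrip a b ×ˢ K))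
    (h : ∀ τ ∈ K, ∀ z ∈ farSector κ R, ‖f z τ‖ ≤ C * ‖z‖ ^ (-r)) :
    ∃ C' : ℝ, 0 ≤ C' ∧ ∀ τ ∈ K, ∀ z ∈ vstrip a b, ‖f z τ‖ ≤ C' * (1 + ‖z‖) ^ (-r) := by
  set m : ℝ := max |a| |b|
  set R' : ℝ := max (max R 1) (m / κ)
  have hcomp : IsCompact (((Set.Icc a b) ×ℂ (Set.Icc (-R') R')) ×ˢ K) :=
    (isCompact_Icc.reProdIm isCompact_Icc).prod hK
  have hsub : ((Set.Icc a b) ×ℂ (Set.Icc (-R') R')) ×ˢ K ⊆ vstrip a b ×ˢ K :=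
    fun p hp => ⟨(mem_reProdIm.1 hp.1).1, hp.2⟩
  have hcg : ContinuousOn (fun p : ℂ × ℂ => ‖f p.1 p.2‖ * (1 + ‖p.1‖) ^ r)
      (((Set.Icc a b) ×ℂ (Set.Icc (-R') R')) ×ˢ K) := by
    refine ((hc.mono hsub).norm).mul (ContinuousOn.rpow_const (by fun_prop) fun p _ => Or.inl ?_)
    exact (one_add_norm_pos p.1).ne'
  obtain ⟨M, hM⟩ := hcomp.bddAbove_image hcg
  refine ⟨max (C * 2 ^ r) M, le_max_of_le_left (by positivity), fun τ hτ z hz => ?_⟩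
  have hp := one_add_norm_pos z
  by_cases hz' : R' ≤ |z.im|
  · have h1 : 1 ≤ |z.im| := le_trans (le_trans (le_max_right R 1) (le_max_left _ _)) hz'
    have h2 : m ≤ κ * |z.im| := by
      have := (le_max_right (max R 1) (m / κ)).trans hz'
      rw [div_le_iff₀ hκ] at this; linarith
    have h3 : |z.re| ≤ m := abs_le_max_abs_abs hz.1 hz.2
    have h4 := h τ hτ z ⟨le_trans (le_trans (le_max_left R 1) (le_max_left _ _)) hz', h3.trans h2⟩
    refine h4.trans ?_
    have h5 := one_add_norm_rpow_of_one_le (h1.trans (abs_im_le_norm z)) hr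
    calc _ ≤ C * (2 ^ r * (1 + ‖z‖) ^ (-r)) := by gcongr
      _ = C * 2 ^ r * (1 + ‖z‖) ^ (-r) := by ring
      _ ≤ _ := by gcongr; exact le_max_left _ _
  · have h1 : z ∈ (Set.Icc a b) ×ℂ (Set.Icc (-R') R') :=
      mem_reProdIm.2 ⟨hz, abs_le.1 (not_le.1 hz').le⟩
    have h2 : ‖f z τ‖ * (1 + ‖z‖) ^ r ≤ M := hM ⟨(z, τ), ⟨h1, hτ⟩, rfl⟩
    rw [Real.rpow_neg hp.le, ← div_eq_mul_inv, le_div_iff₀ (by positivity)]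
    exact h2.trans (le_max_right _ _)

theorem norm_deriv_time_le {f : ℂ → ℂ} {t τ : ℂ} {ρ M : ℝ} (hρ : 0 < ρ)
    (hd : ∀ τ ∈ Metric.closedBall t ρ, DifferentiableAt ℂ f τ)
    (hb : ∀ τ ∈ Metric.closedBall t ρ, ‖f τ‖ ≤ M) (hτ : τ ∈ Metric.closedBall t (ρ / 2)) :
    ‖deriv f τ‖ ≤ M / (ρ / 2) := by
  have hsub : Metric.closedBall τ (ρ / 2) ⊆ Metric.closedBall t ρ := by
    refine Metric.closedBall_subset_closedBall' ?_
    have := Metric.mem_closedBall.1 hτ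
    linarith
  refine norm_deriv_le_of_forall_mem_sphere_norm_le (half_pos hρ) ?_
    (fun w hw => hb w (hsub (Metric.sphere_subset_closedBall hw)))
  refine DifferentiableOn.diffContOnCl fun w hw => ?_
  rw [closure_ball _ (half_pos hρ).ne'] at hw
  exact (hd w (hsub hw)).differentiableWithinAt

/-- The time derivative is measurable along a line, as a limit of difference quotients. -/
theorem aestronglyMeasurable_deriv_time {f : ℂ → ℂ → ℂ} {t : ℂ} {c ρ : ℝ} (hρ : 0 < ρ)
    (hc : ∀ τ ∈ Metric.closedBall t ρ, ContinuousOn (fun z => f z τ) (vline c))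
    (hd : ∀ z ∈ vline c, DifferentiableAt ℂ (f z) t) :
    AEStronglyMeasurable (fun y : ℝ => deriv (f (c + y * I)) t) := by
  have hlim : Tendsto (fun n : ℕ => t + ((ρ / (n + 1 : ℝ) : ℝ) : ℂ)) atTop (𝓝[≠] t) := by
    refine tendsto_nhdsWithin_iff.2 ⟨?_, Eventually.of_forall fun n => ?_⟩
    · have h1 : Tendsto (fun n : ℕ => ρ / (n + 1 : ℝ)) atTop (𝓝 0) := by
        have := (tendsto_one_div_add_atTop_nhds_zero_nat (𝕜 := ℝ)).const_mul ρ
        simpa [div_eq_mul_inv] using this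
      have h2 := (continuous_ofReal.tendsto 0).comp h1
      simpa using h2.const_add t
    · have : (0 : ℝ) < ρ / (n + 1 : ℝ) := by positivity
      simpa using (ofReal_ne_zero.2 this.ne')
  refine aestronglyMeasurable_of_tendsto_ae atTop
    (f := fun (n : ℕ) (y : ℝ) => slope (f (c + y * I)) t (t + ((ρ / (n + 1 : ℝ) : ℝ) : ℂ)))
    (fun n => ?_) (Eventually.of_forall fun y => ?_)
  · simp only [slope, vsub_eq_sub, smul_eq_mul]
    have hmem : t + ((ρ / (n + 1 : ℝ) : ℝ) : ℂ) ∈ Metric.closedBall t ρ := by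
      rw [Metric.mem_closedBall, dist_eq_norm, add_sub_cancel_left, norm_real, Real.norm_eq_abs,
        abs_of_pos (by positivity)]
      exact div_le_self hρ.le (by linarith [n.cast_nonneg (α := ℝ)])
    refine ((aestronglyMeasurable_line (hc _ hmem)).sub
      (aestronglyMeasurable_line (hc t (Metric.mem_closedBall_self hρ.le)))).const_mul _
  · exact (hd _ (linePoint_mem c y)).hasDerivAt.tendsto_slope.comp hlim

/-- The hypotheses on the monodromy data, the lines and the time under which the two
Riemann–Hilbert problems are compared. -/
structure Admissible (s₁ s₃ : ℂ) (c₁ c₃ : ℝ) (t : ℂ) : Prop where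
  s₁_ne : s₁ ≠ 0
  s₃_ne : s₃ ≠ 0
  slit : 1 - s₁ * s₃ ∈ slitPlane
  c₁_pos : 0 < c₁
  c₁_lt : c₁ < 1 / 2
  c₃_pos : 0 < c₃
  c₃_lt : c₃ < 1 / 2
  re_pos : 0 < t.re
  jumpA_ne : ∀ z : ℂ, -c₃ ≤ z.re → z.re ≤ c₁ → jumpA s₁ s₃ z t ≠ 0

namespace Admissible

variable {s₁ s₃ t : ℂ} {c₁ c₃ : ℝ}

theorem ne_zero (h : Admissible s₁ s₃ c₁ c₃ t) {z : ℂ} (hz : z ∈ vstrip (-c₃) c₁) :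
    jumpA s₁ s₃ z t ≠ 0 := h.jumpA_ne z hz.1 hz.2

theorem decay_pos (h : Admissible s₁ s₃ c₁ c₃ t) : 0 < decay s₁ s₃ := PainleveTwo.decay_pos h.slit

theorem mem_cutPlane (h : Admissible s₁ s₃ c₁ c₃ t) {z : ℂ} (hz : z ∈ vstrip (-c₃) c₁) :
    z ∈ cutPlane :=
  mem_cutPlane_iff.2 (Or.inr (abs_lt.2 ⟨by linarith [hz.1, h.c₃_lt], by linarith [hz.2, h.c₁_lt]⟩))

end Admissible

section Slices

variable {z τ : ℂ} (s₁ s₃ : ℂ)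

theorem differentiableAt_slice_left {f : ℂ → ℂ → ℂ}
    (h : DifferentiableAt ℂ (fun p : ℂ × ℂ => f p.1 p.2) (z, τ)) :
    DifferentiableAt ℂ (fun w => f w τ) z :=
  DifferentiableAt.comp z (g := fun p : ℂ × ℂ => f p.1 p.2) (f := fun w => (w, τ)) h (by fun_prop)

theorem differentiableAt_slice_right {f : ℂ → ℂ → ℂ}
    (h : DifferentiableAt ℂ (fun p : ℂ × ℂ => f p.1 p.2) (z, τ)) :
    DifferentiableAt ℂ (f z) τ :=
  DifferentiableAt.comp τ (g := fun p : ℂ × ℂ => f p.1 p.2) (f := fun w => (z, w)) h (by fun_prop)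

theorem analyticAt_slice {f : ℂ → ℂ → ℂ} (hz : z ∈ cutPlane)
    (h : ∀ w ∈ cutPlane, DifferentiableAt ℂ (fun p : ℂ × ℂ => f p.1 p.2) (w, τ)) :
    AnalyticAt ℂ (fun w => f w τ) z := by
  refine DifferentiableOn.analyticAt (s := cutPlane) (fun w hw => ?_)
    (isOpen_cutPlane.mem_nhds hz)
  exact (differentiableAt_slice_left (h w hw)).differentiableWithinAt

theorem analyticAt_jumpA (hz : z ∈ cutPlane) (hτ : 0 < τ.re) :
    AnalyticAt ℂ (fun w => jumpA s₁ s₃ w τ) z :=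
  analyticAt_slice hz fun w hw => differentiableAt_jumpA s₁ s₃ (p := (w, τ)) hw (Or.inl hτ)

theorem analyticAt_jumpB (hz : z ∈ cutPlane) (hτ : 0 < τ.re) :
    AnalyticAt ℂ (fun w => jumpB s₁ s₃ w τ) z :=
  analyticAt_slice hz fun w hw => differentiableAt_jumpB s₁ s₃ (p := (w, τ)) hw (Or.inl hτ)

theorem analyticAt_jumpC (hz : z ∈ cutPlane) (hτ : 0 < τ.re) :
    AnalyticAt ℂ (fun w => jumpC s₁ s₃ w τ) z :=
  analyticAt_slice hz fun w hw => differentiableAt_jumpC s₁ s₃ (p := (w, τ)) hw (Or.inl hτ)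

theorem differentiableAt_jumpA_time (hz : z ∈ cutPlane) (hτ : 0 < τ.re) :
    DifferentiableAt ℂ (fun τ => jumpA s₁ s₃ z τ) τ :=
  differentiableAt_slice_right (f := jumpA s₁ s₃)
    (differentiableAt_jumpA s₁ s₃ (p := (z, τ)) hz (Or.inl hτ))

theorem differentiableAt_jumpB_time (hz : z ∈ cutPlane) (hτ : 0 < τ.re) :
    DifferentiableAt ℂ (fun τ => jumpB s₁ s₃ z τ) τ :=
  differentiableAt_slice_right (f := jumpB s₁ s₃)
    (differentiableAt_jumpB s₁ s₃ (p := (z, τ)) hz (Or.inl hτ))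

theorem differentiableAt_jumpC_time (hz : z ∈ cutPlane) (hτ : 0 < τ.re) :
    DifferentiableAt ℂ (fun τ => jumpC s₁ s₃ z τ) τ :=
  differentiableAt_slice_right (f := jumpC s₁ s₃)
    (differentiableAt_jumpC s₁ s₃ (p := (z, τ)) hz (Or.inl hτ))

end Slices

namespace Admissible

variable {s₁ s₃ t : ℂ} {c₁ c₃ : ℝ}

/-- The bounds on the jump matrix in the strip, uniform in the time. -/
theorem exists_bounds (h : Admissible s₁ s₃ c₁ c₃ t) :
    ∃ ρ C : ℝ, 0 < ρ ∧ 0 ≤ C ∧ (∀ τ ∈ Metric.closedBall t ρ, 0 < τ.re) ∧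
      ∀ τ ∈ Metric.closedBall t ρ, ∀ z ∈ vstrip (-c₃) c₁,
        ‖jumpA s₁ s₃ z τ - 1‖ ≤ C * (1 + ‖z‖) ^ (-decay s₁ s₃) ∧
        ‖jumpB s₁ s₃ z τ‖ ≤ C * (1 + ‖z‖) ^ (-decay s₁ s₃) ∧
        ‖jumpC s₁ s₃ z τ‖ ≤ C * (1 + ‖z‖) ^ (-decay s₁ s₃) := by
  obtain ⟨ρ, κ, R, C, hρ, hκ, -, hC, hre, hb⟩ :=
    exists_jump_bounds h.s₁_ne h.s₃_ne h.slit h.re_pos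
  have hK := isCompact_closedBall t ρ
  have hδ := h.decay_pos.le
  have hcont : ∀ f : ℂ → ℂ → ℂ, (∀ p : ℂ × ℂ, p.1 ∈ cutPlane → p.2 ∈ slitPlane →
      DifferentiableAt ℂ (fun p : ℂ × ℂ => f p.1 p.2) p) →
      ContinuousOn (fun p : ℂ × ℂ => f p.1 p.2)
        (vstrip (-c₃) c₁ ×ˢ Metric.closedBall t ρ) := fun f hf p hp =>
    (hf p (h.mem_cutPlane hp.1) (Or.inl (hre _ hp.2))).continuousAt.continuousWithinAt
  obtain ⟨C₁, h1, H1⟩ := exists_bound_vstrip (f := fun z τ => jumpA s₁ s₃ z τ - 1) hK hκ hδ hC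
    ((hcont (jumpA s₁ s₃) fun p => differentiableAt_jumpA s₁ s₃).sub continuousOn_const)
    fun τ hτ z hz => (hb τ hτ z hz).1
  obtain ⟨C₂, h2, H2⟩ := exists_bound_vstrip (f := jumpB s₁ s₃) hK hκ hδ hC
    (hcont _ fun p => differentiableAt_jumpB s₁ s₃) fun τ hτ z hz => (hb τ hτ z hz).2.1
  obtain ⟨C₃, h3, H3⟩ := exists_bound_vstrip (f := jumpC s₁ s₃) hK hκ hδ hC
    (hcont _ fun p => differentiableAt_jumpC s₁ s₃) fun τ hτ z hz => (hb τ hτ z hz).2.2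
  refine ⟨ρ, C₁ + C₂ + C₃, hρ, by positivity, hre, fun τ hτ z hz => ⟨?_, ?_, ?_⟩⟩
  · refine (H1 τ hτ z hz).trans ?_
    gcongr; linarith
  · refine (H2 τ hτ z hz).trans ?_
    gcongr; linarith
  · refine (H3 τ hτ z hz).trans ?_
    gcongr; linarith

theorem decaysOn_jumpA_sub_one (h : Admissible s₁ s₃ c₁ c₃ t) :
    DecaysOn (fun z => jumpA s₁ s₃ z t - 1) (decay s₁ s₃) (vstrip (-c₃) c₁) :=
  let ⟨_, C, hρ, _, _, hb⟩ := h.exists_bounds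
  ⟨C, fun z hz => (hb t (Metric.mem_closedBall_self hρ.le) z hz).1⟩

theorem decaysOn_jumpA (h : Admissible s₁ s₃ c₁ c₃ t) :
    DecaysOn (fun z => jumpA s₁ s₃ z t) 0 (vstrip (-c₃) c₁) :=
  ((h.decaysOn_jumpA_sub_one.mono h.decay_pos.le).add (DecaysOn.const 1 _)).congr
    fun z _ => by ring

theorem decaysOn_jumpB (h : Admissible s₁ s₃ c₁ c₃ t) :
    DecaysOn (fun z => jumpB s₁ s₃ z t) (decay s₁ s₃) (vstrip (-c₃) c₁) :=
  let ⟨_, C, hρ, _, _, hb⟩ := h.exists_bounds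
  ⟨C, fun z hz => (hb t (Metric.mem_closedBall_self hρ.le) z hz).2.1⟩

theorem decaysOn_jumpC (h : Admissible s₁ s₃ c₁ c₃ t) :
    DecaysOn (fun z => jumpC s₁ s₃ z t) (decay s₁ s₃) (vstrip (-c₃) c₁) :=
  let ⟨_, C, hρ, _, _, hb⟩ := h.exists_bounds
  ⟨C, fun z hz => (hb t (Metric.mem_closedBall_self hρ.le) z hz).2.2⟩

theorem analyticAt_jumpA (h : Admissible s₁ s₃ c₁ c₃ t) {z : ℂ} (hz : z ∈ vstrip (-c₃) c₁) :
    AnalyticAt ℂ (fun w => jumpA s₁ s₃ w t) z :=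
  PainleveTwo.analyticAt_jumpA s₁ s₃ (h.mem_cutPlane hz) h.re_pos

theorem decaysOn_inv_jumpA (h : Admissible s₁ s₃ c₁ c₃ t) :
    DecaysOn (fun z => (jumpA s₁ s₃ z t)⁻¹) 0 (vstrip (-c₃) c₁) := by
  obtain ⟨C, hC0, hC⟩ := h.decaysOn_jumpA_sub_one.exists_nonneg
  have hlim : Tendsto (fun x : ℝ => C * x ^ (-decay s₁ s₃)) atTop (𝓝 0) := by
    simpa using (tendsto_rpow_neg_atTop h.decay_pos).const_mul C
  obtain ⟨R, hR⟩ := (eventually_atTop.1 (hlim.eventually (eventually_le_nhds one_half_pos)))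
  refine DecaysOn.of_far (R := R) (fun z hz => ?_) ⟨2, fun z hz => ?_⟩
  · exact ((h.analyticAt_jumpA hz).continuousAt.inv₀ (h.ne_zero hz)).continuousWithinAt
  · have h1 := hC z hz.1
    have h2 := hR (1 + ‖z‖) (by
      have h3 : R ≤ |z.im| := hz.2
      linarith [abs_im_le_norm z])
    have h3 : ‖jumpA s₁ s₃ z t - 1‖ ≤ 1 / 2 := h1.trans h2
    have h4 : 1 / 2 ≤ ‖jumpA s₁ s₃ z t‖ := by
      have := norm_sub_norm_le (1 : ℂ) (1 - jumpA s₁ s₃ z t)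
      rw [norm_sub_rev 1 (jumpA s₁ s₃ z t), sub_sub_cancel, norm_one] at this
      linarith
    rw [norm_inv, neg_zero, Real.rpow_zero, mul_one, inv_eq_one_div]
    rw [div_le_iff₀ (by linarith)]
    linarith

/-- Bounds on the jump matrix in the sectors around the imaginary axis, at one time. -/
theorem exists_bounds_farSector (h : Admissible s₁ s₃ c₁ c₃ t) :
    ∃ κ R M : ℝ, 0 < κ ∧ 2 ≤ R ∧ 1 ≤ M ∧ ∀ z ∈ farSector κ R, jumpA s₁ s₃ z t ≠ 0 ∧
      ‖jumpA s₁ s₃ z t‖ ≤ M ∧ ‖(jumpA s₁ s₃ z t)⁻¹‖ ≤ M ∧ ‖jumpB s₁ s₃ z t‖ ≤ M ∧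
      ‖jumpC s₁ s₃ z t‖ ≤ M := by
  obtain ⟨ρ, κ, R, C, hρ, hκ, hR2, hC, -, hb⟩ :=
    exists_jump_bounds h.s₁_ne h.s₃_ne h.slit h.re_pos
  have hlim : Tendsto (fun x : ℝ => C * x ^ (-decay s₁ s₃)) atTop (𝓝 0) := by
    simpa using (tendsto_rpow_neg_atTop h.decay_pos).const_mul C
  obtain ⟨R', hR'⟩ := (eventually_atTop.1 (hlim.eventually (eventually_le_nhds one_half_pos)))
  refine ⟨κ, max R R', 2, hκ, hR2.trans (le_max_left _ _), by norm_num, fun z hz => ?_⟩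
  obtain ⟨h1, h2, h3⟩ := hb t (Metric.mem_closedBall_self hρ.le) z
    ⟨(le_max_left _ _).trans hz.1, hz.2⟩
  have h4 := hR' ‖z‖ (((le_max_right _ _).trans hz.1).trans (abs_im_le_norm z))
  have h5 : 1 / 2 ≤ ‖jumpA s₁ s₃ z t‖ := by
    have := norm_sub_norm_le (1 : ℂ) (1 - jumpA s₁ s₃ z t)
    rw [norm_sub_rev 1 (jumpA s₁ s₃ z t), sub_sub_cancel, norm_one] at this
    linarith
  refine ⟨norm_pos_iff.1 (by linarith), ?_, ?_, by linarith, by linarith⟩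
  · have := norm_sub_norm_le (jumpA s₁ s₃ z t) 1
    rw [norm_one] at this
    linarith
  · rw [norm_inv, inv_eq_one_div, div_le_iff₀ (by linarith)]
    linarith

theorem farSector_subset_cutPlane {κ R : ℝ} (hR : 2 ≤ R) : farSector κ R ⊆ cutPlane :=
  fun z hz => mem_cutPlane_iff.2 (Or.inl (abs_pos.1 (by linarith [hz.1])))

theorem decaysOn_deriv_jumpA (h : Admissible s₁ s₃ c₁ c₃ t) :
    DecaysOn (deriv fun z => jumpA s₁ s₃ z t) 1 (vstrip (-c₃) c₁) := by
  obtain ⟨κ, R, M, hκ, hR, -, hb⟩ := h.exists_bounds_farSector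
  set s : ℝ := min (1 / 6) (κ / 6) with hs
  have hs0 : 0 < s := lt_min (by norm_num) (by positivity)
  refine decaysOn_deriv (g := fun z => jumpA s₁ s₃ z t) (R := max (2 * R) (1 / s))
    (M := M) (isClosed_vstrip _ _) hs0
    (fun z hz => h.analyticAt_jumpA hz) fun z hz hz' => ⟨EventuallyEq.rfl, fun w hw => ?_⟩
  have hz1 : 1 ≤ s * ‖z‖ := by
    have := (le_max_right _ _).trans hz'
    rw [div_le_iff₀ hs0] at this; linarith
  have hre : |z.re| ≤ 1 := abs_le.2 ⟨by linarith [hz.1, h.c₃_lt], by linarith [hz.2, h.c₁_lt]⟩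
  have hmem := mem_farSector_of_mem_closedBall hκ.le (min_le_right _ _) (min_le_left _ _)
    ((le_max_left _ _).trans hz') hz1 (by linarith) hw
  exact ⟨(PainleveTwo.analyticAt_jumpA s₁ s₃ (farSector_subset_cutPlane hR hmem)
    h.re_pos).differentiableAt, (hb w hmem).2.1⟩

theorem decaysOn_logDeriv_jumpA (h : Admissible s₁ s₃ c₁ c₃ t) :
    DecaysOn (fun z => deriv (fun v => jumpA s₁ s₃ v t) z / jumpA s₁ s₃ z t) 1
      (vstrip (-c₃) c₁) := by
  simpa [div_eq_mul_inv] using h.decaysOn_deriv_jumpA.mul h.decaysOn_inv_jumpA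

/-- The time derivative of the jump matrix decays like the jump matrix. -/
theorem exists_bounds_deriv_time (h : Admissible s₁ s₃ c₁ c₃ t) :
    ∃ ρ C : ℝ, 0 < ρ ∧ 0 ≤ C ∧ (∀ τ ∈ Metric.closedBall t ρ, 0 < τ.re) ∧
      ∀ τ ∈ Metric.closedBall t ρ, ∀ z ∈ vstrip (-c₃) c₁,
        ‖deriv (fun τ => jumpA s₁ s₃ z τ) τ‖ ≤ C * (1 + ‖z‖) ^ (-decay s₁ s₃) ∧
        ‖deriv (fun τ => jumpB s₁ s₃ z τ) τ‖ ≤ C * (1 + ‖z‖) ^ (-decay s₁ s₃) ∧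
        ‖deriv (fun τ => jumpC s₁ s₃ z τ) τ‖ ≤ C * (1 + ‖z‖) ^ (-decay s₁ s₃) := by
  obtain ⟨ρ, C, hρ, hC, hre, hb⟩ := h.exists_bounds
  refine ⟨ρ / 2, C / (ρ / 2), half_pos hρ, by positivity, fun τ hτ => hre τ
    (Metric.closedBall_subset_closedBall (by linarith) hτ), fun τ hτ z hz => ?_⟩
  have hzc := h.mem_cutPlane hz
  rw [div_mul_eq_mul_div]
  refine ⟨?_, ?_, ?_⟩
  · rw [← deriv_sub_const (f := fun τ => jumpA s₁ s₃ z τ) (1 : ℂ)]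
    exact norm_deriv_time_le hρ (fun τ hτ => (differentiableAt_jumpA_time s₁ s₃ hzc
      (hre τ hτ)).sub_const 1) (fun τ hτ => (hb τ hτ z hz).1) hτ
  · exact norm_deriv_time_le hρ (fun τ hτ => differentiableAt_jumpB_time s₁ s₃ hzc
      (hre τ hτ)) (fun τ hτ => (hb τ hτ z hz).2.1) hτ
  · exact norm_deriv_time_le hρ (fun τ hτ => differentiableAt_jumpC_time s₁ s₃ hzc
      (hre τ hτ)) (fun τ hτ => (hb τ hτ z hz).2.2) hτ

theorem decaysOn_deriv_time_jumpA (h : Admissible s₁ s₃ c₁ c₃ t) :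
    DecaysOn (fun z => deriv (fun τ => jumpA s₁ s₃ z τ) t) (decay s₁ s₃) (vstrip (-c₃) c₁) :=
  let ⟨_, C, hρ, _, _, hb⟩ := h.exists_bounds_deriv_time
  ⟨C, fun z hz => (hb t (Metric.mem_closedBall_self hρ.le) z hz).1⟩

theorem decaysOn_deriv_time_jumpB (h : Admissible s₁ s₃ c₁ c₃ t) :
    DecaysOn (fun z => deriv (fun τ => jumpB s₁ s₃ z τ) t) (decay s₁ s₃) (vstrip (-c₃) c₁) :=
  let ⟨_, C, hρ, _, _, hb⟩ := h.exists_bounds_deriv_time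
  ⟨C, fun z hz => (hb t (Metric.mem_closedBall_self hρ.le) z hz).2.1⟩

theorem decaysOn_deriv_time_jumpC (h : Admissible s₁ s₃ c₁ c₃ t) :
    DecaysOn (fun z => deriv (fun τ => jumpC s₁ s₃ z τ) t) (decay s₁ s₃) (vstrip (-c₃) c₁) :=
  let ⟨_, C, hρ, _, _, hb⟩ := h.exists_bounds_deriv_time
  ⟨C, fun z hz => (hb t (Metric.mem_closedBall_self hρ.le) z hz).2.2⟩

end Admissible

namespace Admissible

variable {s₁ s₃ t : ℂ} {c₁ c₃ : ℝ}

theorem exists_time_ball (h : Admissible s₁ s₃ c₁ c₃ t) :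
    ∃ ρ : ℝ, 0 < ρ ∧ ∀ τ ∈ Metric.closedBall t ρ, 0 < τ.re :=
  let ⟨ρ, _, hρ, _, hre, _⟩ := h.exists_bounds
  ⟨ρ, hρ, hre⟩

section Lines

variable {c : ℝ}

theorem aestronglyMeasurable_deriv_time_of (h : Admissible s₁ s₃ c₁ c₃ t) (h1 : -c₃ ≤ c)
    (h2 : c ≤ c₁) {f : ℂ → ℂ → ℂ} (hf : ∀ p : ℂ × ℂ, p.1 ∈ cutPlane → p.2 ∈ slitPlane →
      DifferentiableAt ℂ (fun p : ℂ × ℂ => f p.1 p.2) p) :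
    AEStronglyMeasurable (fun y : ℝ => deriv (f (c + y * I)) t) := by
  obtain ⟨ρ, hρ, hre⟩ := h.exists_time_ball
  refine aestronglyMeasurable_deriv_time hρ (fun τ hτ z hz => ?_) fun z hz => ?_
  · exact (differentiableAt_slice_left (hf (z, τ) (h.mem_cutPlane (vline_subset_vstrip h1 h2 hz))
      (Or.inl (hre τ hτ)))).continuousAt.continuousWithinAt
  · exact differentiableAt_slice_right (hf (z, t) (h.mem_cutPlane (vline_subset_vstrip h1 h2 hz))
      (Or.inl h.re_pos))

theorem continuousOn_jumpA (h : Admissible s₁ s₃ c₁ c₃ t) :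
    ContinuousOn (fun z => jumpA s₁ s₃ z t) (vstrip (-c₃) c₁) := fun _ hz =>
  (h.analyticAt_jumpA hz).continuousAt.continuousWithinAt

theorem continuousOn_inv_jumpA (h : Admissible s₁ s₃ c₁ c₃ t) :
    ContinuousOn (fun z => (jumpA s₁ s₃ z t)⁻¹) (vstrip (-c₃) c₁) :=
  h.continuousOn_jumpA.inv₀ fun _ hz => h.ne_zero hz

/-- `Ȧ / A` along a line. -/
theorem aestronglyMeasurable_dotA_div (h : Admissible s₁ s₃ c₁ c₃ t) (h1 : -c₃ ≤ c)
    (h2 : c ≤ c₁) : AEStronglyMeasurable (fun y : ℝ =>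
      deriv (fun τ => jumpA s₁ s₃ (c + y * I) τ) t / jumpA s₁ s₃ (c + y * I) t) := by
  have ha := h.aestronglyMeasurable_deriv_time_of h1 h2 (f := jumpA s₁ s₃)
    fun p => differentiableAt_jumpA s₁ s₃
  simp only [div_eq_mul_inv]
  exact ha.mul (aestronglyMeasurable_line (h.continuousOn_inv_jumpA.mono (vline_subset_vstrip h1 h2)))

theorem decaysOn_dotA_div (h : Admissible s₁ s₃ c₁ c₃ t) :
    DecaysOn (fun z => deriv (fun τ => jumpA s₁ s₃ z τ) t / jumpA s₁ s₃ z t) (decay s₁ s₃)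
      (vstrip (-c₃) c₁) := by
  simpa [div_eq_mul_inv] using h.decaysOn_deriv_time_jumpA.mul h.decaysOn_inv_jumpA

theorem deriv_time_div (h : Admissible s₁ s₃ c₁ c₃ t) {f : ℂ → ℂ → ℂ} {z : ℂ}
    (hz : z ∈ vstrip (-c₃) c₁) (hf : DifferentiableAt ℂ (f z) t) :
    deriv (fun τ => f z τ / jumpA s₁ s₃ z τ) t =
      (deriv (f z) t * jumpA s₁ s₃ z t - f z t * deriv (fun τ => jumpA s₁ s₃ z τ) t) *
        ((jumpA s₁ s₃ z t)⁻¹ * (jumpA s₁ s₃ z t)⁻¹) := by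
  rw [deriv_fun_div hf (differentiableAt_jumpA_time s₁ s₃ (h.mem_cutPlane hz) h.re_pos)
    (h.ne_zero hz)]
  rw [div_eq_mul_inv, sq, mul_inv]

theorem decaysOn_deriv_time_div (h : Admissible s₁ s₃ c₁ c₃ t) {f : ℂ → ℂ → ℂ}
    (hf : ∀ p : ℂ × ℂ, p.1 ∈ cutPlane → p.2 ∈ slitPlane →
      DifferentiableAt ℂ (fun p : ℂ × ℂ => f p.1 p.2) p)
    (hd : DecaysOn (fun z => f z t) (decay s₁ s₃) (vstrip (-c₃) c₁))
    (hd' : DecaysOn (fun z => deriv (f z) t) (decay s₁ s₃) (vstrip (-c₃) c₁)) :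
    DecaysOn (fun z => deriv (fun τ => f z τ / jumpA s₁ s₃ z τ) t) (decay s₁ s₃)
      (vstrip (-c₃) c₁) := by
  have hA := h.decaysOn_inv_jumpA.mul h.decaysOn_inv_jumpA
  have h1 := hd'.mul h.decaysOn_jumpA
  have h2 := hd.mul (h.decaysOn_deriv_time_jumpA.mono h.decay_pos.le)
  have h3 := (h1.sub h2).mul hA
  simp only [add_zero] at h3
  exact h3.congr fun z hz => h.deriv_time_div hz (differentiableAt_slice_right
    (hf (z, t) (h.mem_cutPlane hz) (Or.inl h.re_pos)))

theorem aestronglyMeasurable_deriv_time_div (h : Admissible s₁ s₃ c₁ c₃ t) (h1 : -c₃ ≤ c)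
    (h2 : c ≤ c₁) {f : ℂ → ℂ → ℂ} (hf : ∀ p : ℂ × ℂ, p.1 ∈ cutPlane → p.2 ∈ slitPlane →
      DifferentiableAt ℂ (fun p : ℂ × ℂ => f p.1 p.2) p) :
    AEStronglyMeasurable (fun y : ℝ =>
      deriv (fun τ => f (c + y * I) τ / jumpA s₁ s₃ (c + y * I) τ) t) := by
  have hs := vline_subset_vstrip h1 h2
  have e : ∀ y : ℝ, _ := fun y => h.deriv_time_div (f := f) (hs (linePoint_mem c y))
    (differentiableAt_slice_right
      (hf (_, t) (h.mem_cutPlane (hs (linePoint_mem c y))) (Or.inl h.re_pos)))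
  simp only [e]
  have mf : AEStronglyMeasurable (fun y : ℝ => f (c + y * I) t) :=
    aestronglyMeasurable_line (f := fun z => f z t) fun z hz => (differentiableAt_slice_left
      (hf (z, t) (h.mem_cutPlane (hs hz)) (Or.inl h.re_pos))).continuousAt.continuousWithinAt
  have mA := aestronglyMeasurable_line (h.continuousOn_jumpA.mono hs)
  have mI := aestronglyMeasurable_line (h.continuousOn_inv_jumpA.mono hs)
  have mf' := h.aestronglyMeasurable_deriv_time_of h1 h2 hf
  have mA' := h.aestronglyMeasurable_deriv_time_of h1 h2 (f := jumpA s₁ s₃)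
    fun p => differentiableAt_jumpA s₁ s₃
  exact ((mf'.mul mA).sub (mf.mul mA')).mul (mI.mul mI)

end Lines

/-! ### The logarithm of `A` and the function `φ` -/

theorem norm_log_le_of_norm_sub_one_le {a : ℂ} (ha : ‖a - 1‖ ≤ 1 / 2) :
    ‖log a‖ ≤ 3 / 2 * ‖a - 1‖ := by
  have := norm_log_one_add_half_le_self ha
  rwa [add_sub_cancel] at this

theorem mem_slitPlane_of_norm_sub_one_le {a : ℂ} (ha : ‖a - 1‖ ≤ 1 / 2) : a ∈ slitPlane := by
  have := mem_slitPlane_of_norm_lt_one (z := a - 1) (by linarith)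
  rwa [add_sub_cancel] at this

theorem isLogBranch_unique {a L L' : ℝ → ℂ} (hL : IsLogBranch a L) (hL' : IsLogBranch a L') :
    L = L' := by
  have hc : ∀ x y, L x - L' x = L y - L' y := fun x y =>
    sub_eq_sub_of_exp_eq isPreconnected_univ hL.1.continuousOn hL'.1.continuousOn
      (fun x _ => by rw [hL.2.1, hL'.2.1]) trivial trivial
  have h0 : Tendsto (fun y => L y - L' y) (cocompact ℝ) (𝓝 0) := by
    simpa using hL.2.2.sub hL'.2.2
  funext x
  have h1 : Tendsto (fun y => L y - L' y) (cocompact ℝ) (𝓝 (L x - L' x)) := by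
    simp only [fun y => hc y x]
    exact tendsto_const_nhds
  exact sub_eq_zero.1 (tendsto_nhds_unique h1 h0)

theorem logBranch_eq {a L : ℝ → ℂ} (hL : IsLogBranch a L) : logBranch a = L :=
  isLogBranch_unique (Classical.epsilon_spec ⟨L, hL⟩) hL

/-- An analytic logarithm of `A` that decays at infinity exists near the imaginary axis. It decays
at both ends of the strip, because it inherits the symmetry `A(-z) = A(z)`. -/
theorem exists_log (h : Admissible s₁ s₃ c₁ c₃ t) :
    ∃ L : ℂ → ℂ, (∀ z, |z.re| < min c₁ c₃ → AnalyticAt ℂ L z) ∧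
      (∀ z, |z.re| < min c₁ c₃ → exp (L z) = jumpA s₁ s₃ z t) ∧
      ∀ d < min c₁ c₃, DecaysOn L (decay s₁ s₃) (vstrip (-d) d) := by
  set m : ℝ := min c₁ c₃ with hm
  have hm0 : 0 < m := lt_min h.c₁_pos h.c₃_pos
  set U : Set ℂ := {z | |z.re| < m} with hU
  have hUre : U = re ⁻¹' (Set.Ioo (-m) m) := by ext z; simp [hU, abs_lt]
  have hUo : IsOpen U := by rw [hUre]; exact isOpen_Ioo.preimage continuous_re
  have hUc : Convex ℝ U := by
    rw [hUre]; exact (convex_Ioo (-m) m).linear_preimage reLm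
  have hU0 : (0 : ℂ) ∈ U := by simpa [hU] using hm0
  have hUs : U ⊆ vstrip (-c₃) c₁ := fun z hz => by
    have := abs_lt.1 (show |z.re| < m from hz)
    exact ⟨by linarith [this.1, min_le_right c₁ c₃], by linarith [this.2, min_le_left c₁ c₃]⟩
  have hUneg : ∀ z ∈ U, -z ∈ U := fun z hz => by simpa [hU] using hz
  have hsc : IsSimplyConnected U := by
    have := hUc.contractibleSpace ⟨0, hU0⟩
    exact SimplyConnectedSpace.ofContractible U
  obtain ⟨L₀, hL₀c, hL₀⟩ := exists_continuousOn_eqOn_exp_comp hsc hUo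
    (h.continuousOn_jumpA.mono hUs) (by rintro ⟨z, hz, h0⟩; exact h.ne_zero (hUs hz) h0)
  have hexp : ∀ z ∈ U, exp (L₀ z) = jumpA s₁ s₃ z t := fun z hz => hL₀ hz
  have hpre : IsPreconnected U := hUc.isPreconnected
  -- the logarithm is even
  have heven : ∀ z ∈ U, L₀ (-z) = L₀ z := fun z hz => by
    have := sub_eq_sub_of_exp_eq hpre (f := fun z => L₀ (-z)) (g := L₀)
      (hL₀c.comp continuousOn_neg hUneg) hL₀c
      (fun x hx => by rw [hexp _ (hUneg x hx), hexp x hx, jumpA_neg]) hz hU0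
    simpa [sub_eq_zero] using this
  -- it is analytic
  have hanal : ∀ z ∈ U, AnalyticAt ℂ L₀ z := fun z hz => by
    have hne := h.ne_zero (hUs hz)
    have hAz := h.analyticAt_jumpA (hUs hz)
    have hq : AnalyticAt ℂ (fun w => jumpA s₁ s₃ w t / jumpA s₁ s₃ z t) z :=
      hAz.div analyticAt_const hne
    have hq1 : jumpA s₁ s₃ z t / jumpA s₁ s₃ z t = 1 := div_self hne
    have hlog : AnalyticAt ℂ (fun w => L₀ z + log (jumpA s₁ s₃ w t / jumpA s₁ s₃ z t)) z :=
      analyticAt_const.add (hq.clog (by rw [hq1]; exact one_mem_slitPlane))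
    refine hlog.congr ?_
    have hev1 : ∀ᶠ w in 𝓝 z, ‖jumpA s₁ s₃ w t / jumpA s₁ s₃ z t - 1‖ < 1 / 2 := by
      have : ContinuousAt (fun w => ‖jumpA s₁ s₃ w t / jumpA s₁ s₃ z t - 1‖) z :=
        (hq.continuousAt.sub continuousAt_const).norm
      refine this.eventually_lt continuousAt_const ?_
      rw [hq1, sub_self, norm_zero]; norm_num
    obtain ⟨r, hr, hball⟩ := Metric.mem_nhds_iff.1 (hev1.and (hUo.mem_nhds hz))
    refine Filter.mem_of_superset (Metric.ball_mem_nhds z hr) fun w hw => ?_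
    have hsl : ∀ v ∈ Metric.ball z r, jumpA s₁ s₃ v t / jumpA s₁ s₃ z t ∈ slitPlane :=
      fun v hv => mem_slitPlane_of_norm_sub_one_le (hball hv).1.le
    have := sub_eq_sub_of_exp_eq (convex_ball z r).isPreconnected
      (f := L₀) (g := fun w => L₀ z + log (jumpA s₁ s₃ w t / jumpA s₁ s₃ z t))
      (hL₀c.mono fun v hv => (hball hv).2)
      (fun v hv => ContinuousAt.continuousWithinAt (continuousAt_const.add
        (((h.analyticAt_jumpA (hUs (hball hv).2)).continuousAt.div_const _).clog (hsl v hv))))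
      (fun v hv => by
        rw [exp_add, exp_log (slitPlane_ne_zero (hsl v hv)), hexp z hz, hexp v (hball hv).2,
          mul_div_cancel₀ _ hne]) hw (Metric.mem_ball_self hr)
    simp only [hq1, log_one, add_zero, sub_self] at this
    exact (sub_eq_zero.1 this).symm
  -- far from the real axis it differs by a constant from the principal logarithm
  obtain ⟨C, hC0, hC⟩ := h.decaysOn_jumpA_sub_one.exists_nonneg
  have hlim : Tendsto (fun x : ℝ => C * x ^ (-decay s₁ s₃)) atTop (𝓝 0) := by
    simpa using (tendsto_rpow_neg_atTop h.decay_pos).const_mul C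
  obtain ⟨R, hR⟩ := (eventually_atTop.1 (hlim.eventually (eventually_le_nhds one_half_pos)))
  set R' : ℝ := max R 1
  have hnear : ∀ z ∈ U, R' ≤ |z.im| → ‖jumpA s₁ s₃ z t - 1‖ ≤ 1 / 2 := fun z hz hz' =>
    (hC z (hUs hz)).trans (hR _ (by
      linarith [abs_im_le_norm z, (le_max_left R 1).trans hz']))
  set V : Set ℂ := U ∩ im ⁻¹' (Set.Ici R') with hV
  have hVc : Convex ℝ V := hUc.inter ((convex_Ici R').linear_preimage imLm)
  have hVim : ∀ z ∈ V, R' ≤ |z.im| := fun z hz => le_trans hz.2 (le_abs_self _)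
  have hp : (R' * I : ℂ) ∈ V := by simp [hV, hU, hm0]
  set k : ℂ := L₀ (R' * I) - log (jumpA s₁ s₃ (R' * I) t) with hk
  have hupper : ∀ z ∈ V, L₀ z - log (jumpA s₁ s₃ z t) = k := fun z hz =>
    sub_eq_sub_of_exp_eq hVc.isPreconnected (f := L₀) (g := fun z => log (jumpA s₁ s₃ z t))
      (hL₀c.mono fun z hz => hz.1)
      (fun v hv => ContinuousAt.continuousWithinAt
        ((h.analyticAt_jumpA (hUs hv.1)).continuousAt.clog
          (mem_slitPlane_of_norm_sub_one_le (hnear v hv.1 (hVim v hv)))))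
      (fun v hv => by
        rw [exp_log (h.ne_zero (hUs hv.1)), hexp v hv.1]) hz hp
  have hfar : ∀ z ∈ U, R' ≤ |z.im| → L₀ z - k = log (jumpA s₁ s₃ z t) := fun z hz hz' => by
    rcases le_abs'.1 hz' with h1 | h1
    · have := hupper (-z) ⟨hUneg z hz, by simp only [Set.mem_preimage, neg_im, Set.mem_Ici]; linarith⟩
      rw [heven z hz, jumpA_neg] at this
      rw [← this]; ring
    · rw [← hupper z ⟨hz, h1⟩]; ring
  have hexpk : exp k = 1 := by
    rw [hk, exp_sub, exp_log (h.ne_zero (hUs hp.1)), hexp _ hp.1, div_self (h.ne_zero (hUs hp.1))]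
  refine ⟨fun z => L₀ z - k, fun z hz => (hanal z hz).sub analyticAt_const,
    fun z hz => by rw [exp_sub, hexpk, div_one, hexp z hz], fun d hd => ?_⟩
  have hdU : vstrip (-d) d ⊆ U := fun z hz => lt_of_le_of_lt (abs_le.2 hz) hd
  refine DecaysOn.of_far (R := R') (fun z hz => ?_) ⟨3 / 2 * C, fun z hz => ?_⟩
  · exact ((hanal z (hdU hz)).sub analyticAt_const).continuousAt.continuousWithinAt
  · have hzU := hdU hz.1
    show ‖L₀ z - k‖ ≤ _
    rw [hfar z hzU hz.2]
    refine (norm_log_le_of_norm_sub_one_le (hnear z hzU hz.2)).trans ?_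
    rw [mul_assoc]
    gcongr
    exact hC z (hUs hzU)

end Admissible

theorem DecaysOn.tendsto_zero {f : ℂ → ℂ} {r : ℝ} {S : Set ℂ} (h : DecaysOn f r S) (hr : 0 < r) :
    Tendsto f (Bornology.cobounded ℂ ⊓ 𝓟 S) (𝓝 0) := by
  obtain ⟨C, hC⟩ := h
  have h1 : Tendsto (fun z : ℂ => C * (1 + ‖z‖) ^ (-r)) (Bornology.cobounded ℂ) (𝓝 0) := by
    have h2 : Tendsto (fun z : ℂ => 1 + ‖z‖) (Bornology.cobounded ℂ) atTop :=
      tendsto_atTop_add_const_left _ _ tendsto_norm_cobounded_atTop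
    simpa using ((tendsto_rpow_neg_atTop hr).comp h2).const_mul C
  refine squeeze_zero_norm' ?_ (h1.mono_left inf_le_left)
  filter_upwards [mem_inf_of_right (mem_principal_self S)] with z hz using hC z hz

theorem tendsto_ofReal_mul_I_cocompact :
    Tendsto (fun y : ℝ => (y * I : ℂ)) (cocompact ℝ) (Bornology.cobounded ℂ ⊓ 𝓟 (vline 0)) := by
  refine tendsto_inf.2 ⟨?_, tendsto_principal.2 (Eventually.of_forall fun y => by simp [vline])⟩
  rw [← tendsto_norm_atTop_iff_cobounded]
  exact (tendsto_norm_cocompact_atTop (E := ℝ)).congr fun y => by simp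

namespace Admissible

variable {s₁ s₃ t : ℂ} {c₁ c₃ : ℝ}

theorem phi_eq_exp_cauchyTr {L : ℂ → ℂ} {τ : ℂ}
    (hL : IsLogBranch (fun u : ℝ => jumpA s₁ s₃ (u * I) τ) fun y => L (y * I)) (z : ℂ) :
    phi s₁ s₃ z τ = exp (cauchyTr 0 L z) := by
  unfold phi cauchyTr lineInt
  rw [logBranch_eq hL]
  simp only [ofReal_zero, zero_add]

theorem isLogBranch_of_decaysOn {L : ℂ → ℂ} {a : ℂ → ℂ} {r : ℝ} (hr : 0 < r)
    (hc : ContinuousOn L (vline 0)) (he : ∀ z ∈ vline 0, exp (L z) = a z)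
    (hd : DecaysOn L r (vline 0)) :
    IsLogBranch (fun u : ℝ => a (u * I)) fun y => L (y * I) := by
  have hm : ∀ y : ℝ, (y * I : ℂ) ∈ vline 0 := fun y => by simp [vline]
  exact ⟨hc.comp_continuous (by fun_prop) hm, fun y => he _ (hm y),
    (hd.tendsto_zero hr).comp tendsto_ofReal_mul_I_cocompact⟩

/-- The function `φ` extends analytically from the right half plane across the imaginary axis; on
the left of the axis the extension is `φ / A`. -/
theorem exists_phi_right (h : Admissible s₁ s₃ c₁ c₃ t) :
    ∃ (φ : ℂ → ℂ) (η : ℝ), 0 < η ∧ η < min c₁ c₃ ∧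
      (∀ z : ℂ, -η < z.re → AnalyticAt ℂ φ z) ∧ (∀ z, φ z ≠ 0) ∧
      (∀ z : ℂ, 0 < z.re → phi s₁ s₃ z t = φ z) ∧
      (∀ z : ℂ, -η < z.re → z.re < 0 → phi s₁ s₃ z t = jumpA s₁ s₃ z t * φ z) ∧
      (∀ z : ℂ, z.re < 0 → AnalyticAt ℂ (fun z => phi s₁ s₃ z t) z) ∧
      Tendsto φ (Bornology.cobounded ℂ ⊓ 𝓟 {z | -(η / 2) ≤ z.re}) (𝓝 1) ∧
      Tendsto (fun z => phi s₁ s₃ z t)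
        (Bornology.cobounded ℂ ⊓ 𝓟 {z | z.re ≤ -(η / 2)}) (𝓝 1) := by
  obtain ⟨L, hLa, hLe, hLd⟩ := h.exists_log
  have hm0 : 0 < min c₁ c₃ := lt_min h.c₁_pos h.c₃_pos
  set m : ℝ := min c₁ c₃
  set η : ℝ := m / 2 with hη
  have hη0 : 0 < η := half_pos hm0
  have hηm : η < m := half_lt_self hm0
  have hδ := h.decay_pos
  have hdec := hLd η hηm
  have han : ∀ z ∈ vstrip (-η) η, AnalyticAt ℂ L z := fun z hz =>
    hLa z (lt_of_le_of_lt (abs_le.2 hz) hηm)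
  have hc : ContinuousOn L (vstrip (-η) η) := fun z hz =>
    (han z hz).continuousAt.continuousWithinAt
  have hs0 : vline 0 ⊆ vstrip (-η) η := vline_subset_vstrip (by linarith) hη0.le
  have hs1 : vline (-η) ⊆ vstrip (-η) η := vline_subset_vstrip le_rfl (by linarith)
  have hphi : ∀ z, phi s₁ s₃ z t = exp (cauchyTr 0 L z) := phi_eq_exp_cauchyTr
    (isLogBranch_of_decaysOn (a := fun z => jumpA s₁ s₃ z t) hδ (hc.mono hs0)
      (fun z hz => hLe z (lt_of_le_of_lt (abs_le.2 (hs0 hz)) hηm)) (hdec.mono_set hs0))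
  have hm1 := aestronglyMeasurable_line (hc.mono hs1)
  have hmz := aestronglyMeasurable_line (hc.mono hs0)
  have hd1 : ∀ z : ℂ, z.re ≠ -η → AnalyticAt ℂ (cauchyTr (-η) L) z := fun z hz =>
    DifferentiableOn.analyticAt (s := {z : ℂ | z.re ≠ -η})
      (fun w hw => (differentiableAt_cauchyTr hδ hm1 (hdec.mono_set hs1)
        hw).differentiableWithinAt)
      ((isOpen_ne.preimage continuous_re).mem_nhds hz)
  have hd0 : ∀ z : ℂ, z.re ≠ 0 → AnalyticAt ℂ (cauchyTr 0 L) z := fun z hz =>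
    DifferentiableOn.analyticAt (s := {z : ℂ | z.re ≠ 0})
      (fun w hw => (differentiableAt_cauchyTr hδ hmz (hdec.mono_set hs0)
        hw).differentiableWithinAt)
      ((isOpen_ne.preimage continuous_re).mem_nhds hz)
  refine ⟨fun z => exp (cauchyTr (-η) L z), η, hη0, hηm, fun z hz => (hd1 z hz.ne').cexp,
    fun z => exp_ne_zero _, fun z hz => ?_, fun z hz hz' => ?_, fun z hz => ?_, ?_, ?_⟩
  · rw [hphi z]
    congr 1
    unfold cauchyTr
    refine (lineInt_eq_of_decaysOn (r := decay s₁ s₃ + 1) (by linarith) (by linarith)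
      (fun w hw => ?_) ?_).symm
    · have h1 : w - z ≠ 0 := fun h0 => by
        have h1 := congrArg re h0
        have h2 := hw.2
        simp only [sub_re, zero_re] at h1
        linarith
      exact (han w ⟨hw.1, hw.2.trans hη0.le⟩).differentiableAt.div (by fun_prop) h1
    · simp only [div_eq_mul_inv]
      refine (hdec.mono_set fun w hw => ⟨hw.1, hw.2.trans hη0.le⟩).mul
        (DecaysOn.inv_sub hz fun w hw => ?_)
      have h1 := abs_re_sub_le_norm w z
      have h2 := neg_abs_le (w.re - z.re)
      have h3 := hw.2
      linarith
  · have := lineInt_div_sub_sub_lineInt_div_sub (f := L) hz hz' hδ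
      (fun w hw => (han w ⟨hw.1, hw.2.trans hη0.le⟩).differentiableAt)
      (hdec.mono_set fun w hw => ⟨hw.1, hw.2.trans hη0.le⟩)
    have hzm : |z.re| < m := abs_lt.2 ⟨by linarith, by linarith⟩
    rw [hphi z, ← hLe z hzm, ← exp_add, ← this]
    congr 1
    unfold cauchyTr
    ring
  · simp only [hphi]
    exact (hd0 z hz.ne).cexp
  · have h1 := ((decaysOn_cauchyTr hδ (decay_le_one s₁ s₃) (half_pos hη0)
      (hdec.mono_set hs1)).mono_set (S' := {z | -(η / 2) ≤ z.re}) fun z hz => by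
        have hz' : -(η / 2) ≤ z.re := hz
        show η / 2 ≤ |(-η) - z.re|
        rw [abs_sub_comm]
        exact le_trans (by linarith) (le_abs_self _)).tendsto_zero (by linarith)
    simpa [Function.comp_def] using (continuous_exp.tendsto 0).comp h1
  · have h1 := ((decaysOn_cauchyTr hδ (decay_le_one s₁ s₃) (half_pos hη0)
      (hdec.mono_set hs0)).mono_set (S' := {z | z.re ≤ -(η / 2)}) fun z hz => by
        have hz' : z.re ≤ -(η / 2) := hz
        show η / 2 ≤ |0 - z.re|
        exact le_trans (by linarith) (le_abs_self _)).tendsto_zero (by linarith)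
    have h2 := (continuous_exp.tendsto 0).comp h1
    simp only [hphi]
    simpa [Function.comp_def] using h2

/-- The logarithm of `A` at times near `t`, on the imaginary axis. -/
theorem exists_log_near (h : Admissible s₁ s₃ c₁ c₃ t) :
    ∃ (L : ℂ → ℂ → ℂ) (ρ C : ℝ), 0 < ρ ∧ 0 ≤ C ∧
      ∀ τ ∈ Metric.ball t ρ,
        ContinuousOn (fun z => L z τ) (vline 0) ∧ DecaysOn (fun z => L z τ) (decay s₁ s₃) (vline 0) ∧
        ∀ z ∈ vline 0, exp (L z τ) = jumpA s₁ s₃ z τ ∧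
          HasDerivAt (L z) (deriv (fun τ => jumpA s₁ s₃ z τ) τ / jumpA s₁ s₃ z τ) τ ∧
          ‖deriv (fun τ => jumpA s₁ s₃ z τ) τ / jumpA s₁ s₃ z τ‖ ≤
            C * (1 + ‖z‖) ^ (-decay s₁ s₃) := by
  obtain ⟨L, hLa, hLe, hLd⟩ := h.exists_log
  have hm0 : 0 < min c₁ c₃ := lt_min h.c₁_pos h.c₃_pos
  obtain ⟨ρ, C, hρ, hC, hre, hb⟩ := h.exists_bounds_deriv_time
  obtain ⟨M, hM0, hM⟩ := h.decaysOn_inv_jumpA.exists_nonneg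
  simp only [neg_zero, Real.rpow_zero, mul_one] at hM
  have hs : vline 0 ⊆ vstrip (-c₃) c₁ :=
    vline_subset_vstrip (by linarith [h.c₃_pos]) h.c₁_pos.le
  have hδ := h.decay_pos
  set ρ' : ℝ := min ρ (1 / (2 * (C * M + 1))) with hρ'
  have hCM : 0 ≤ C * M := by positivity
  have hρ0 : 0 < ρ' := lt_min hρ (by positivity)
  have hball : Metric.ball t ρ' ⊆ Metric.closedBall t ρ :=
    Metric.ball_subset_closedBall.trans (Metric.closedBall_subset_closedBall (min_le_left _ _))
  set q : ℂ → ℂ → ℂ := fun z τ => jumpA s₁ s₃ z τ * (jumpA s₁ s₃ z t)⁻¹ with hq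
  -- the quotient of the values at two times is close to one
  have hq1 : ∀ τ ∈ Metric.ball t ρ', ∀ z ∈ vline 0,
      ‖q z τ - 1‖ ≤ 1 / 2 * (1 + ‖z‖) ^ (-decay s₁ s₃) := fun τ hτ z hz => by
    have hzs := hs hz
    have h1 := Convex.norm_image_sub_le_of_norm_deriv_le (𝕜 := ℂ)
      (f := fun τ => jumpA s₁ s₃ z τ) (C := C * (1 + ‖z‖) ^ (-decay s₁ s₃))
      (fun τ hτ => differentiableAt_jumpA_time s₁ s₃ (h.mem_cutPlane hzs) (hre τ hτ))
      (fun τ hτ => (hb τ hτ z hzs).1) (convex_closedBall t ρ) (Metric.mem_closedBall_self hρ.le)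
      (hball hτ)
    have e : q z τ - 1 = (jumpA s₁ s₃ z τ - jumpA s₁ s₃ z t) * (jumpA s₁ s₃ z t)⁻¹ := by
      rw [sub_mul, mul_inv_cancel₀ (h.ne_zero hzs)]
    have h2 : ‖τ - t‖ ≤ 1 / (2 * (C * M + 1)) := by
      have h3 := Metric.mem_ball.1 hτ
      rw [dist_eq_norm] at h3
      exact h3.le.trans (min_le_right _ _)
    rw [e, norm_mul]
    calc _ ≤ (C * (1 + ‖z‖) ^ (-decay s₁ s₃) * (1 / (2 * (C * M + 1)))) * M := by
          gcongr
          · exact h1.trans (by gcongr)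
          · exact hM z hzs
      _ = (C * M) / (C * M + 1) * (1 / 2 * (1 + ‖z‖) ^ (-decay s₁ s₃)) := by field_simp
      _ ≤ 1 * (1 / 2 * (1 + ‖z‖) ^ (-decay s₁ s₃)) := by
          gcongr
          rw [div_le_one (by positivity)]
          linarith
      _ = _ := one_mul _
  have hq2 : ∀ τ ∈ Metric.ball t ρ', ∀ z ∈ vline 0, ‖q z τ - 1‖ ≤ 1 / 2 := fun τ hτ z hz => by
    refine (hq1 τ hτ z hz).trans ?_
    have : (1 + ‖z‖) ^ (-decay s₁ s₃) ≤ 1 :=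
      Real.rpow_le_one_of_one_le_of_nonpos (by linarith [norm_nonneg z]) (by linarith)
    linarith
  have hL0 : ∀ z ∈ vline 0, |z.re| < min c₁ c₃ := fun z hz => by
    have hz' : z.re = 0 := hz
    rw [hz', abs_zero]; exact hm0
  have hq3 : ∀ τ ∈ Metric.ball t ρ', ∀ z ∈ vline 0, q z τ ∈ slitPlane := fun τ hτ z hz =>
    mem_slitPlane_of_norm_sub_one_le (hq2 τ hτ z hz)
  refine ⟨fun z τ => L z + log (q z τ), ρ', C * (2 * M), hρ0, by positivity,
    fun τ hτ => ⟨fun z hz => ?_, ?_, fun z hz => ⟨?_, ?_, ?_⟩⟩⟩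
  · have hqc : ContinuousAt (fun z => q z τ) z :=
      ((PainleveTwo.analyticAt_jumpA s₁ s₃ (h.mem_cutPlane (hs hz))
        (hre τ (hball hτ))).continuousAt).mul
        ((h.analyticAt_jumpA (hs hz)).continuousAt.inv₀ (h.ne_zero (hs hz)))
    exact ((hLa z (hL0 z hz)).continuousAt.add (hqc.clog (hq3 τ hτ z hz))).continuousWithinAt
  · refine DecaysOn.add ?_ ⟨3 / 2 * (1 / 2), fun z hz => ?_⟩
    · refine (hLd (min c₁ c₃ / 2) (half_lt_self hm0)).mono_set
        (vline_subset_vstrip (by linarith) (by linarith))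
    · refine (norm_log_le_of_norm_sub_one_le (hq2 τ hτ z hz)).trans ?_
      rw [mul_assoc]
      have := hq1 τ hτ z hz
      gcongr
  · rw [exp_add, exp_log (slitPlane_ne_zero (hq3 τ hτ z hz)), hLe z (hL0 z hz), hq]
    simp only
    rw [mul_comm, mul_assoc, inv_mul_cancel₀ (h.ne_zero (hs hz)), mul_one]
  · have h1 := ((differentiableAt_jumpA_time s₁ s₃ (h.mem_cutPlane (hs hz))
      (hre τ (hball hτ))).hasDerivAt.mul_const (jumpA s₁ s₃ z t)⁻¹).clog (hq3 τ hτ z hz)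
    have h2 := h1.const_add (L z)
    refine h2.congr_deriv ?_
    exact mul_div_mul_right _ _ (inv_ne_zero (h.ne_zero (hs hz)))
  · have hd := (hb τ (hball hτ) z (hs hz)).1
    have hqn : 1 / 2 ≤ ‖q z τ‖ := by
      have := norm_sub_norm_le (1 : ℂ) (1 - q z τ)
      rw [norm_sub_rev 1 (q z τ), sub_sub_cancel, norm_one] at this
      linarith [hq2 τ hτ z hz]
    have hinv : ‖(jumpA s₁ s₃ z τ)⁻¹‖ ≤ 2 * M := by
      have e : (jumpA s₁ s₃ z τ)⁻¹ = (q z τ)⁻¹ * (jumpA s₁ s₃ z t)⁻¹ := by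
        rw [hq]
        simp only
        rw [mul_inv, inv_inv, mul_assoc, mul_inv_cancel₀ (h.ne_zero (hs hz)), mul_one]
      have hqi : ‖(q z τ)⁻¹‖ ≤ 2 := by
        rw [norm_inv, inv_eq_one_div, div_le_iff₀ (by linarith)]
        linarith
      rw [e, norm_mul]
      have := hM z (hs hz)
      gcongr
    rw [div_eq_mul_inv, norm_mul]
    calc _ ≤ (C * (1 + ‖z‖) ^ (-decay s₁ s₃)) * (2 * M) := by gcongr
      _ = _ := by ring

/-- The time derivative of `φ`. -/
theorem hasDerivAt_phi (h : Admissible s₁ s₃ c₁ c₃ t) {z : ℂ} (hz : z.re ≠ 0) :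
    HasDerivAt (fun τ => phi s₁ s₃ z τ)
      (phi s₁ s₃ z t * cauchyTr 0
        (fun w => deriv (fun τ => jumpA s₁ s₃ w τ) t / jumpA s₁ s₃ w t) z) t := by
  obtain ⟨L, ρ, C, hρ, hC, hL⟩ := h.exists_log_near
  have hδ := h.decay_pos
  have hphi : ∀ τ ∈ Metric.ball t ρ, phi s₁ s₃ z τ = exp (cauchyTr 0 (fun w => L w τ) z) :=
    fun τ hτ => phi_eq_exp_cauchyTr (isLogBranch_of_decaysOn (a := fun z => jumpA s₁ s₃ z τ) hδ
      (hL τ hτ).1 (fun w hw => ((hL τ hτ).2.2 w hw).1) (hL τ hτ).2.1) z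
  have ht := Metric.mem_ball_self (x := t) hρ
  have hev : (fun τ => phi s₁ s₃ z τ) =ᶠ[𝓝 t] fun τ => exp (cauchyTr 0 (fun w => L w τ) z) :=
    Filter.mem_of_superset (Metric.ball_mem_nhds t hρ) hphi
  refine HasDerivAt.congr_of_eventuallyEq ?_ hev
  rw [hphi t ht]
  refine HasDerivAt.cexp ?_
  obtain ⟨K, hK0, hK⟩ := (DecaysOn.inv_sub (S := vline 0) (w := z) (abs_pos.2 hz) fun w hw => by
    have := abs_sub_re_le_of_mem_vline (z := z) hw
    rwa [zero_sub, abs_neg] at this).exists_nonneg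
  have hfin := hasDerivAt_integral_of_dominated_loc_of_deriv_le (μ := volume) (𝕜 := ℂ)
    (F := fun τ (y : ℝ) => L ((0 : ℝ) + y * I) τ / (((0 : ℝ) + y * I : ℂ) - z) * I)
    (F' := fun τ (y : ℝ) => deriv (fun τ => jumpA s₁ s₃ ((0 : ℝ) + y * I) τ) τ /
      jumpA s₁ s₃ ((0 : ℝ) + y * I) τ / (((0 : ℝ) + y * I : ℂ) - z) * I)
    (bound := fun y : ℝ => C * K * (1 + |y|) ^ (-(decay s₁ s₃ + 1)))
    (x₀ := t) (Metric.ball_mem_nhds t hρ) ?_ ?_ ?_ ?_ ?_ ?_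
  · exact hfin.2.const_mul _
  · filter_upwards [Metric.ball_mem_nhds t hρ] with τ hτ
    exact (aestronglyMeasurable_mul_inv (aestronglyMeasurable_line (hL τ hτ).1) z).mul_const I
  · exact (lineIntegrable_div_sub hδ (aestronglyMeasurable_line (hL t ht).1) (hL t ht).2.1
      hz).mul_const I
  · exact (aestronglyMeasurable_mul_inv (g := fun w => deriv (fun τ => jumpA s₁ s₃ w τ) t /
      jumpA s₁ s₃ w t) (h.aestronglyMeasurable_dotA_div (by linarith [h.c₃_pos]) h.c₁_pos.le)
      z).mul_const I
  · refine Eventually.of_forall fun y τ hτ => ?_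
    have hw := linePoint_mem 0 y
    have h1 := ((hL τ hτ).2.2 _ hw).2.2
    have h2 := hK _ hw
    have h3 := one_add_norm_rpow_le 0 y (r := decay s₁ s₃ + 1) (by linarith)
    rw [norm_mul, norm_I, mul_one, div_eq_mul_inv (_ / _), norm_mul]
    calc _ ≤ (C * (1 + ‖((0 : ℝ) + y * I : ℂ)‖) ^ (-decay s₁ s₃)) *
          (K * (1 + ‖((0 : ℝ) + y * I : ℂ)‖) ^ (-(1 : ℝ))) := by gcongr
      _ = C * K * (1 + ‖((0 : ℝ) + y * I : ℂ)‖) ^ (-(decay s₁ s₃ + 1)) := by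
          rw [neg_add, Real.rpow_add (one_add_norm_pos _)]; ring
      _ ≤ _ := by gcongr
  · exact (integrable_one_add_abs (by linarith)).const_mul _
  · refine Eventually.of_forall fun y τ hτ => ?_
    exact (((hL τ hτ).2.2 _ (linePoint_mem 0 y)).2.1.div_const _).mul_const I

end Admissible

/-! ### Gluing matrix functions along vertical lines -/

/-- Entrywise analyticity at a point. -/
def AnalyticMatAt (Y : ℂ → Mat2) (z : ℂ) : Prop := ∀ i j, AnalyticAt ℂ (fun w => Y w i j) z

theorem AnalyticMat.at {Y : ℂ → Mat2} {S : Set ℂ} (h : AnalyticMat Y S) {z : ℂ} (hz : z ∈ S) :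
    AnalyticMatAt Y z := fun i j => h i j z hz

theorem AnalyticMatAt.mul {X Y : ℂ → Mat2} {z : ℂ} (hX : AnalyticMatAt X z)
    (hY : AnalyticMatAt Y z) : AnalyticMatAt (fun w => X w * Y w) z := fun i j => by
  simp only [Matrix.mul_apply, Fin.sum_univ_two]
  exact ((hX i 0).mul (hY 0 j)).add ((hX i 1).mul (hY 1 j))

theorem AnalyticMatAt.congr {X Y : ℂ → Mat2} {z : ℂ} (hX : AnalyticMatAt X z)
    (h : X =ᶠ[𝓝 z] Y) : AnalyticMatAt Y z := fun i j =>
  (hX i j).congr (h.mono fun w hw => by simp only [hw])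

theorem AnalyticMatAt.det {Y : ℂ → Mat2} {z : ℂ} (hY : AnalyticMatAt Y z) :
    AnalyticAt ℂ (fun w => (Y w).det) z := by
  simp only [Matrix.det_fin_two]
  exact ((hY 0 0).mul (hY 1 1)).sub ((hY 0 1).mul (hY 1 0))

theorem analyticMatAt_of {a b c d : ℂ → ℂ} {z : ℂ} (ha : AnalyticAt ℂ a z) (hb : AnalyticAt ℂ b z)
    (hc : AnalyticAt ℂ c z) (hd : AnalyticAt ℂ d z) :
    AnalyticMatAt (fun w => !![a w, b w; c w, d w]) z := by
  intro i j
  fin_cases i <;> fin_cases j <;> simpa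

theorem eventuallyEq_mat_of_eq_on_line {X Y : ℂ → Mat2} {z : ℂ} (hX : AnalyticMatAt X z)
    (hY : AnalyticMatAt Y z) (h : ∀ w : ℂ, w.re = z.re → X w = Y w) : X =ᶠ[𝓝 z] Y := by
  have : ∀ᶠ w in 𝓝 z, ∀ i j, X w i j = Y w i j :=
    eventually_all.2 fun i => eventually_all.2 fun j =>
      eventuallyEq_of_eq_on_line (hX i j) (hY i j) fun w hw => by rw [h w hw]
  exact this.mono fun w hw => Matrix.ext hw

section Glue

variable {α : Type*}

/-- The function that equals `f` on `Re z ≥ c` and `g` on `Re z < c`. -/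
def glue (c : ℝ) (f g : ℂ → α) (z : ℂ) : α := if c ≤ z.re then f z else g z

variable {f g : ℂ → α} {c : ℝ} {z : ℂ}

theorem glue_eventuallyEq_of_lt (hz : c < z.re) : glue c f g =ᶠ[𝓝 z] f :=
  Filter.mem_of_superset ((isOpen_Ioi.preimage continuous_re).mem_nhds hz)
    fun _ hw => if_pos (le_of_lt hw)

theorem glue_eventuallyEq_of_gt (hz : z.re < c) : glue c f g =ᶠ[𝓝 z] g :=
  Filter.mem_of_superset ((isOpen_Iio.preimage continuous_re).mem_nhds hz)
    fun _ hw => if_neg (not_le.2 hw)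

theorem glue_eventuallyEq_left (hz : c ≤ z.re) (h : z.re = c → f =ᶠ[𝓝 z] g) :
    glue c f g =ᶠ[𝓝 z] f := by
  rcases hz.lt_or_eq with hz | hz
  · exact glue_eventuallyEq_of_lt hz
  · refine (h hz.symm).mono fun w hw => ?_
    unfold glue
    split_ifs
    · rfl
    · exact hw.symm

theorem glue_eventuallyEq_right (hz : z.re ≤ c) (h : z.re = c → f =ᶠ[𝓝 z] g) :
    glue c f g =ᶠ[𝓝 z] g := by
  rcases hz.lt_or_eq with hz | hz
  · exact glue_eventuallyEq_of_gt hz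
  · exact (glue_eventuallyEq_left hz.ge h).trans (h hz)

variable {f₁ f₂ f₃ f₄ : ℂ → α} {c₁ c₃ : ℝ}

/-- Four functions glued along the lines `Re z = c₁`, `Re z = 0`, `Re z = -c₃`. -/
def glue₄ (c₁ c₃ : ℝ) (f₁ f₂ f₃ f₄ : ℂ → α) : ℂ → α :=
  glue c₁ f₁ (glue 0 f₂ (glue (-c₃) f₃ f₄))

theorem glue₄_eventuallyEq (hc₁ : 0 < c₁) (hc₃ : 0 < c₃) (h₁ : z.re = c₁ → f₁ =ᶠ[𝓝 z] f₂)
    (h₂ : z.re = 0 → f₂ =ᶠ[𝓝 z] f₃) (h₃ : z.re = -c₃ → f₃ =ᶠ[𝓝 z] f₄) :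
    (c₁ ≤ z.re → glue₄ c₁ c₃ f₁ f₂ f₃ f₄ =ᶠ[𝓝 z] f₁) ∧
    (0 ≤ z.re ∧ z.re ≤ c₁ → glue₄ c₁ c₃ f₁ f₂ f₃ f₄ =ᶠ[𝓝 z] f₂) ∧
    (-c₃ ≤ z.re ∧ z.re ≤ 0 → glue₄ c₁ c₃ f₁ f₂ f₃ f₄ =ᶠ[𝓝 z] f₃) ∧
    (z.re ≤ -c₃ → glue₄ c₁ c₃ f₁ f₂ f₃ f₄ =ᶠ[𝓝 z] f₄) := by
  have a₂ : ∀ g : ℂ → α, z.re = c₁ → glue 0 f₂ g =ᶠ[𝓝 z] f₂ := fun g h =>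
    glue_eventuallyEq_of_lt (by linarith)
  have a₁ : z.re = c₁ → f₁ =ᶠ[𝓝 z] glue 0 f₂ (glue (-c₃) f₃ f₄) := fun h =>
    (h₁ h).trans (a₂ _ h).symm
  have b₁ : z.re = 0 → f₂ =ᶠ[𝓝 z] glue (-c₃) f₃ f₄ := fun h =>
    (h₂ h).trans (glue_eventuallyEq_of_lt (by linarith)).symm
  refine ⟨fun h => glue_eventuallyEq_left h a₁, fun h => ?_, fun h => ?_, fun h => ?_⟩
  · exact (glue_eventuallyEq_right h.2 a₁).trans (glue_eventuallyEq_left h.1 b₁)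
  · exact (glue_eventuallyEq_of_gt (by linarith)).trans
      ((glue_eventuallyEq_right h.2 b₁).trans (glue_eventuallyEq_left h.1 h₃))
  · exact (glue_eventuallyEq_of_gt (by linarith)).trans
      ((glue_eventuallyEq_of_gt (by linarith)).trans (glue_eventuallyEq_right h h₃))

end Glue

/-! ### The triangular and diagonal jumps -/

/-- The inverse of `F1`. -/
def F1inv (s₁ s₃ z t : ℂ) : Mat2 := !![1, 0; -(jumpC s₁ s₃ z t / jumpA s₁ s₃ z t), 1]

/-- The inverse of `F2`. -/
def F2inv (s₁ s₃ z t : ℂ) : Mat2 := !![1 / jumpA s₁ s₃ z t, 0; 0, jumpA s₁ s₃ z t]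

/-- The inverse of `F3`. -/
def F3inv (s₁ s₃ z t : ℂ) : Mat2 := !![1, -(jumpB s₁ s₃ z t / jumpA s₁ s₃ z t); 0, 1]

section Inverses

variable (s₁ s₃ z t : ℂ)

theorem F1_mul_F1inv : F1 s₁ s₃ z t * F1inv s₁ s₃ z t = 1 := by
  simp [F1, F1inv, Matrix.one_fin_two]

theorem F1inv_mul_F1 : F1inv s₁ s₃ z t * F1 s₁ s₃ z t = 1 := by
  simp [F1, F1inv, Matrix.one_fin_two]

theorem F3_mul_F3inv : F3 s₁ s₃ z t * F3inv s₁ s₃ z t = 1 := by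
  simp [F3, F3inv, Matrix.one_fin_two]

theorem F3inv_mul_F3 : F3inv s₁ s₃ z t * F3 s₁ s₃ z t = 1 := by
  simp [F3, F3inv, Matrix.one_fin_two]

variable {z t}

theorem F2_mul_F2inv (h : jumpA s₁ s₃ z t ≠ 0) : F2 s₁ s₃ z t * F2inv s₁ s₃ z t = 1 := by
  simp [F2, F2inv, Matrix.one_fin_two, h]

theorem F2inv_mul_F2 (h : jumpA s₁ s₃ z t ≠ 0) : F2inv s₁ s₃ z t * F2 s₁ s₃ z t = 1 := by
  simp [F2, F2inv, Matrix.one_fin_two, h]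

theorem det_F1 (z t : ℂ) : (F1 s₁ s₃ z t).det = 1 := by simp [F1, Matrix.det_fin_two]

theorem det_F3 (z t : ℂ) : (F3 s₁ s₃ z t).det = 1 := by simp [F3, Matrix.det_fin_two]

theorem det_F2 (h : jumpA s₁ s₃ z t ≠ 0) : (F2 s₁ s₃ z t).det = 1 := by
  simp [F2, Matrix.det_fin_two, h]

variable {s₁ s₃}

theorem analyticMatAt_F (hz : z ∈ cutPlane) (ht : 0 < t.re) (h : jumpA s₁ s₃ z t ≠ 0) :
    AnalyticMatAt (fun w => F1 s₁ s₃ w t) z ∧ AnalyticMatAt (fun w => F2 s₁ s₃ w t) z ∧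
    AnalyticMatAt (fun w => F3 s₁ s₃ w t) z ∧ AnalyticMatAt (fun w => F1inv s₁ s₃ w t) z ∧
    AnalyticMatAt (fun w => F2inv s₁ s₃ w t) z ∧ AnalyticMatAt (fun w => F3inv s₁ s₃ w t) z := by
  have hA := analyticAt_jumpA s₁ s₃ hz ht
  have hB := (analyticAt_jumpB s₁ s₃ hz ht).fun_div hA h
  have hC := (analyticAt_jumpC s₁ s₃ hz ht).fun_div hA h
  have h0 : AnalyticAt ℂ (fun _ : ℂ => (0 : ℂ)) z := analyticAt_const
  have h1 : AnalyticAt ℂ (fun _ : ℂ => (1 : ℂ)) z := analyticAt_const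
  have hI := h1.fun_div hA h
  exact ⟨analyticMatAt_of h1 h0 hC h1, analyticMatAt_of hA h0 h0 hI, analyticMatAt_of h1 hB h0 h1,
    analyticMatAt_of h1 h0 hC.neg h1, analyticMatAt_of hI h0 h0 hA,
    analyticMatAt_of h1 hB.neg h0 h1⟩

end Inverses

/-! ### Bounded analytic matrix functions -/

/-- `X` is analytic at every point of `S`, with bounded entries on `S`. -/
def BddAnalyticOn (X : ℂ → Mat2) (S : Set ℂ) : Prop :=
  (∀ z ∈ S, AnalyticMatAt X z) ∧ ∃ M : ℝ, ∀ z ∈ S, ∀ i j, ‖X z i j‖ ≤ M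

namespace BddAnalyticOn

variable {X Y : ℂ → Mat2} {S S' : Set ℂ}

theorem mono (h : BddAnalyticOn X S) (hS : S' ⊆ S) : BddAnalyticOn X S' :=
  ⟨fun z hz => h.1 z (hS hz), let ⟨M, hM⟩ := h.2; ⟨M, fun z hz => hM z (hS hz)⟩⟩

theorem mul (hX : BddAnalyticOn X S) (hY : BddAnalyticOn Y S) :
    BddAnalyticOn (fun z => X z * Y z) S := by
  obtain ⟨hXa, M, hM⟩ := hX
  obtain ⟨hYa, N, hN⟩ := hY
  refine ⟨fun z hz => (hXa z hz).mul (hYa z hz), M * N + M * N, fun z hz i j => ?_⟩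
  have hM0 : 0 ≤ M := (norm_nonneg _).trans (hM z hz i j)
  show ‖(X z * Y z) i j‖ ≤ _
  rw [Matrix.mul_apply, Fin.sum_univ_two]
  refine (norm_add_le _ _).trans ?_
  rw [norm_mul, norm_mul]
  exact add_le_add (mul_le_mul (hM z hz _ _) (hN z hz _ _) (norm_nonneg _) hM0)
    (mul_le_mul (hM z hz _ _) (hN z hz _ _) (norm_nonneg _) hM0)

theorem congr (hX : BddAnalyticOn X S) (h : ∀ z ∈ S, Y =ᶠ[𝓝 z] X) : BddAnalyticOn Y S := by
  obtain ⟨hXa, M, hM⟩ := hX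
  exact ⟨fun z hz => (hXa z hz).congr (h z hz).symm, M, fun z hz i j => by
    rw [(h z hz).eq_of_nhds]; exact hM z hz i j⟩

theorem union (h : BddAnalyticOn X S) (h' : BddAnalyticOn X S') : BddAnalyticOn X (S ∪ S') := by
  obtain ⟨ha, M, hM⟩ := h
  obtain ⟨ha', M', hM'⟩ := h'
  refine ⟨fun z hz => hz.elim (ha z) (ha' z), max M M', fun z hz i j => ?_⟩
  rcases hz with hz | hz
  · exact (hM z hz i j).trans (le_max_left _ _)
  · exact (hM' z hz i j).trans (le_max_right _ _)

theorem of_entries {a b c d : ℂ → ℂ} {M : ℝ}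
    (ha : ∀ z ∈ S, AnalyticMatAt (fun w => !![a w, b w; c w, d w]) z)
    (h : ∀ z ∈ S, ‖a z‖ ≤ M ∧ ‖b z‖ ≤ M ∧ ‖c z‖ ≤ M ∧ ‖d z‖ ≤ M) :
    BddAnalyticOn (fun w => !![a w, b w; c w, d w]) S := by
  refine ⟨ha, M, fun z hz i j => ?_⟩
  obtain ⟨h1, h2, h3, h4⟩ := h z hz
  fin_cases i <;> fin_cases j <;> simpa

end BddAnalyticOn

theorem TendsToOneAtInfinity.exists_norm_le {Y : ℂ → Mat2} {S : Set ℂ}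
    (h : TendsToOneAtInfinity Y S) :
    ∃ R : ℝ, ∀ z ∈ S, R ≤ ‖z‖ → ∀ i j, ‖Y z i j‖ ≤ 2 := by
  have hev : ∀ᶠ z in Bornology.cobounded ℂ ⊓ 𝓟 S, ∀ i j, ‖Y z i j‖ ≤ 2 := by
    refine eventually_all.2 fun i => eventually_all.2 fun j => ?_
    have h1 : Tendsto (fun z => ‖Y z i j‖) (Bornology.cobounded ℂ ⊓ 𝓟 S)
        (𝓝 ‖(1 : Mat2) i j‖) :=
      ((tendsto_pi_nhds.1 (tendsto_pi_nhds.1 h i)) j).norm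
    refine (h1.eventually_lt_const (u := 2) ?_).mono fun z hz => hz.le
    rw [Matrix.one_apply]
    split_ifs <;> norm_num
  rw [eventually_inf_principal, ← comap_norm_atTop, eventually_comap] at hev
  obtain ⟨R, hR⟩ := eventually_atTop.1 hev
  exact ⟨R, fun z hz hzR => hR ‖z‖ hzR z rfl hz⟩

theorem AnalyticMat.exists_bddAnalyticOn {Y : ℂ → Mat2} {S : Set ℂ} (hY : AnalyticMat Y S)
    (h : TendsToOneAtInfinity Y S) : ∃ R : ℝ, BddAnalyticOn Y (S ∩ {z | R ≤ ‖z‖}) := by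
  obtain ⟨R, hR⟩ := TendsToOneAtInfinity.exists_norm_le h
  exact ⟨R, fun z hz => hY.at hz.1, 2, fun z hz => hR z hz.1 hz.2⟩

theorem AnalyticMat.decaysOn_zero {Y : ℂ → Mat2} {S : Set ℂ} (hS : IsClosed S)
    (hY : AnalyticMat Y S) (h : TendsToOneAtInfinity Y S) (i j : Fin 2) :
    DecaysOn (fun z => Y z i j) 0 S := by
  obtain ⟨R, hR⟩ := TendsToOneAtInfinity.exists_norm_le h
  have hcomp : IsCompact (S ∩ Metric.closedBall 0 R) := (isCompact_closedBall 0 R).inter_left hS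
  obtain ⟨N, hN⟩ := hcomp.exists_bound_of_continuousOn (f := fun z => Y z i j)
    fun z hz => (hY i j z hz.1).continuousAt.continuousWithinAt
  refine ⟨max N 2, fun z hz => ?_⟩
  rw [neg_zero, Real.rpow_zero, mul_one]
  by_cases hzR : ‖z‖ ≤ R
  · exact (hN z ⟨hz, by simpa using hzR⟩).trans (le_max_left _ _)
  · exact (hR z hz (not_le.1 hzR).le i j).trans (le_max_right _ _)

theorem AnalyticMat.decaysOn_deriv {Y g : ℂ → Mat2} {S D : Set ℂ} {s R : ℝ} (hS : IsClosed S)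
    (hs : 0 < s) (hY : AnalyticMat Y S) (hg : BddAnalyticOn g D)
    (hfar : ∀ z ∈ S, R ≤ ‖z‖ → Y =ᶠ[𝓝 z] g ∧ Metric.closedBall z (s * ‖z‖) ⊆ D) (i j : Fin 2) :
    DecaysOn (deriv fun z => Y z i j) 1 S := by
  obtain ⟨hga, M, hM⟩ := hg
  refine PainleveTwo.decaysOn_deriv (g := fun z => g z i j) (M := M) (R := R) hS hs (hY i j)
    fun z hz hzR => ?_
  obtain ⟨h1, h2⟩ := hfar z hz hzR
  exact ⟨h1.mono fun w hw => by simp only [hw], fun w hw =>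
    ⟨(hga w (h2 hw) i j).differentiableAt, hM w (h2 hw) i j⟩⟩

/-! ### Solutions of the problem with jumps on three lines -/

theorem tendsto_of_regions {α : Type*} {f : ℂ → α} {l : Filter α} {c₁ c₃ : ℝ}
    (h₁ : Tendsto f (Bornology.cobounded ℂ ⊓ 𝓟 {z | c₁ ≤ z.re}) l)
    (h₂ : Tendsto f (Bornology.cobounded ℂ ⊓ 𝓟 {z | 0 ≤ z.re ∧ z.re ≤ c₁}) l)
    (h₃ : Tendsto f (Bornology.cobounded ℂ ⊓ 𝓟 {z | -c₃ ≤ z.re ∧ z.re ≤ 0}) l)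
    (h₄ : Tendsto f (Bornology.cobounded ℂ ⊓ 𝓟 {z | z.re ≤ -c₃}) l) :
    Tendsto f (Bornology.cobounded ℂ) l := by
  refine ((((h₁.sup h₂).sup h₃).sup h₄)).mono_left ?_
  rw [← inf_sup_left, ← inf_sup_left, ← inf_sup_left, sup_principal, sup_principal, sup_principal]
  refine le_inf le_rfl (le_principal_iff.2 (univ_mem' fun z => ?_))
  simp only [Set.mem_union, Set.mem_ofPred_eq]
  rcases le_total c₁ z.re with h | h
  · exact Or.inl (Or.inl (Or.inl h))
  rcases le_total 0 z.re with h' | h'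
  · exact Or.inl (Or.inl (Or.inr ⟨h', h⟩))
  rcases le_total (-c₃) z.re with h'' | h''
  · exact Or.inl (Or.inr ⟨h'', h'⟩)
  · exact Or.inr h''

theorem TendsToOneAtInfinity.det {Y : ℂ → Mat2} {S : Set ℂ} (h : TendsToOneAtInfinity Y S) :
    Tendsto (fun z => (Y z).det) (Bornology.cobounded ℂ ⊓ 𝓟 S) (𝓝 1) := by
  have := ((continuous_id (X := Mat2)).matrix_det.tendsto 1).comp h
  simpa [Function.comp_def] using this

namespace SolvesLDU

variable {s₁ s₃ t : ℂ} {c₁ c₃ : ℝ} {Y₁ Y₂ Y₃ Y₄ : ℂ → Mat2} {z : ℂ}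

theorem eventually₁ (hY : SolvesLDU s₁ s₃ c₁ c₃ t Y₁ Y₂ Y₃ Y₄) (h : Admissible s₁ s₃ c₁ c₃ t)
    (hz : z.re = c₁) : Y₂ =ᶠ[𝓝 z] fun w => Y₁ w * F1 s₁ s₃ w t := by
  have hzs : z ∈ vstrip (-c₃) c₁ := ⟨by linarith [h.c₁_pos, h.c₃_pos], hz.le⟩
  refine eventuallyEq_mat_of_eq_on_line (hY.analytic₂.at ⟨by linarith [h.c₁_pos], hz.le⟩)
    ((hY.analytic₁.at hz.ge).mul (analyticMatAt_F (h.mem_cutPlane hzs) h.re_pos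
      (h.ne_zero hzs)).1) fun w hw => hY.jump₁ w (hw.trans hz)

theorem eventually₂ (hY : SolvesLDU s₁ s₃ c₁ c₃ t Y₁ Y₂ Y₃ Y₄) (h : Admissible s₁ s₃ c₁ c₃ t)
    (hz : z.re = 0) : Y₃ =ᶠ[𝓝 z] fun w => Y₂ w * F2 s₁ s₃ w t := by
  have hzs : z ∈ vstrip (-c₃) c₁ := ⟨by linarith [h.c₃_pos], by linarith [h.c₁_pos]⟩
  refine eventuallyEq_mat_of_eq_on_line (hY.analytic₃.at ⟨by linarith [h.c₃_pos], hz.le⟩)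
    ((hY.analytic₂.at ⟨hz.ge, by linarith [h.c₁_pos]⟩).mul
      (analyticMatAt_F (h.mem_cutPlane hzs) h.re_pos
      (h.ne_zero hzs)).2.1) fun w hw => hY.jump₂ w (hw.trans hz)

theorem eventually₃ (hY : SolvesLDU s₁ s₃ c₁ c₃ t Y₁ Y₂ Y₃ Y₄) (h : Admissible s₁ s₃ c₁ c₃ t)
    (hz : z.re = -c₃) : Y₄ =ᶠ[𝓝 z] fun w => Y₃ w * F3 s₁ s₃ w t := by
  have hzs : z ∈ vstrip (-c₃) c₁ := ⟨hz.ge, by linarith [h.c₁_pos, h.c₃_pos]⟩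
  refine eventuallyEq_mat_of_eq_on_line (hY.analytic₄.at hz.le)
    ((hY.analytic₃.at ⟨hz.ge, by linarith [h.c₃_pos]⟩).mul
      (analyticMatAt_F (h.mem_cutPlane hzs) h.re_pos
      (h.ne_zero hzs)).2.2.1) fun w hw => hY.jump₃ w (hw.trans hz)

/-- All pieces of the solution have determinant one, by Liouville's theorem. -/
theorem det_eq_one (hY : SolvesLDU s₁ s₃ c₁ c₃ t Y₁ Y₂ Y₃ Y₄) (h : Admissible s₁ s₃ c₁ c₃ t) :
    (∀ z : ℂ, c₁ ≤ z.re → (Y₁ z).det = 1) ∧ (∀ z : ℂ, 0 ≤ z.re → z.re ≤ c₁ → (Y₂ z).det = 1) ∧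
    (∀ z : ℂ, -c₃ ≤ z.re → z.re ≤ 0 → (Y₃ z).det = 1) ∧
    (∀ z : ℂ, z.re ≤ -c₃ → (Y₄ z).det = 1) := by
  set D : ℂ → ℂ := glue₄ c₁ c₃ (fun z => (Y₁ z).det) (fun z => (Y₂ z).det) (fun z => (Y₃ z).det)
    (fun z => (Y₄ z).det) with hD
  have key := fun z : ℂ => glue₄_eventuallyEq (z := z) (f₁ := fun z => (Y₁ z).det)
    (f₂ := fun z => (Y₂ z).det) (f₃ := fun z => (Y₃ z).det) (f₄ := fun z => (Y₄ z).det)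
    h.c₁_pos h.c₃_pos
    (fun hz => (hY.eventually₁ h hz).mono fun w hw => by
      simp only [hw, Matrix.det_mul, det_F1, mul_one])
    (fun hz => by
      have hzs : z ∈ vstrip (-c₃) c₁ := ⟨by linarith [h.c₃_pos], by linarith [h.c₁_pos]⟩
      filter_upwards [hY.eventually₂ h hz, (h.analyticAt_jumpA hzs).continuousAt.eventually_ne
        (h.ne_zero hzs)] with w hw hne
      simp only [hw, Matrix.det_mul, det_F2 s₁ s₃ hne, mul_one])
    (fun hz => (hY.eventually₃ h hz).mono fun w hw => by
      simp only [hw, Matrix.det_mul, det_F3, mul_one])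
  have hdiff : Differentiable ℂ D := fun z => by
    rcases le_total c₁ z.re with h1 | h1
    · exact ((hY.analytic₁.at h1).det.congr ((key z).1 h1).symm).differentiableAt
    rcases le_total 0 z.re with h2 | h2
    · exact ((hY.analytic₂.at ⟨h2, h1⟩).det.congr ((key z).2.1 ⟨h2, h1⟩).symm).differentiableAt
    rcases le_total (-c₃) z.re with h3 | h3
    · exact ((hY.analytic₃.at ⟨h3, h2⟩).det.congr ((key z).2.2.1 ⟨h3, h2⟩).symm).differentiableAt
    · exact ((hY.analytic₄.at h3).det.congr ((key z).2.2.2 h3).symm).differentiableAt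
  have hin : ∀ S : Set ℂ, ∀ᶠ z in Bornology.cobounded ℂ ⊓ 𝓟 S, z ∈ S := fun S =>
    mem_inf_of_right (mem_principal_self S)
  have hlim : Tendsto D (Bornology.cobounded ℂ) (𝓝 1) := by
    refine tendsto_of_regions (c₁ := c₁) (c₃ := c₃) ?_ ?_ ?_ ?_
    · exact hY.infinity₁.det.congr' ((hin _).mono fun z hz => ((key z).1 hz).eq_of_nhds.symm)
    · exact hY.infinity₂.det.congr' ((hin _).mono fun z hz => ((key z).2.1 hz).eq_of_nhds.symm)
    · exact hY.infinity₃.det.congr' ((hin _).mono fun z hz => ((key z).2.2.1 hz).eq_of_nhds.symm)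
    · exact hY.infinity₄.det.congr' ((hin _).mono fun z hz => ((key z).2.2.2 hz).eq_of_nhds.symm)
  rw [Metric.cobounded_eq_cocompact] at hlim
  have hone : ∀ z, D z = 1 := fun z => hdiff.apply_eq_of_tendsto_cocompact z hlim
  exact ⟨fun z h1 => ((key z).1 h1).eq_of_nhds.symm.trans (hone z),
    fun z h1 h2 => ((key z).2.1 ⟨h1, h2⟩).eq_of_nhds.symm.trans (hone z),
    fun z h1 h2 => ((key z).2.2.1 ⟨h1, h2⟩).eq_of_nhds.symm.trans (hone z),
    fun z h1 => ((key z).2.2.2 h1).eq_of_nhds.symm.trans (hone z)⟩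

/-- Far from the origin every piece of the solution extends, boundedly and analytically, to the
sectors around the imaginary axis: the jump matrices are analytic and bounded there. -/
theorem exists_extension (hY : SolvesLDU s₁ s₃ c₁ c₃ t Y₁ Y₂ Y₃ Y₄)
    (h : Admissible s₁ s₃ c₁ c₃ t) :
    ∃ (κ R : ℝ) (G₁ G₂ G₃ G₄ : ℂ → Mat2), 0 < κ ∧ 2 ≤ R ∧
      BddAnalyticOn Y₁ ({z | c₁ ≤ z.re} ∩ {z | R ≤ ‖z‖}) ∧
      BddAnalyticOn Y₄ ({z | z.re ≤ -c₃} ∩ {z | R ≤ ‖z‖}) ∧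
      BddAnalyticOn G₁ (farSector κ R) ∧ BddAnalyticOn G₂ (farSector κ R) ∧
      BddAnalyticOn G₃ (farSector κ R) ∧ BddAnalyticOn G₄ (farSector κ R) ∧
      ∀ z ∈ farSector κ R, (c₁ ≤ z.re → G₁ =ᶠ[𝓝 z] Y₁) ∧
        (0 ≤ z.re ∧ z.re ≤ c₁ → G₂ =ᶠ[𝓝 z] Y₂) ∧ (-c₃ ≤ z.re ∧ z.re ≤ 0 → G₃ =ᶠ[𝓝 z] Y₃) ∧
        (z.re ≤ -c₃ → G₄ =ᶠ[𝓝 z] Y₄) := by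
  obtain ⟨κ, R₀, M, hκ, hR₀, hM1, hb⟩ := h.exists_bounds_farSector
  obtain ⟨R₁, b₁⟩ := hY.analytic₁.exists_bddAnalyticOn hY.infinity₁
  obtain ⟨R₂, b₂⟩ := hY.analytic₂.exists_bddAnalyticOn hY.infinity₂
  obtain ⟨R₃, b₃⟩ := hY.analytic₃.exists_bddAnalyticOn hY.infinity₃
  obtain ⟨R₄, b₄⟩ := hY.analytic₄.exists_bddAnalyticOn hY.infinity₄
  set R : ℝ := max R₀ (max (max R₁ R₂) (max R₃ R₄)) with hR
  have r₁ : R₁ ≤ R := ((le_max_left R₁ R₂).trans (le_max_left _ _)).trans (le_max_right _ _)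
  have r₂ : R₂ ≤ R := ((le_max_right R₁ R₂).trans (le_max_left _ _)).trans (le_max_right _ _)
  have r₃ : R₃ ≤ R := ((le_max_left R₃ R₄).trans (le_max_right _ _)).trans (le_max_right _ _)
  have r₄ : R₄ ≤ R := ((le_max_right R₃ R₄).trans (le_max_right _ _)).trans (le_max_right _ _)
  have hsec : ∀ z ∈ farSector κ R, z ∈ farSector κ R₀ := fun z hz =>
    ⟨(le_max_left _ _).trans hz.1, hz.2⟩
  have hnorm : ∀ z ∈ farSector κ R, R ≤ ‖z‖ := fun z hz => hz.1.trans (abs_im_le_norm z)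
  have hcut : ∀ z ∈ farSector κ R, z ∈ cutPlane := fun z hz =>
    Admissible.farSector_subset_cutPlane hR₀ (hsec z hz)
  have hne : ∀ z ∈ farSector κ R, jumpA s₁ s₃ z t ≠ 0 := fun z hz => (hb z (hsec z hz)).1
  have hev : ∀ z ∈ farSector κ R, ∀ᶠ w in 𝓝 z, jumpA s₁ s₃ w t ≠ 0 := fun z hz =>
    (analyticAt_jumpA s₁ s₃ (hcut z hz) h.re_pos).continuousAt.eventually_ne (hne z hz)
  have hF := fun z (hz : z ∈ farSector κ R) =>
    analyticMatAt_F (s₁ := s₁) (s₃ := s₃) (hcut z hz) h.re_pos (hne z hz)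
  have hMM : M ≤ M * M := le_mul_of_one_le_left (by linarith) hM1
  have hq : ∀ {a b : ℂ}, ‖a‖ ≤ M → ‖b⁻¹‖ ≤ M → ‖a / b‖ ≤ M * M := fun ha hb => by
    rw [div_eq_mul_inv, norm_mul]
    exact mul_le_mul ha hb (norm_nonneg _) (by linarith)
  have h0 : ‖(0 : ℂ)‖ ≤ M * M := by rw [norm_zero]; positivity
  have h1 : ‖(1 : ℂ)‖ ≤ M * M := by rw [norm_one]; linarith
  have f₁ : BddAnalyticOn (fun z => F1 s₁ s₃ z t) (farSector κ R) :=
    BddAnalyticOn.of_entries (M := M * M) (fun z hz => (hF z hz).1) fun z hz => by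
      obtain ⟨-, -, e2, -, e4⟩ := hb z (hsec z hz)
      exact ⟨h1, h0, hq e4 e2, h1⟩
  have f₂ : BddAnalyticOn (fun z => F2 s₁ s₃ z t) (farSector κ R) :=
    BddAnalyticOn.of_entries (M := M * M) (fun z hz => (hF z hz).2.1) fun z hz => by
      obtain ⟨-, e1, e2, -, -⟩ := hb z (hsec z hz)
      exact ⟨e1.trans hMM, h0, h0, hq (by rw [norm_one]; exact hM1) e2⟩
  have f₃ : BddAnalyticOn (fun z => F3 s₁ s₃ z t) (farSector κ R) :=
    BddAnalyticOn.of_entries (M := M * M) (fun z hz => (hF z hz).2.2.1) fun z hz => by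
      obtain ⟨-, -, e2, e3, -⟩ := hb z (hsec z hz)
      exact ⟨h1, hq e3 e2, h0, h1⟩
  have g₁ : BddAnalyticOn (fun z => F1inv s₁ s₃ z t) (farSector κ R) :=
    BddAnalyticOn.of_entries (M := M * M) (fun z hz => (hF z hz).2.2.2.1) fun z hz => by
      obtain ⟨-, -, e2, -, e4⟩ := hb z (hsec z hz)
      exact ⟨h1, h0, by rw [norm_neg]; exact hq e4 e2, h1⟩
  have g₂ : BddAnalyticOn (fun z => F2inv s₁ s₃ z t) (farSector κ R) :=
    BddAnalyticOn.of_entries (M := M * M) (fun z hz => (hF z hz).2.2.2.2.1) fun z hz => by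
      obtain ⟨-, e1, e2, -, -⟩ := hb z (hsec z hz)
      exact ⟨hq (by rw [norm_one]; exact hM1) e2, h0, h0, e1.trans hMM⟩
  have g₃ : BddAnalyticOn (fun z => F3inv s₁ s₃ z t) (farSector κ R) :=
    BddAnalyticOn.of_entries (M := M * M) (fun z hz => (hF z hz).2.2.2.2.2) fun z hz => by
      obtain ⟨-, -, e2, e3, -⟩ := hb z (hsec z hz)
      exact ⟨h1, by rw [norm_neg]; exact hq e3 e2, h0, h1⟩
  -- `Y₁` continued through the three lines
  set X₂ : ℂ → Mat2 := fun z => Y₂ z * F1inv s₁ s₃ z t with hX₂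
  set X₃ : ℂ → Mat2 := fun z => Y₃ z * F2inv s₁ s₃ z t * F1inv s₁ s₃ z t with hX₃
  set X₄ : ℂ → Mat2 := fun z => Y₄ z * F3inv s₁ s₃ z t * F2inv s₁ s₃ z t * F1inv s₁ s₃ z t with hX₄
  set G : ℂ → Mat2 := glue₄ c₁ c₃ Y₁ X₂ X₃ X₄ with hG
  have key := fun z (hz : z ∈ farSector κ R) => glue₄_eventuallyEq (z := z) (f₁ := Y₁) (f₂ := X₂)
    (f₃ := X₃) (f₄ := X₄) h.c₁_pos h.c₃_pos
    (fun hz' => (hY.eventually₁ h hz').mono fun w hw => by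
      simp only [hX₂, hw, Matrix.mul_assoc, F1_mul_F1inv, Matrix.mul_one])
    (fun hz' => by
      filter_upwards [hY.eventually₂ h hz', hev z hz] with w hw hne
      simp only [hX₂, hX₃, hw]
      rw [Matrix.mul_assoc (Y₂ w), F2_mul_F2inv s₁ s₃ hne, Matrix.mul_one])
    (fun hz' => (hY.eventually₃ h hz').mono fun w hw => by
      simp only [hX₃, hX₄, hw]
      rw [Matrix.mul_assoc (Y₃ w) (F3 s₁ s₃ w t), F3_mul_F3inv, Matrix.mul_one])
  have hGb : BddAnalyticOn G (farSector κ R) := by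
    have a₁ : BddAnalyticOn G (farSector κ R ∩ {z | c₁ ≤ z.re}) :=
      (b₁.mono fun z hz => ⟨hz.2, r₁.trans (hnorm z hz.1)⟩).congr fun z hz =>
        (key z hz.1).1 hz.2
    have a₂ : BddAnalyticOn G (farSector κ R ∩ {z | 0 ≤ z.re ∧ z.re ≤ c₁}) :=
      ((b₂.mono fun z hz => ⟨hz.2, r₂.trans (hnorm z hz.1)⟩).mul
        (g₁.mono Set.inter_subset_left)).congr fun z hz => (key z hz.1).2.1 hz.2
    have a₃ : BddAnalyticOn G (farSector κ R ∩ {z | -c₃ ≤ z.re ∧ z.re ≤ 0}) :=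
      (((b₃.mono fun z hz => ⟨hz.2, r₃.trans (hnorm z hz.1)⟩).mul
        (g₂.mono Set.inter_subset_left)).mul (g₁.mono Set.inter_subset_left)).congr
        fun z hz => (key z hz.1).2.2.1 hz.2
    have a₄ : BddAnalyticOn G (farSector κ R ∩ {z | z.re ≤ -c₃}) :=
      ((((b₄.mono fun z hz => ⟨hz.2, r₄.trans (hnorm z hz.1)⟩).mul
        (g₃.mono Set.inter_subset_left)).mul (g₂.mono Set.inter_subset_left)).mul
        (g₁.mono Set.inter_subset_left)).congr fun z hz => (key z hz.1).2.2.2 hz.2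
    refine (((a₁.union a₂).union a₃).union a₄).mono fun z hz => ?_
    rcases le_total c₁ z.re with h | h
    · exact Or.inl (Or.inl (Or.inl ⟨hz, h⟩))
    rcases le_total 0 z.re with h' | h'
    · exact Or.inl (Or.inl (Or.inr ⟨hz, h', h⟩))
    rcases le_total (-c₃) z.re with h'' | h''
    · exact Or.inl (Or.inr ⟨hz, h'', h'⟩)
    · exact Or.inr ⟨hz, h''⟩
  refine ⟨κ, R, G, fun z => G z * F1 s₁ s₃ z t, fun z => G z * F1 s₁ s₃ z t * F2 s₁ s₃ z t,
    fun z => G z * F1 s₁ s₃ z t * F2 s₁ s₃ z t * F3 s₁ s₃ z t, hκ, hR₀.trans (le_max_left _ _),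
    b₁.mono fun z hz => ⟨hz.1, r₁.trans hz.2⟩, b₄.mono fun z hz => ⟨hz.1, r₄.trans hz.2⟩, hGb,
    hGb.mul f₁, (hGb.mul f₁).mul f₂, ((hGb.mul f₁).mul f₂).mul f₃, fun z hz => ⟨(key z hz).1,
      fun h2 => ((key z hz).2.1 h2).mono fun w hw => ?_, fun h3 => ?_, fun h4 => ?_⟩⟩
  · have hw' : G w = X₂ w := hw
    simp only [hw', hX₂, Matrix.mul_assoc, F1inv_mul_F1, Matrix.mul_one]
  · filter_upwards [(key z hz).2.2.1 h3, hev z hz] with w hw hne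
    have hw' : G w = X₃ w := hw
    simp only [hw', hX₃]
    rw [Matrix.mul_assoc _ (F1inv s₁ s₃ w t), F1inv_mul_F1, Matrix.mul_one, Matrix.mul_assoc,
      F2inv_mul_F2 s₁ s₃ hne, Matrix.mul_one]
  · filter_upwards [(key z hz).2.2.2 h4, hev z hz] with w hw hne
    have hw' : G w = X₄ w := hw
    simp only [hw', hX₄]
    rw [Matrix.mul_assoc _ (F1inv s₁ s₃ w t), F1inv_mul_F1, Matrix.mul_one,
      Matrix.mul_assoc _ (F2inv s₁ s₃ w t), F2inv_mul_F2 s₁ s₃ hne, Matrix.mul_one,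
      Matrix.mul_assoc, F3inv_mul_F3, Matrix.mul_one]

/-- The derivatives of the pieces of the solution are `O(1 / |z|)`. -/
theorem decaysOn_deriv (hY : SolvesLDU s₁ s₃ c₁ c₃ t Y₁ Y₂ Y₃ Y₄)
    (h : Admissible s₁ s₃ c₁ c₃ t) (i j : Fin 2) :
    DecaysOn (deriv fun z => Y₁ z i j) 1 {z | c₁ ≤ z.re} ∧
    DecaysOn (deriv fun z => Y₂ z i j) 1 {z | 0 ≤ z.re ∧ z.re ≤ c₁} ∧
    DecaysOn (deriv fun z => Y₃ z i j) 1 {z | -c₃ ≤ z.re ∧ z.re ≤ 0} ∧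
    DecaysOn (deriv fun z => Y₄ z i j) 1 {z | z.re ≤ -c₃} := by
  obtain ⟨κ, R, G₁, G₂, G₃, G₄, hκ, hR, b₁, b₄, g₁, g₂, g₃, g₄, key⟩ := hY.exists_extension h
  set s : ℝ := min (1 / 6) (κ / 6) with hs
  have hs0 : 0 < s := lt_min (by norm_num) (by positivity)
  have hs1 : s ≤ 1 / 6 := min_le_left _ _
  set R' : ℝ := max (2 * R) (1 / s) with hR'
  have c₁l := h.c₁_lt
  have c₃l := h.c₃_lt
  have c₁p := h.c₁_pos
  have c₃p := h.c₃_pos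
  have hone : ∀ z : ℂ, R' ≤ ‖z‖ → 1 ≤ s * ‖z‖ := fun z hz => by
    have := (le_max_right _ _).trans hz
    rw [div_le_iff₀ hs0] at this; linarith
  have hsec : ∀ z w : ℂ, R' ≤ ‖z‖ → |z.re| ≤ 1 + s * ‖z‖ → w ∈ Metric.closedBall z (s * ‖z‖) →
      w ∈ farSector κ R := fun z w hz hre hw =>
    mem_farSector_of_mem_closedBall hκ.le (min_le_right _ _) hs1
      ((le_max_left _ _).trans hz) (hone z hz) hre hw
  have hself : ∀ z : ℂ, z ∈ Metric.closedBall z (s * ‖z‖) := fun z =>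
    Metric.mem_closedBall_self (by positivity)
  have hbig : ∀ z w : ℂ, R' ≤ ‖z‖ → w ∈ Metric.closedBall z (s * ‖z‖) → R ≤ ‖w‖ :=
    fun z w hz hw => by
      have h1 := (le_max_left _ _).trans hz
      rw [Metric.mem_closedBall, dist_eq_norm] at hw
      have h2 := norm_sub_norm_le z w
      rw [norm_sub_rev] at h2
      have : s * ‖z‖ ≤ 1 / 6 * ‖z‖ := by gcongr
      linarith
  have hre : ∀ z w : ℂ, w ∈ Metric.closedBall z (s * ‖z‖) → |w.re - z.re| ≤ s * ‖z‖ :=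
    fun z w hw => by
      rw [Metric.mem_closedBall, dist_eq_norm] at hw
      exact (abs_re_sub_le_norm w z).trans hw
  have hstrip : ∀ z : ℂ, |z.re| ≤ 1 → |z.re| ≤ 1 + s * ‖z‖ := fun z hz =>
    hz.trans (le_add_of_nonneg_right (by positivity))
  refine ⟨?_, ?_, ?_, ?_⟩
  · have hD : BddAnalyticOn (glue c₁ Y₁ G₁)
        ({z | c₁ < z.re ∧ R ≤ ‖z‖} ∪ farSector κ R) := by
      refine ((b₁.mono (S' := {z | c₁ < z.re ∧ R ≤ ‖z‖}) fun z hz => ⟨hz.1.le, hz.2⟩).congr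
        fun z hz => glue_eventuallyEq_of_lt hz.1).union (g₁.congr fun z hz => ?_)
      rcases le_or_gt c₁ z.re with h1 | h1
      · exact (glue_eventuallyEq_left h1 fun _ => ((key z hz).1 h1).symm).trans
          ((key z hz).1 h1).symm
      · exact glue_eventuallyEq_of_gt h1
    have hS : IsClosed {z : ℂ | c₁ ≤ z.re} := isClosed_le continuous_const continuous_re
    refine hY.analytic₁.decaysOn_deriv (R := R') hS hs0 hD (fun z hz hzR => ⟨?_, fun w hw => ?_⟩) i j
    · refine (glue_eventuallyEq_left hz fun hz' => ?_).symm
      have hz1 : |z.re| ≤ 1 := by rw [hz', abs_of_pos c₁p]; linarith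
      exact ((key z (hsec z z hzR (hstrip z hz1) (hself z))).1 hz).symm
    · by_cases hw1 : c₁ < w.re
      · exact Or.inl ⟨hw1, hbig z w hzR hw⟩
      · refine Or.inr (hsec z w hzR ?_ hw)
        have hz0 : c₁ ≤ z.re := hz
        have := neg_abs_le (w.re - z.re)
        rw [abs_of_pos (by linarith)]
        linarith [hre z w hw]
  · have hS : IsClosed {z : ℂ | 0 ≤ z.re ∧ z.re ≤ c₁} := isClosed_vstrip 0 c₁
    refine hY.analytic₂.decaysOn_deriv (R := R') hS hs0 g₂ (fun z hz hzR => ?_) i j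
    have hz1 : |z.re| ≤ 1 := abs_le.2 ⟨by linarith [hz.1], by linarith [hz.2]⟩
    exact ⟨((key z (hsec z z hzR (hstrip z hz1) (hself z))).2.1 hz).symm,
      fun w hw => hsec z w hzR (hstrip z hz1) hw⟩
  · have hS : IsClosed {z : ℂ | -c₃ ≤ z.re ∧ z.re ≤ 0} := isClosed_vstrip (-c₃) 0
    refine hY.analytic₃.decaysOn_deriv (R := R') hS hs0 g₃ (fun z hz hzR => ?_) i j
    have hz1 : |z.re| ≤ 1 := abs_le.2 ⟨by linarith [hz.1], by linarith [hz.2]⟩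
    exact ⟨((key z (hsec z z hzR (hstrip z hz1) (hself z))).2.2.1 hz).symm,
      fun w hw => hsec z w hzR (hstrip z hz1) hw⟩
  · have hD : BddAnalyticOn (glue (-c₃) G₄ Y₄)
        ({z | z.re < -c₃ ∧ R ≤ ‖z‖} ∪ farSector κ R) := by
      refine ((b₄.mono (S' := {z | z.re < -c₃ ∧ R ≤ ‖z‖}) fun z hz => ⟨hz.1.le, hz.2⟩).congr
        fun z hz => glue_eventuallyEq_of_gt hz.1).union (g₄.congr fun z hz => ?_)
      rcases le_or_gt z.re (-c₃) with h1 | h1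
      · exact (glue_eventuallyEq_right h1 fun _ => (key z hz).2.2.2 h1).trans
          ((key z hz).2.2.2 h1).symm
      · exact glue_eventuallyEq_of_lt h1
    have hS : IsClosed {z : ℂ | z.re ≤ -c₃} := isClosed_le continuous_re continuous_const
    refine hY.analytic₄.decaysOn_deriv (R := R') hS hs0 hD (fun z hz hzR => ⟨?_, fun w hw => ?_⟩) i j
    · refine (glue_eventuallyEq_right hz fun hz' => ?_).symm
      have hz1 : |z.re| ≤ 1 := by rw [hz', abs_neg, abs_of_pos c₃p]; linarith
      exact (key z (hsec z z hzR (hstrip z hz1) (hself z))).2.2.2 hz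
    · by_cases hw1 : w.re < -c₃
      · exact Or.inl ⟨hw1, hbig z w hzR hw⟩
      · refine Or.inr (hsec z w hzR ?_ hw)
        have hz0 : z.re ≤ -c₃ := hz
        have := le_abs_self (w.re - z.re)
        rw [abs_of_neg (by linarith)]
        linarith [hre z w hw]

end SolvesLDU

/-! ### Logarithmic derivatives of matrix functions and Malgrange densities -/

/-- The logarithmic derivative `Y⁻¹ Y'` of a matrix function of determinant one. The adjugate in
place of the inverse makes the entries polynomials in the entries of `Y` and `Y'`. -/
def logDerivMat (Y : ℂ → Mat2) (z : ℂ) : Mat2 := (Y z).adjugate * derivMat Y z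

/-- `Tr (Y⁻¹ Y' σ₃)`. -/
def diagPart (Y : ℂ → Mat2) (z : ℂ) : ℂ := logDerivMat Y z 0 0 - logDerivMat Y z 1 1

theorem derivMat_congr {X Y : ℂ → Mat2} {z : ℂ} (h : X =ᶠ[𝓝 z] Y) :
    derivMat X z = derivMat Y z := by
  ext i j
  have h' : (fun w => X w i j) =ᶠ[𝓝 z] fun w => Y w i j := h.mono fun w hw => by simp only [hw]
  exact h'.deriv_eq

theorem logDerivMat_congr {X Y : ℂ → Mat2} {z : ℂ} (h : X =ᶠ[𝓝 z] Y) :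
    logDerivMat X z = logDerivMat Y z := by
  rw [logDerivMat, logDerivMat, h.eq_of_nhds, derivMat_congr h]

theorem diagPart_congr {X Y : ℂ → Mat2} {z : ℂ} (h : X =ᶠ[𝓝 z] Y) :
    diagPart X z = diagPart Y z := by
  rw [diagPart, diagPart, logDerivMat_congr h]

theorem logDerivMat_eq (Y : ℂ → Mat2) (z : ℂ) : logDerivMat Y z =
    !![Y z 1 1 * deriv (fun w => Y w 0 0) z - Y z 0 1 * deriv (fun w => Y w 1 0) z,
       Y z 1 1 * deriv (fun w => Y w 0 1) z - Y z 0 1 * deriv (fun w => Y w 1 1) z;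
       Y z 0 0 * deriv (fun w => Y w 1 0) z - Y z 1 0 * deriv (fun w => Y w 0 0) z,
       Y z 0 0 * deriv (fun w => Y w 1 1) z - Y z 1 0 * deriv (fun w => Y w 0 1) z] := by
  unfold logDerivMat
  rw [Matrix.adjugate_fin_two]
  ext i j
  fin_cases i <;> fin_cases j <;>
    simp [derivMat, Matrix.mul_apply, Fin.sum_univ_two] <;> ring

theorem derivMat_mul {X Y : ℂ → Mat2} {z : ℂ} (hX : AnalyticMatAt X z) (hY : AnalyticMatAt Y z) :
    derivMat (fun w => X w * Y w) z = derivMat X z * Y z + X z * derivMat Y z := by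
  ext i j
  have hx := fun i j => (hX i j).differentiableAt
  have hy := fun i j => (hY i j).differentiableAt
  simp only [derivMat, Matrix.of_apply, Matrix.add_apply, Matrix.mul_apply, Fin.sum_univ_two]
  rw [deriv_fun_add ((hx i 0).fun_mul (hy 0 j)) ((hx i 1).fun_mul (hy 1 j)),
    deriv_fun_mul (hx i 0) (hy 0 j), deriv_fun_mul (hx i 1) (hy 1 j)]
  ring

theorem logDerivMat_mul {X Y : ℂ → Mat2} {z : ℂ} (hX : AnalyticMatAt X z)
    (hY : AnalyticMatAt Y z) (hdet : (X z).det = 1) :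
    logDerivMat (fun w => X w * Y w) z =
      (Y z).adjugate * logDerivMat X z * Y z + (Y z).adjugate * derivMat Y z := by
  simp only [logDerivMat]
  rw [derivMat_mul hX hY, Matrix.adjugate_mul_distrib, Matrix.mul_add]
  congr 1
  · simp only [Matrix.mul_assoc]
  · rw [Matrix.mul_assoc, ← Matrix.mul_assoc (X z).adjugate, Matrix.adjugate_mul, hdet, one_smul,
      Matrix.one_mul]

section Transform

variable {X : ℂ → Mat2} {f a b : ℂ → ℂ} {z : ℂ}

theorem diagPart_mul_lower (hX : AnalyticMatAt X z) (hf : AnalyticAt ℂ f z)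
    (hdet : (X z).det = 1) :
    diagPart (fun w => X w * !![1, 0; f w, 1]) z =
      diagPart X z + 2 * f z * logDerivMat X z 0 1 := by
  have h0 : AnalyticAt ℂ (fun _ : ℂ => (0 : ℂ)) z := analyticAt_const
  have h1 : AnalyticAt ℂ (fun _ : ℂ => (1 : ℂ)) z := analyticAt_const
  rw [diagPart, logDerivMat_mul hX (analyticMatAt_of h1 h0 hf h1) hdet, diagPart,
    Matrix.adjugate_fin_two]
  simp only [derivMat, Matrix.mul_apply, Fin.sum_univ_two, Matrix.add_apply, Matrix.of_apply,
    Matrix.cons_val', Matrix.cons_val_zero, Matrix.cons_val_one, Matrix.cons_val_fin_one,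
    deriv_const, neg_zero, mul_zero, zero_mul, add_zero, zero_add, mul_one, one_mul]
  ring

theorem diagPart_mul_upper (hX : AnalyticMatAt X z) (hf : AnalyticAt ℂ f z)
    (hdet : (X z).det = 1) :
    diagPart (fun w => X w * !![1, f w; 0, 1]) z =
      diagPart X z - 2 * f z * logDerivMat X z 1 0 := by
  have h0 : AnalyticAt ℂ (fun _ : ℂ => (0 : ℂ)) z := analyticAt_const
  have h1 : AnalyticAt ℂ (fun _ : ℂ => (1 : ℂ)) z := analyticAt_const
  rw [diagPart, logDerivMat_mul hX (analyticMatAt_of h1 hf h0 h1) hdet, diagPart,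
    Matrix.adjugate_fin_two]
  simp only [derivMat, Matrix.mul_apply, Fin.sum_univ_two, Matrix.add_apply, Matrix.of_apply,
    Matrix.cons_val', Matrix.cons_val_zero, Matrix.cons_val_one, Matrix.cons_val_fin_one,
    deriv_const, neg_zero, mul_zero, zero_mul, add_zero, zero_add, mul_one, one_mul]
  ring

theorem logDerivMat_mul_diag (hX : AnalyticMatAt X z) (ha : AnalyticAt ℂ a z)
    (hb : AnalyticAt ℂ b z) (hab : a z * b z = 1) (hdet : (X z).det = 1) :
    diagPart (fun w => X w * !![a w, 0; 0, b w]) z =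
        diagPart X z + (b z * deriv a z - a z * deriv b z) ∧
      logDerivMat (fun w => X w * !![a w, 0; 0, b w]) z 0 1 = b z ^ 2 * logDerivMat X z 0 1 ∧
      logDerivMat (fun w => X w * !![a w, 0; 0, b w]) z 1 0 = a z ^ 2 * logDerivMat X z 1 0 := by
  have h0 : AnalyticAt ℂ (fun _ : ℂ => (0 : ℂ)) z := analyticAt_const
  rw [diagPart, logDerivMat_mul hX (analyticMatAt_of ha h0 h0 hb) hdet, diagPart,
    Matrix.adjugate_fin_two]
  simp only [derivMat, Matrix.mul_apply, Fin.sum_univ_two, Matrix.add_apply, Matrix.of_apply,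
    Matrix.cons_val', Matrix.cons_val_zero, Matrix.cons_val_one, Matrix.cons_val_fin_one,
    deriv_const, neg_zero, mul_zero, zero_mul, add_zero, zero_add]
  refine ⟨?_, by ring, by ring⟩
  linear_combination (logDerivMat X z 0 0 - logDerivMat X z 1 1) * hab

end Transform

section Density

variable {Y : ℂ → Mat2} {z t : ℂ}

theorem malgrangeDensity_eq (F : ℂ → ℂ → Mat2) (hY : (Y z).det = 1) (hF : (F z t).det = 1) :
    malgrangeDensity Y F t z =
      (logDerivMat Y z * derivMat (fun τ => F z τ) t * (F z t).adjugate).trace := by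
  rw [malgrangeDensity, logDerivMat, Matrix.inv_def, Matrix.inv_def, hY, hF, Ring.inverse_one,
    one_smul, one_smul]

theorem malgrangeDensity_lower (f : ℂ → ℂ → ℂ) (hY : (Y z).det = 1) :
    malgrangeDensity Y (fun z τ => !![1, 0; f z τ, 1]) t z =
      logDerivMat Y z 0 1 * deriv (f z) t := by
  rw [malgrangeDensity_eq _ hY (by simp [Matrix.det_fin_two]), Matrix.adjugate_fin_two]
  simp [derivMat, Matrix.trace_fin_two, Matrix.mul_apply, Fin.sum_univ_two]

theorem malgrangeDensity_upper (f : ℂ → ℂ → ℂ) (hY : (Y z).det = 1) :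
    malgrangeDensity Y (fun z τ => !![1, f z τ; 0, 1]) t z =
      logDerivMat Y z 1 0 * deriv (f z) t := by
  rw [malgrangeDensity_eq _ hY (by simp [Matrix.det_fin_two]), Matrix.adjugate_fin_two]
  simp [derivMat, Matrix.trace_fin_two, Matrix.mul_apply, Fin.sum_univ_two]

theorem malgrangeDensity_diag {a : ℂ → ℂ → ℂ} (hY : (Y z).det = 1) (ha : a z t ≠ 0)
    (had : DifferentiableAt ℂ (a z) t) :
    malgrangeDensity Y (fun z τ => !![a z τ, 0; 0, 1 / a z τ]) t z =
      deriv (a z) t / a z t * diagPart Y z := by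
  rw [malgrangeDensity_eq _ hY (by simp [Matrix.det_fin_two, ha]), Matrix.adjugate_fin_two,
    diagPart]
  have hd : deriv (fun τ => 1 / a z τ) t = -deriv (a z) t / a z t ^ 2 := by
    simp only [one_div]
    exact deriv_fun_inv'' had ha
  simp only [derivMat, Matrix.trace_fin_two, Matrix.mul_apply, Fin.sum_univ_two, Matrix.of_apply,
    Matrix.cons_val', Matrix.cons_val_zero, Matrix.cons_val_one, Matrix.cons_val_fin_one,
    deriv_const, neg_zero, mul_zero, add_zero, zero_add, hd]
  field_simp
  ring

end Density

section Regularity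

variable {Y : ℂ → Mat2} {S : Set ℂ}

theorem AnalyticMat.logDerivMat (hY : AnalyticMat Y S) : AnalyticMat (logDerivMat Y) S := by
  intro i j z hz
  have h := fun i j => hY i j z hz
  have hd := fun i j => (hY i j z hz).deriv
  simp only [logDerivMat_eq]
  exact analyticMatAt_of (((h 1 1).mul (hd 0 0)).sub ((h 0 1).mul (hd 1 0)))
    (((h 1 1).mul (hd 0 1)).sub ((h 0 1).mul (hd 1 1)))
    (((h 0 0).mul (hd 1 0)).sub ((h 1 0).mul (hd 0 0)))
    (((h 0 0).mul (hd 1 1)).sub ((h 1 0).mul (hd 0 1))) i j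

theorem AnalyticMat.diagPart (hY : AnalyticMat Y S) : AnalyticOnNhd ℂ (diagPart Y) S :=
  fun z hz => (hY.logDerivMat 0 0 z hz).sub (hY.logDerivMat 1 1 z hz)

theorem decaysOn_logDerivMat (h0 : ∀ i j, DecaysOn (fun z => Y z i j) 0 S)
    (h1 : ∀ i j, DecaysOn (deriv fun z => Y z i j) 1 S) (i j : Fin 2) :
    DecaysOn (fun z => logDerivMat Y z i j) 1 S := by
  have h := fun i j k l => (h0 i j).mul (h1 k l)
  simp only [zero_add] at h
  simp only [logDerivMat_eq]
  fin_cases i <;> fin_cases j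
  · exact (h 1 1 0 0).sub (h 0 1 1 0)
  · exact (h 1 1 0 1).sub (h 0 1 1 1)
  · exact (h 0 0 1 0).sub (h 1 0 0 0)
  · exact (h 0 0 1 1).sub (h 1 0 0 1)

end Regularity

/-! ### Conjugation by `φ` -/

theorem phi_ne_zero (s₁ s₃ z t : ℂ) : phi s₁ s₃ z t ≠ 0 := exp_ne_zero _

theorem det_phiConj (s₁ s₃ z t : ℂ) : (phiConj s₁ s₃ z t).det = 1 := by
  simp [phiConj, Matrix.det_fin_two, phi_ne_zero]

theorem analyticMatAt_conj {φ : ℂ → ℂ} {z : ℂ} (h : AnalyticAt ℂ φ z) (h0 : φ z ≠ 0) :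
    AnalyticMatAt (fun w => !![(φ w)⁻¹, 0; 0, φ w]) z :=
  analyticMatAt_of (h.fun_inv h0) analyticAt_const analyticAt_const h

theorem tendsto_conj {φ : ℂ → ℂ} {l : Filter ℂ} (h : Tendsto φ l (𝓝 1)) :
    Tendsto (fun w => (!![(φ w)⁻¹, 0; 0, φ w] : Mat2)) l (𝓝 1) := by
  have hi : Tendsto (fun w => (φ w)⁻¹) l (𝓝 1) := by simpa using h.inv₀ one_ne_zero
  refine tendsto_pi_nhds.2 fun i => tendsto_pi_nhds.2 fun j => ?_
  fin_cases i <;> fin_cases j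
  · simpa using hi
  · simpa using tendsto_const_nhds
  · simpa using tendsto_const_nhds
  · simpa using h

theorem phiConj_mul_Ft1 (s₁ s₃ z t : ℂ) :
    phiConj s₁ s₃ z t * Ft1 s₁ s₃ z t = F1 s₁ s₃ z t * phiConj s₁ s₃ z t := by
  have h := phi_ne_zero s₁ s₃ z t
  simp only [phiConj, Ft1, F1, Matrix.mul_fin_two]
  congr! 3 <;> field_simp <;> ring_nf

theorem phiConj_mul_Ft3 (s₁ s₃ z t : ℂ) :
    phiConj s₁ s₃ z t * Ft3 s₁ s₃ z t = F3 s₁ s₃ z t * phiConj s₁ s₃ z t := by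
  have h := phi_ne_zero s₁ s₃ z t
  simp only [phiConj, Ft3, F3, Matrix.mul_fin_two]
  congr! 3 <;> field_simp <;> ring_nf

theorem F2_mul_conj {s₁ s₃ z t p : ℂ} (h : jumpA s₁ s₃ z t ≠ 0) :
    F2 s₁ s₃ z t * !![(jumpA s₁ s₃ z t * p)⁻¹, 0; 0, jumpA s₁ s₃ z t * p] =
      !![p⁻¹, 0; 0, p] := by
  have e1 : jumpA s₁ s₃ z t * (jumpA s₁ s₃ z t * p)⁻¹ = p⁻¹ := by
    rw [mul_inv, mul_inv_cancel_left₀ h]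
  have e2 : 1 / jumpA s₁ s₃ z t * (jumpA s₁ s₃ z t * p) = p := by
    rw [one_div, inv_mul_cancel_left₀ h]
  simp only [F2, Matrix.mul_fin_two, mul_zero, zero_mul, add_zero, zero_add, e1, e2]

/-- `∂ₜ log φ`, the Cauchy transform of `Ȧ / A`. -/
def dotLogPhi (s₁ s₃ t z : ℂ) : ℂ :=
  cauchyTr 0 (fun w => deriv (fun τ => jumpA s₁ s₃ w τ) t / jumpA s₁ s₃ w t) z

namespace SolvesLDU

variable {s₁ s₃ t : ℂ} {c₁ c₃ : ℝ} {Y₁ Y₂ Y₃ Y₄ : ℂ → Mat2}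

/-- Conjugation by `φ` removes the jump on the imaginary axis. -/
theorem exists_solvesLU (hY : SolvesLDU s₁ s₃ c₁ c₃ t Y₁ Y₂ Y₃ Y₄)
    (h : Admissible s₁ s₃ c₁ c₃ t) :
    ∃ W₂ : ℂ → Mat2, SolvesLU s₁ s₃ c₁ c₃ t (fun z => Y₁ z * phiConj s₁ s₃ z t) W₂
        (fun z => Y₄ z * phiConj s₁ s₃ z t) ∧
      (∀ z : ℂ, 0 < z.re → W₂ z = Y₂ z * phiConj s₁ s₃ z t) ∧
      (∀ z : ℂ, z.re < 0 → W₂ z = Y₃ z * phiConj s₁ s₃ z t) := by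
  obtain ⟨φ, η, hη, hηm, hφa, hφ0, hφr, hφl, hpa, hφlim, hplim⟩ := h.exists_phi_right
  have c₁p := h.c₁_pos
  have c₃p := h.c₃_pos
  have hηc₃ : η < c₃ := lt_of_lt_of_le hηm (min_le_right _ _)
  set Φ : ℂ → Mat2 := fun z => !![(φ z)⁻¹, 0; 0, φ z] with hΦ
  have hpc : ∀ z : ℂ, 0 < z.re → phiConj s₁ s₃ z t = Φ z := fun z hz => by
    rw [phiConj, hφr z hz]
  have hpr : ∀ z : ℂ, 0 < z.re → AnalyticAt ℂ (fun z => phi s₁ s₃ z t) z := fun z hz =>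
    (hφa z (by linarith)).congr (Filter.mem_of_superset
      ((isOpen_Ioi.preimage continuous_re).mem_nhds hz) fun w hw => (hφr w hw).symm)
  have hca : ∀ z : ℂ, z.re ≠ 0 → AnalyticMatAt (fun z => phiConj s₁ s₃ z t) z := fun z hz =>
    analyticMatAt_conj (hz.lt_or_gt.elim (hpa z) (hpr z)) (phi_ne_zero s₁ s₃ z t)
  have hΦa : ∀ z : ℂ, -η < z.re → AnalyticMatAt Φ z := fun z hz =>
    analyticMatAt_conj (hφa z hz) (hφ0 z)
  set W₂ : ℂ → Mat2 := glue 0 (fun z => Y₂ z * Φ z) (fun z => Y₃ z * phiConj s₁ s₃ z t) with hW₂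
  have hWr : ∀ z : ℂ, 0 < z.re → W₂ z = Y₂ z * phiConj s₁ s₃ z t := fun z hz => by
    rw [hpc z hz]; exact if_pos hz.le
  have hWl : ∀ z : ℂ, z.re < 0 → W₂ z = Y₃ z * phiConj s₁ s₃ z t := fun z hz =>
    if_neg (not_le.2 hz)
  have hWr' : ∀ z : ℂ, 0 ≤ z.re → W₂ z = Y₂ z * Φ z := fun z hz => if_pos hz
  have htp : ∀ S : Set ℂ, Tendsto (fun z => phi s₁ s₃ z t) (Bornology.cobounded ℂ ⊓ 𝓟 S) (𝓝 1) →
      Tendsto (fun z => phiConj s₁ s₃ z t) (Bornology.cobounded ℂ ⊓ 𝓟 S) (𝓝 1) :=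
    fun S hS => tendsto_conj hS
  have hphi1 : Tendsto (fun z => phi s₁ s₃ z t) (Bornology.cobounded ℂ ⊓ 𝓟 {z | c₁ ≤ z.re})
      (𝓝 1) := by
    refine (hφlim.mono_left (inf_le_inf_left _ (principal_mono.2 fun z hz => ?_))).congr' ?_
    · have hz' : c₁ ≤ z.re := hz
      show -(η / 2) ≤ z.re
      linarith
    · filter_upwards [mem_inf_of_right (mem_principal_self _)] with z hz
      exact (hφr z (lt_of_lt_of_le c₁p hz)).symm
  have hone : ∀ {X X' : ℂ → Mat2} {l : Filter ℂ}, Tendsto X l (𝓝 1) → Tendsto X' l (𝓝 1) →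
      Tendsto (fun z => X z * X' z) l (𝓝 1) := fun hX hX' => by
    simpa using hX.mul hX'
  refine ⟨W₂, ⟨?_, ?_, ?_, ?_, ?_, ?_, ?_, ?_⟩, hWr, hWl⟩
  · exact fun i j z hz => (hY.analytic₁.at hz).mul
      (hca z (lt_of_lt_of_le c₁p hz).ne') i j
  · intro i j z hz
    rcases lt_trichotomy z.re 0 with h1 | h1 | h1
    · exact (((hY.analytic₃.at ⟨hz.1, h1.le⟩).mul (hca z h1.ne)).congr
        (glue_eventuallyEq_of_gt h1).symm) i j
    · refine (((hY.analytic₂.at ⟨h1.ge, by linarith⟩).mul (hΦa z (by linarith))).congr ?_) i j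
      have hzs : z ∈ vstrip (-c₃) c₁ := ⟨by linarith, by linarith⟩
      have hnear : ∀ᶠ w in 𝓝 z, -η < w.re := (isOpen_Ioi.preimage continuous_re).mem_nhds
        (show -η < z.re by linarith)
      filter_upwards [hY.eventually₂ h h1, hnear,
        (h.analyticAt_jumpA hzs).continuousAt.eventually_ne (h.ne_zero hzs)] with w hw hwη hne
      rcases le_or_gt 0 w.re with h2 | h2
      · exact (hWr' w h2).symm
      · rw [hWl w h2, hw, phiConj, hφl w hwη h2, Matrix.mul_assoc, F2_mul_conj hne]
    · exact (((hY.analytic₂.at ⟨h1.le, hz.2⟩).mul (hΦa z (by linarith))).congr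
        (glue_eventuallyEq_of_lt h1).symm) i j
  · exact fun i j z hz => (hY.analytic₄.at hz).mul
      (hca z (lt_of_le_of_lt hz (by linarith)).ne) i j
  · intro z hz
    rw [hWr z (by linarith), hY.jump₁ z hz, Matrix.mul_assoc, Matrix.mul_assoc,
      phiConj_mul_Ft1]
  · intro z hz
    rw [hWl z (by linarith), hY.jump₃ z hz, Matrix.mul_assoc, Matrix.mul_assoc,
      phiConj_mul_Ft3]
  · exact hone hY.infinity₁ (htp _ hphi1)
  · have t₁ : Tendsto W₂ (Bornology.cobounded ℂ ⊓ 𝓟 {z | 0 ≤ z.re ∧ z.re ≤ c₁}) (𝓝 1) := by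
      refine (hone hY.infinity₂ (tendsto_conj (hφlim.mono_left
        (inf_le_inf_left _ (principal_mono.2 fun z hz => ?_))))).congr' ?_
      · have hz' : 0 ≤ z.re := hz.1
        show -(η / 2) ≤ z.re
        linarith
      · filter_upwards [mem_inf_of_right (mem_principal_self _)] with z hz
        exact (hWr' z hz.1).symm
    have t₂ : Tendsto W₂ (Bornology.cobounded ℂ ⊓ 𝓟 {z | -(η / 2) ≤ z.re ∧ z.re < 0}) (𝓝 1) := by
      have hsub : {z : ℂ | -(η / 2) ≤ z.re ∧ z.re < 0} ⊆ vstrip (-c₃) c₁ := fun z hz =>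
        ⟨by linarith [hz.1], by linarith [hz.2]⟩
      have hA : Tendsto (fun z => jumpA s₁ s₃ z t)
          (Bornology.cobounded ℂ ⊓ 𝓟 {z | -(η / 2) ≤ z.re ∧ z.re < 0}) (𝓝 1) := by
        have := ((h.decaysOn_jumpA_sub_one.mono_set hsub).tendsto_zero h.decay_pos).add_const 1
        simpa using this
      have hAφ : Tendsto (fun z => jumpA s₁ s₃ z t * φ z)
          (Bornology.cobounded ℂ ⊓ 𝓟 {z | -(η / 2) ≤ z.re ∧ z.re < 0}) (𝓝 1) := by
        simpa using hA.mul (hφlim.mono_left (inf_le_inf_left _ (principal_mono.2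
          fun z (hz : -(η / 2) ≤ z.re ∧ z.re < 0) => hz.1)))
      refine (hone (hY.infinity₃.mono_left (inf_le_inf_left _ (principal_mono.2
        fun z (hz : -(η / 2) ≤ z.re ∧ z.re < 0) => ⟨by linarith [hz.1], hz.2.le⟩)))
        (tendsto_conj hAφ)).congr' ?_
      filter_upwards [mem_inf_of_right (mem_principal_self _)] with z hz
      rw [hWl z hz.2, phiConj, hφl z (by linarith [hz.1]) hz.2]
    have t₃ : Tendsto W₂ (Bornology.cobounded ℂ ⊓ 𝓟 {z | -c₃ ≤ z.re ∧ z.re ≤ -(η / 2)})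
        (𝓝 1) := by
      refine (hone (hY.infinity₃.mono_left (inf_le_inf_left _ (principal_mono.2
        fun z (hz : -c₃ ≤ z.re ∧ z.re ≤ -(η / 2)) => ⟨hz.1, by linarith [hz.2]⟩)))
        (htp _ (hplim.mono_left (inf_le_inf_left _ (principal_mono.2
          fun z (hz : -c₃ ≤ z.re ∧ z.re ≤ -(η / 2)) => hz.2))))).congr' ?_
      filter_upwards [mem_inf_of_right (mem_principal_self _)] with z hz
      exact (hWl z (lt_of_le_of_lt hz.2 (by linarith))).symm
    refine ((t₁.sup t₂).sup t₃).mono_left ?_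
    rw [← inf_sup_left, ← inf_sup_left, sup_principal, sup_principal]
    refine inf_le_inf_left _ (principal_mono.2 fun z hz => ?_)
    rcases le_or_gt 0 z.re with h1 | h1
    · exact Or.inl (Or.inl ⟨h1, hz.2⟩)
    rcases le_total (-(η / 2)) z.re with h2 | h2
    · exact Or.inl (Or.inr ⟨h2, h1⟩)
    · exact Or.inr ⟨hz.1, h2⟩
  · refine hone hY.infinity₄ (htp _ (hplim.mono_left
      (inf_le_inf_left _ (principal_mono.2 fun z hz => ?_))))
    have hz' : z.re ≤ -c₃ := hz
    show z.re ≤ -(η / 2)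
    linarith

theorem analyticAt_phi (h : Admissible s₁ s₃ c₁ c₃ t) {z : ℂ} (hz : z.re ≠ 0) :
    AnalyticAt ℂ (fun z => phi s₁ s₃ z t) z := by
  obtain ⟨φ, η, hη, -, hφa, -, hφr, -, hpa, -, -⟩ := h.exists_phi_right
  rcases hz.lt_or_gt with hz | hz
  · exact hpa z hz
  · exact (hφa z (by linarith)).congr (Filter.mem_of_superset
      ((isOpen_Ioi.preimage continuous_re).mem_nhds hz) fun w hw => (hφr w hw).symm)

theorem logDerivMat_mul_phiConj {Y : ℂ → Mat2} {z : ℂ} (h : Admissible s₁ s₃ c₁ c₃ t)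
    (hz : z.re ≠ 0) (hYa : AnalyticMatAt Y z) (hdet : (Y z).det = 1) :
    logDerivMat (fun w => Y w * phiConj s₁ s₃ w t) z 0 1 =
        phi s₁ s₃ z t ^ 2 * logDerivMat Y z 0 1 ∧
      logDerivMat (fun w => Y w * phiConj s₁ s₃ w t) z 1 0 =
        ((phi s₁ s₃ z t)⁻¹) ^ 2 * logDerivMat Y z 1 0 := by
  have hp := analyticAt_phi h hz
  have h0 := phi_ne_zero s₁ s₃ z t
  exact (logDerivMat_mul_diag hYa (hp.fun_inv h0) hp (inv_mul_cancel₀ h0) hdet).2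

/-- On `l₁` the two Malgrange densities differ by the time derivative of `log φ` times the jump of
the diagonal part of `Y⁻¹ Y'`. -/
theorem malgrangeDensity_Ft1 (hY : SolvesLDU s₁ s₃ c₁ c₃ t Y₁ Y₂ Y₃ Y₄)
    (h : Admissible s₁ s₃ c₁ c₃ t) {z : ℂ} (hz : z ∈ vline c₁) :
    malgrangeDensity (fun z => Y₁ z * phiConj s₁ s₃ z t) (Ft1 s₁ s₃) t z =
      malgrangeDensity Y₁ (F1 s₁ s₃) t z -
        (diagPart Y₂ z * dotLogPhi s₁ s₃ t z - diagPart Y₁ z * dotLogPhi s₁ s₃ t z) := by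
  have hz' : z.re = c₁ := hz
  have c₁p := h.c₁_pos
  have hz0 : z.re ≠ 0 := by rw [hz']; exact c₁p.ne'
  have hzs : z ∈ vstrip (-c₃) c₁ := ⟨by linarith [h.c₃_pos], hz'.le⟩
  have hdet := (hY.det_eq_one h).1 z hz'.ge
  have hYa := hY.analytic₁.at (z := z) hz'.ge
  have hp0 := phi_ne_zero s₁ s₃ z t
  have hfa := (analyticAt_jumpC s₁ s₃ (h.mem_cutPlane hzs) h.re_pos).fun_div
    (h.analyticAt_jumpA hzs) (h.ne_zero hzs)
  have hft : HasDerivAt (fun τ => jumpC s₁ s₃ z τ / jumpA s₁ s₃ z τ)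
      (deriv (fun τ => jumpC s₁ s₃ z τ / jumpA s₁ s₃ z τ) t) t :=
    ((differentiableAt_jumpC_time s₁ s₃ (h.mem_cutPlane hzs) h.re_pos).fun_div
      (differentiableAt_jumpA_time s₁ s₃ (h.mem_cutPlane hzs) h.re_pos)
      (h.ne_zero hzs)).hasDerivAt
  have e1 := malgrangeDensity_lower (t := t) (fun z τ => jumpC s₁ s₃ z τ / jumpA s₁ s₃ z τ) hdet
  have e2 := malgrangeDensity_lower (Y := fun z => Y₁ z * phiConj s₁ s₃ z t) (t := t) (z := z)
    (fun z τ => jumpC s₁ s₃ z τ / jumpA s₁ s₃ z τ * ((phi s₁ s₃ z τ) ^ 2)⁻¹)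
    (by rw [Matrix.det_mul, hdet, det_phiConj, one_mul])
  have e3 := (hft.fun_mul (((h.hasDerivAt_phi hz0).fun_pow 2).fun_inv (pow_ne_zero 2 hp0))).deriv
  have e4 : diagPart Y₂ z = _ := (diagPart_congr (hY.eventually₁ h hz')).trans
    (diagPart_mul_lower hYa hfa hdet)
  have e1' : malgrangeDensity Y₁ (F1 s₁ s₃) t z = _ := e1
  have e2' : malgrangeDensity (fun z => Y₁ z * phiConj s₁ s₃ z t) (Ft1 s₁ s₃) t z = _ := e2
  rw [e1', e2', e3, e4, (logDerivMat_mul_phiConj h hz0 hYa hdet).1, dotLogPhi]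
  field_simp
  ring

/-- On `l₃` the two Malgrange densities differ by the time derivative of `log φ` times the jump of
the diagonal part of `Y⁻¹ Y'`. -/
theorem malgrangeDensity_Ft3 (hY : SolvesLDU s₁ s₃ c₁ c₃ t Y₁ Y₂ Y₃ Y₄)
    (h : Admissible s₁ s₃ c₁ c₃ t) {W : ℂ → Mat2}
    (hW : ∀ z : ℂ, z.re < 0 → W z = Y₃ z * phiConj s₁ s₃ z t) {z : ℂ} (hz : z ∈ vline (-c₃)) :
    malgrangeDensity W (Ft3 s₁ s₃) t z =
      malgrangeDensity Y₃ (F3 s₁ s₃) t z +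
        (diagPart Y₃ z * dotLogPhi s₁ s₃ t z - diagPart Y₄ z * dotLogPhi s₁ s₃ t z) := by
  have hz' : z.re = -c₃ := hz
  have c₃p := h.c₃_pos
  have hzn : z.re < 0 := by rw [hz']; linarith
  have hzs : z ∈ vstrip (-c₃) c₁ := ⟨hz'.ge, by linarith [h.c₁_pos]⟩
  have hdet := (hY.det_eq_one h).2.2.1 z hz'.ge hzn.le
  have hYa := hY.analytic₃.at (z := z) ⟨hz'.ge, hzn.le⟩
  have hp0 := phi_ne_zero s₁ s₃ z t
  have hfa := (analyticAt_jumpB s₁ s₃ (h.mem_cutPlane hzs) h.re_pos).fun_div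
    (h.analyticAt_jumpA hzs) (h.ne_zero hzs)
  have hft : HasDerivAt (fun τ => jumpB s₁ s₃ z τ / jumpA s₁ s₃ z τ)
      (deriv (fun τ => jumpB s₁ s₃ z τ / jumpA s₁ s₃ z τ) t) t :=
    ((differentiableAt_jumpB_time s₁ s₃ (h.mem_cutPlane hzs) h.re_pos).fun_div
      (differentiableAt_jumpA_time s₁ s₃ (h.mem_cutPlane hzs) h.re_pos)
      (h.ne_zero hzs)).hasDerivAt
  have hWe : W =ᶠ[𝓝 z] fun z => Y₃ z * phiConj s₁ s₃ z t :=
    Filter.mem_of_superset ((isOpen_Iio.preimage continuous_re).mem_nhds hzn) hW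
  have e1 := malgrangeDensity_upper (t := t) (fun z τ => jumpB s₁ s₃ z τ / jumpA s₁ s₃ z τ) hdet
  have e2 := malgrangeDensity_upper (Y := W) (t := t) (z := z)
    (fun z τ => jumpB s₁ s₃ z τ / jumpA s₁ s₃ z τ * (phi s₁ s₃ z τ) ^ 2)
    (by rw [hW z hzn, Matrix.det_mul, hdet, det_phiConj, one_mul])
  have e3 := (hft.fun_mul ((h.hasDerivAt_phi hzn.ne).fun_pow 2)).deriv
  have e4 : diagPart Y₄ z = _ := (diagPart_congr (hY.eventually₃ h hz')).trans
    (diagPart_mul_upper hYa hfa hdet)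
  have e1' : malgrangeDensity Y₃ (F3 s₁ s₃) t z = _ := e1
  have e2' : malgrangeDensity W (Ft3 s₁ s₃) t z = _ := e2
  rw [e1', e2', e3, e4, logDerivMat_congr hWe, (logDerivMat_mul_phiConj h hzn.ne hYa hdet).2,
    dotLogPhi]
  field_simp
  ring

/-- Across the imaginary axis the diagonal part of `Y⁻¹ Y'` jumps by `2 A' / A`. -/
theorem diagPart_jump (hY : SolvesLDU s₁ s₃ c₁ c₃ t Y₁ Y₂ Y₃ Y₄)
    (h : Admissible s₁ s₃ c₁ c₃ t) {z : ℂ} (hz : z.re = 0) :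
    diagPart Y₃ z = diagPart Y₂ z +
      2 * (deriv (fun v => jumpA s₁ s₃ v t) z / jumpA s₁ s₃ z t) := by
  have hzs : z ∈ vstrip (-c₃) c₁ := ⟨by linarith [h.c₃_pos], by linarith [h.c₁_pos]⟩
  have hA := h.analyticAt_jumpA hzs
  have h0 := h.ne_zero hzs
  have hd : deriv (fun w => 1 / jumpA s₁ s₃ w t) z =
      -deriv (fun v => jumpA s₁ s₃ v t) z / jumpA s₁ s₃ z t ^ 2 := by
    simp only [one_div]
    exact deriv_fun_inv'' hA.differentiableAt h0
  have e := (logDerivMat_mul_diag (X := Y₂)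
    (hY.analytic₂.at ⟨hz.ge, by linarith [h.c₁_pos]⟩) hA
    (analyticAt_const (v := (1 : ℂ)) |>.fun_div hA h0) (mul_one_div_cancel h0)
    ((hY.det_eq_one h).2.1 z hz.ge (by linarith [h.c₁_pos]))).1
  have e' : diagPart Y₃ z = _ := (diagPart_congr (hY.eventually₂ h hz)).trans e
  rw [e', hd]
  field_simp
  ring

end SolvesLDU

/-! ### Comparison of the Malgrange forms -/

theorem cauchyTr_eq_zero_of_right {T : ℂ → ℂ} {c δ : ℝ} {w : ℂ} (hδ : 0 < δ) (hw : w.re < c)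
    (hd : ∀ z : ℂ, c ≤ z.re → DifferentiableAt ℂ T z) (h : DecaysOn T δ {z | c ≤ z.re}) :
    cauchyTr c T w = 0 := by
  have hp : 0 < c - w.re := sub_pos.2 hw
  have hlow : ∀ z ∈ {z : ℂ | c ≤ z.re}, c - w.re ≤ ‖z - w‖ := fun z hz => by
    have hz' : c ≤ z.re := hz
    linarith [abs_re_sub_le_norm z w, le_abs_self (z.re - w.re)]
  refine lineInt_eq_zero_of_right (r := δ + 1) (by linarith) (fun z hz => ?_) ?_
  · have hne : z - w ≠ 0 := norm_pos_iff.1 (hp.trans_le (hlow z hz))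
    exact (hd z hz).fun_div (by fun_prop) hne
  · simp only [div_eq_mul_inv]
    exact h.mul (DecaysOn.inv_sub hp hlow)

theorem cauchyTr_eq_zero_of_left {T : ℂ → ℂ} {c δ : ℝ} {w : ℂ} (hδ : 0 < δ) (hw : c < w.re)
    (hd : ∀ z : ℂ, z.re ≤ c → DifferentiableAt ℂ T z) (h : DecaysOn T δ {z | z.re ≤ c}) :
    cauchyTr c T w = 0 := by
  have hp : 0 < w.re - c := sub_pos.2 hw
  have hlow : ∀ z ∈ {z : ℂ | z.re ≤ c}, w.re - c ≤ ‖z - w‖ := fun z hz => by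
    have hz' : z.re ≤ c := hz
    linarith [abs_re_sub_le_norm z w, neg_abs_le (z.re - w.re)]
  refine lineInt_eq_zero_of_left (r := δ + 1) (by linarith) (fun z hz => ?_) ?_
  · have hne : z - w ≠ 0 := norm_pos_iff.1 (hp.trans_le (hlow z hz))
    exact (hd z hz).fun_div (by fun_prop) hne
  · simp only [div_eq_mul_inv]
    exact h.mul (DecaysOn.inv_sub hp hlow)

namespace SolvesLDU

variable {s₁ s₃ t : ℂ} {c₁ c₃ : ℝ} {Y₁ Y₂ Y₃ Y₄ : ℂ → Mat2}

theorem decaysOn_logDerivMat (hY : SolvesLDU s₁ s₃ c₁ c₃ t Y₁ Y₂ Y₃ Y₄)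
    (h : Admissible s₁ s₃ c₁ c₃ t) (i j : Fin 2) :
    DecaysOn (fun z => logDerivMat Y₁ z i j) 1 {z | c₁ ≤ z.re} ∧
    DecaysOn (fun z => logDerivMat Y₂ z i j) 1 (vstrip 0 c₁) ∧
    DecaysOn (fun z => logDerivMat Y₃ z i j) 1 (vstrip (-c₃) 0) ∧
    DecaysOn (fun z => logDerivMat Y₄ z i j) 1 {z | z.re ≤ -c₃} := by
  have hd := fun i j => hY.decaysOn_deriv h i j
  exact ⟨PainleveTwo.decaysOn_logDerivMat (hY.analytic₁.decaysOn_zero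
      (isClosed_le continuous_const continuous_re) hY.infinity₁) (fun i j => (hd i j).1) i j,
    PainleveTwo.decaysOn_logDerivMat (hY.analytic₂.decaysOn_zero
      (isClosed_vstrip 0 c₁) hY.infinity₂) (fun i j => (hd i j).2.1) i j,
    PainleveTwo.decaysOn_logDerivMat (hY.analytic₃.decaysOn_zero
      (isClosed_vstrip (-c₃) 0) hY.infinity₃) (fun i j => (hd i j).2.2.1) i j,
    PainleveTwo.decaysOn_logDerivMat (hY.analytic₄.decaysOn_zero
      (isClosed_le continuous_re continuous_const) hY.infinity₄) (fun i j => (hd i j).2.2.2) i j⟩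

theorem decaysOn_diagPart (hY : SolvesLDU s₁ s₃ c₁ c₃ t Y₁ Y₂ Y₃ Y₄)
    (h : Admissible s₁ s₃ c₁ c₃ t) :
    DecaysOn (diagPart Y₁) 1 {z | c₁ ≤ z.re} ∧ DecaysOn (diagPart Y₂) 1 (vstrip 0 c₁) ∧
    DecaysOn (diagPart Y₃) 1 (vstrip (-c₃) 0) ∧ DecaysOn (diagPart Y₄) 1 {z | z.re ≤ -c₃} := by
  have h0 := hY.decaysOn_logDerivMat h 0 0
  have h1 := hY.decaysOn_logDerivMat h 1 1
  exact ⟨h0.1.sub h1.1, h0.2.1.sub h1.2.1, h0.2.2.1.sub h1.2.2.1, h0.2.2.2.sub h1.2.2.2⟩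

theorem lineIntegrable_F1 (hY : SolvesLDU s₁ s₃ c₁ c₃ t Y₁ Y₂ Y₃ Y₄)
    (h : Admissible s₁ s₃ c₁ c₃ t) :
    LineIntegrable c₁ (malgrangeDensity Y₁ (F1 s₁ s₃) t) := by
  have c₁p := h.c₁_pos
  have c₃p := h.c₃_pos
  have hs : vline c₁ ⊆ {z : ℂ | c₁ ≤ z.re} := fun z hz => (show z.re = c₁ from hz).ge
  have hδ := h.decay_pos
  have hN := ((hY.decaysOn_logDerivMat h 0 1).1.mono_set hs).mul
    ((h.decaysOn_deriv_time_div (fun p => differentiableAt_jumpC s₁ s₃) h.decaysOn_jumpC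
      h.decaysOn_deriv_time_jumpC).mono_set (vline_subset_vstrip (by linarith) le_rfl))
  have hm := (aestronglyMeasurable_line (f := fun z => logDerivMat Y₁ z 0 1) fun z hz =>
    (hY.analytic₁.logDerivMat 0 1 z (hs hz)).continuousAt.continuousWithinAt).mul
    (h.aestronglyMeasurable_deriv_time_div (c := c₁) (by linarith) le_rfl
      fun p => differentiableAt_jumpC s₁ s₃)
  exact (lineIntegrable_of_decaysOn (r := 1 + decay s₁ s₃) (by linarith) hm hN).congr fun z hz =>
    malgrangeDensity_lower (fun z τ => jumpC s₁ s₃ z τ / jumpA s₁ s₃ z τ)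
      ((hY.det_eq_one h).1 z (hs hz))

theorem lineIntegrable_F3 (hY : SolvesLDU s₁ s₃ c₁ c₃ t Y₁ Y₂ Y₃ Y₄)
    (h : Admissible s₁ s₃ c₁ c₃ t) :
    LineIntegrable (-c₃) (malgrangeDensity Y₃ (F3 s₁ s₃) t) := by
  have c₁p := h.c₁_pos
  have c₃p := h.c₃_pos
  have hs : vline (-c₃) ⊆ vstrip (-c₃) 0 := vline_subset_vstrip le_rfl (by linarith)
  have hδ := h.decay_pos
  have hN := ((hY.decaysOn_logDerivMat h 1 0).2.2.1.mono_set hs).mul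
    ((h.decaysOn_deriv_time_div (fun p => differentiableAt_jumpB s₁ s₃) h.decaysOn_jumpB
      h.decaysOn_deriv_time_jumpB).mono_set (vline_subset_vstrip le_rfl (by linarith)))
  have hm := (aestronglyMeasurable_line (f := fun z => logDerivMat Y₃ z 1 0) fun z hz =>
    (hY.analytic₃.logDerivMat 1 0 z (hs hz)).continuousAt.continuousWithinAt).mul
    (h.aestronglyMeasurable_deriv_time_div (c := -c₃) le_rfl (by linarith)
      fun p => differentiableAt_jumpB s₁ s₃)
  exact (lineIntegrable_of_decaysOn (r := 1 + decay s₁ s₃) (by linarith) hm hN).congr fun z hz =>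
    malgrangeDensity_upper (fun z τ => jumpB s₁ s₃ z τ / jumpA s₁ s₃ z τ)
      ((hY.det_eq_one h).2.2.1 z (hs hz).1 (hs hz).2)

theorem malgrangeDensity_F2 (hY : SolvesLDU s₁ s₃ c₁ c₃ t Y₁ Y₂ Y₃ Y₄)
    (h : Admissible s₁ s₃ c₁ c₃ t) {z : ℂ} (hz : z ∈ vline 0) :
    malgrangeDensity Y₂ (F2 s₁ s₃) t z =
      deriv (fun τ => jumpA s₁ s₃ z τ) t / jumpA s₁ s₃ z t * diagPart Y₂ z := by
  have hzs : z ∈ vstrip (-c₃) c₁ :=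
    vline_subset_vstrip (by linarith [h.c₃_pos]) h.c₁_pos.le hz
  have hz' : z.re = 0 := hz
  exact malgrangeDensity_diag (a := jumpA s₁ s₃)
    ((hY.det_eq_one h).2.1 z hz'.ge (by linarith [h.c₁_pos])) (h.ne_zero hzs)
    (differentiableAt_jumpA_time s₁ s₃ (h.mem_cutPlane hzs) h.re_pos)

theorem lineIntegrable_F2 (hY : SolvesLDU s₁ s₃ c₁ c₃ t Y₁ Y₂ Y₃ Y₄)
    (h : Admissible s₁ s₃ c₁ c₃ t) :
    LineIntegrable 0 (malgrangeDensity Y₂ (F2 s₁ s₃) t) := by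
  have c₁p := h.c₁_pos
  have c₃p := h.c₃_pos
  have hs : vline 0 ⊆ vstrip 0 c₁ := vline_subset_vstrip le_rfl c₁p.le
  have hδ := h.decay_pos
  have hN := (h.decaysOn_dotA_div.mono_set (vline_subset_vstrip (by linarith) c₁p.le)).mul
    ((hY.decaysOn_diagPart h).2.1.mono_set hs)
  have hm := (h.aestronglyMeasurable_dotA_div (c := 0) (by linarith) c₁p.le).mul
    (aestronglyMeasurable_line (f := diagPart Y₂) fun z hz =>
      (hY.analytic₂.diagPart z (hs hz)).continuousAt.continuousWithinAt)
  exact (lineIntegrable_of_decaysOn (r := decay s₁ s₃ + 1) (by linarith) hm hN).congr fun z hz =>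
    hY.malgrangeDensity_F2 h hz

/-- The Malgrange forms of the two problems. The diagonal parts `T` of `Y⁻¹ Y'` on the two sides of
`l₁` and `l₃` enter through their integrals against `∂ₜ log φ`. After the interchange of the
integrations those are integrals over the imaginary axis of `Ȧ / A` times the Cauchy transforms of
`T`. The transforms of the outer pieces vanish, and those of the inner pieces combine, by Cauchy's
formula in the strip, to the density on the imaginary axis and a multiple of the transform of
`A' / A`. -/
theorem malgrangeLDU_eq (hY : SolvesLDU s₁ s₃ c₁ c₃ t Y₁ Y₂ Y₃ Y₄)
    (h : Admissible s₁ s₃ c₁ c₃ t) {W : ℂ → Mat2}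
    (hW : ∀ z : ℂ, z.re < 0 → W z = Y₃ z * phiConj s₁ s₃ z t) :
    LineIntegrable c₁ (malgrangeDensity (fun z => Y₁ z * phiConj s₁ s₃ z t) (Ft1 s₁ s₃) t) ∧
    LineIntegrable (-c₃) (malgrangeDensity W (Ft3 s₁ s₃) t) ∧
    malgrangeLDU s₁ s₃ c₁ c₃ t Y₁ Y₂ Y₃ =
      malgrangeLU s₁ s₃ c₁ c₃ t (fun z => Y₁ z * phiConj s₁ s₃ z t) W +
        2 * lineInt 0 (fun z => deriv (fun τ => jumpA s₁ s₃ z τ) t / jumpA s₁ s₃ z t *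
          cauchyTr (-c₃) (fun w => deriv (fun v => jumpA s₁ s₃ v t) w / jumpA s₁ s₃ w t) z) := by
  have c₁p := h.c₁_pos
  have c₃p := h.c₃_pos
  have hδ := h.decay_pos
  have hδ1 := decay_le_one s₁ s₃
  set g : ℂ → ℂ := fun z => deriv (fun τ => jumpA s₁ s₃ z τ) t / jumpA s₁ s₃ z t with hg
  set a : ℂ → ℂ := fun w => deriv (fun v => jumpA s₁ s₃ v t) w / jumpA s₁ s₃ w t with ha
  obtain ⟨d₁, d₂, d₃, d₄⟩ := hY.decaysOn_diagPart h
  have hgd : DecaysOn g (decay s₁ s₃) (vline 0) :=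
    h.decaysOn_dotA_div.mono_set (vline_subset_vstrip (by linarith) c₁p.le)
  have hgm : AEStronglyMeasurable (fun y : ℝ => g ((0 : ℝ) + y * I)) :=
    h.aestronglyMeasurable_dotA_div (by linarith) c₁p.le
  have s₁r : vline c₁ ⊆ {z : ℂ | c₁ ≤ z.re} := fun z hz => (show z.re = c₁ from hz).ge
  have s₁l : vline c₁ ⊆ vstrip 0 c₁ := vline_subset_vstrip c₁p.le le_rfl
  have s₃r : vline (-c₃) ⊆ vstrip (-c₃) 0 := vline_subset_vstrip le_rfl (by linarith)
  have s₃l : vline (-c₃) ⊆ {z : ℂ | z.re ≤ -c₃} := fun z hz => (show z.re = -c₃ from hz).le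
  have n₁ := hY.analytic₁.diagPart
  have n₂ := hY.analytic₂.diagPart
  have n₃ := hY.analytic₃.diagPart
  have n₄ := hY.analytic₄.diagPart
  have hmeas : ∀ {T : ℂ → ℂ} {S : Set ℂ} {c : ℝ}, AnalyticOnNhd ℂ T S → vline c ⊆ S →
      AEStronglyMeasurable (fun y : ℝ => T (c + y * I)) := fun hT hS =>
    aestronglyMeasurable_line fun z hz => (hT z (hS hz)).continuousAt.continuousWithinAt
  -- interchange of the integrations
  have x₁ := lineInt_mul_cauchyTr c₁p.ne' hδ hδ1 (hmeas n₁ s₁r) (d₁.mono_set s₁r) hgm hgd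
  have x₂ := lineInt_mul_cauchyTr c₁p.ne' hδ hδ1 (hmeas n₂ s₁l) (d₂.mono_set s₁l) hgm hgd
  have x₃ := lineInt_mul_cauchyTr (neg_ne_zero.2 c₃p.ne') hδ hδ1 (hmeas n₃ s₃r)
    (d₃.mono_set s₃r) hgm hgd
  have x₄ := lineInt_mul_cauchyTr (neg_ne_zero.2 c₃p.ne') hδ hδ1 (hmeas n₄ s₃l)
    (d₄.mono_set s₃l) hgm hgd
  have hψ : cauchyTr 0 g = dotLogPhi s₁ s₃ t := rfl
  rw [hψ] at x₁ x₂ x₃ x₄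
  -- the outer pieces do not contribute
  have z₁ : lineInt 0 (fun w => g w * cauchyTr c₁ (diagPart Y₁) w) = 0 := by
    rw [lineInt_congr (g := fun _ => 0 * (0 : ℂ)), lineInt_const_mul, zero_mul]
    intro w hw
    have hw' : w.re = 0 := hw
    rw [cauchyTr_eq_zero_of_right one_pos (by rw [hw']; exact c₁p)
      (fun z hz => (n₁ z hz).differentiableAt) d₁, mul_zero, mul_zero]
  have z₄ : lineInt 0 (fun w => g w * cauchyTr (-c₃) (diagPart Y₄) w) = 0 := by
    rw [lineInt_congr (g := fun _ => 0 * (0 : ℂ)), lineInt_const_mul, zero_mul]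
    intro w hw
    have hw' : w.re = 0 := hw
    rw [cauchyTr_eq_zero_of_left one_pos (by rw [hw']; linarith)
      (fun z hz => (n₄ z hz).differentiableAt) d₄, mul_zero, mul_zero]
  -- the function that equals the diagonal part on the right of the axis, continued to the left
  set T : ℂ → ℂ := glue 0 (diagPart Y₂) (fun z => diagPart Y₃ z - 2 * a z) with hT
  have haa : ∀ z ∈ vstrip (-c₃) c₁, AnalyticAt ℂ a z := fun z hz =>
    (h.analyticAt_jumpA hz).deriv.fun_div (h.analyticAt_jumpA hz) (h.ne_zero hz)
  have n₃' : ∀ z ∈ vstrip (-c₃) 0, AnalyticAt ℂ (fun z => diagPart Y₃ z - 2 * a z) z :=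
    fun z hz => (n₃ z hz).sub (analyticAt_const.mul (haa z ⟨hz.1, hz.2.trans c₁p.le⟩))
  have hax : ∀ z : ℂ, z.re = 0 → diagPart Y₂ =ᶠ[𝓝 z] fun z => diagPart Y₃ z - 2 * a z :=
    fun z hz => eventuallyEq_of_eq_on_line (n₂ z ⟨hz.ge, by linarith⟩)
      (n₃' z ⟨by linarith, hz.le⟩) fun w hw => by
        rw [hY.diagPart_jump h (hw.trans hz), ha]; ring
  have hTr : ∀ z : ℂ, 0 ≤ z.re → T =ᶠ[𝓝 z] diagPart Y₂ := fun z hz =>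
    glue_eventuallyEq_left hz (hax z)
  have hTl : ∀ z : ℂ, z.re ≤ 0 → T =ᶠ[𝓝 z] fun z => diagPart Y₃ z - 2 * a z := fun z hz =>
    glue_eventuallyEq_right hz (hax z)
  have hTd : ∀ z ∈ vstrip (-c₃) c₁, DifferentiableAt ℂ T z := fun z hz => by
    rcases le_total 0 z.re with h0 | h0
    · exact ((n₂ z ⟨h0, hz.2⟩).congr (hTr z h0).symm).differentiableAt
    · exact ((n₃' z ⟨hz.1, h0⟩).congr (hTl z h0).symm).differentiableAt
  have hTdec : DecaysOn T 1 (vstrip (-c₃) c₁) := by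
    have e₃ : DecaysOn (fun z => diagPart Y₃ z - 2 * a z) 1 (vstrip (-c₃) 0) :=
      d₃.sub ((h.decaysOn_logDeriv_jumpA.mono_set fun z hz => ⟨hz.1, hz.2.trans c₁p.le⟩).const_mul
        2)
    obtain ⟨C, hC⟩ := d₂
    obtain ⟨D, hD⟩ := e₃
    refine ⟨max C D, fun z hz => ?_⟩
    have hp : 0 ≤ (1 + ‖z‖) ^ (-(1 : ℝ)) := by positivity
    rcases le_total 0 z.re with h0 | h0
    · rw [(hTr z h0).eq_of_nhds]
      exact (hC z ⟨h0, hz.2⟩).trans (mul_le_mul_of_nonneg_right (le_max_left _ _) hp)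
    · rw [(hTl z h0).eq_of_nhds]
      exact (hD z ⟨hz.1, h0⟩).trans (mul_le_mul_of_nonneg_right (le_max_right _ _) hp)
  have ham : AEStronglyMeasurable (fun y : ℝ => a ((-c₃ : ℝ) + y * I)) :=
    hmeas haa (vline_subset_vstrip le_rfl (by linarith))
  have had : DecaysOn a 1 (vline (-c₃)) :=
    h.decaysOn_logDeriv_jumpA.mono_set (vline_subset_vstrip le_rfl (by linarith))
  have hcomb : ∀ w ∈ vline 0, cauchyTr (-c₃) (diagPart Y₃) w =
      cauchyTr c₁ (diagPart Y₂) w - diagPart Y₂ w + 2 * cauchyTr (-c₃) a w := fun w hw => by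
    have hw' : w.re = 0 := hw
    have hwne : w.re ≠ -c₃ := by rw [hw']; exact (neg_ne_zero.2 c₃p.ne').symm
    have hstrip := lineInt_div_sub_sub_lineInt_div_sub (f := T) (w := w) (a := -c₃) (b := c₁)
      (by rw [hw']; linarith) (by rw [hw']; exact c₁p) one_pos hTd hTdec
    have e1 : lineInt c₁ (fun z => T z / (z - w)) = cauchyTr c₁ (diagPart Y₂) w :=
      lineInt_congr fun z hz => by rw [(hTr z (s₁l hz).1).eq_of_nhds]
    have e2 : lineInt (-c₃) (fun z => T z / (z - w)) =
        cauchyTr (-c₃) (diagPart Y₃) w - 2 * cauchyTr (-c₃) a w := by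
      unfold cauchyTr
      rw [← lineInt_const_mul, ← lineInt_sub]
      · refine lineInt_congr fun z hz => ?_
        rw [(hTl z (s₃r hz).2).eq_of_nhds]
        ring
      · exact lineIntegrable_div_sub one_pos (hmeas n₃ s₃r) (d₃.mono_set s₃r) hwne
      · exact (lineIntegrable_div_sub one_pos ham had hwne).const_mul 2
    rw [e1, e2, (hTr w hw'.ge).eq_of_nhds] at hstrip
    linear_combination -hstrip
  have xa := lineInt_mul_cauchyTr (neg_ne_zero.2 c₃p.ne') hδ hδ1 ham had hgm hgd
  have i₂ : LineIntegrable 0 (fun w => g w * diagPart Y₂ w) :=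
    (hY.lineIntegrable_F2 h).congr fun z hz => (hY.malgrangeDensity_F2 h hz).symm
  have i₁ := hY.lineIntegrable_F1 h
  have i₃ := hY.lineIntegrable_F3 h
  have hE : lineInt 0 (fun w => g w * cauchyTr (-c₃) (diagPart Y₃) w) =
      lineInt 0 (fun w => g w * cauchyTr c₁ (diagPart Y₂) w) -
        lineInt 0 (malgrangeDensity Y₂ (F2 s₁ s₃) t) +
        2 * lineInt 0 (fun w => g w * cauchyTr (-c₃) a w) := by
    rw [lineInt_congr (fun z hz => hY.malgrangeDensity_F2 h hz), ← lineInt_sub x₂.2.1 i₂,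
      ← lineInt_const_mul, ← lineInt_add]
    · refine lineInt_congr fun w hw => ?_
      rw [hcomb w hw]
      ring
    · exact LineIntegrable.sub x₂.2.1 i₂
    · exact xa.2.1.const_mul 2
  have j₁ : LineIntegrable c₁ fun z =>
      diagPart Y₂ z * dotLogPhi s₁ s₃ t z - diagPart Y₁ z * dotLogPhi s₁ s₃ t z :=
    LineIntegrable.sub x₂.1 x₁.1
  have j₃ : LineIntegrable (-c₃) fun z =>
      diagPart Y₃ z * dotLogPhi s₁ s₃ t z - diagPart Y₄ z * dotLogPhi s₁ s₃ t z :=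
    LineIntegrable.sub x₃.1 x₄.1
  refine ⟨?_, ?_, ?_⟩
  · exact (LineIntegrable.sub i₁ j₁).congr fun z hz => hY.malgrangeDensity_Ft1 h hz
  · exact (LineIntegrable.add i₃ j₃).congr fun z hz => hY.malgrangeDensity_Ft3 h hW hz
  · have l₁ := (lineInt_congr fun z hz => hY.malgrangeDensity_Ft1 h hz).trans
      ((lineInt_sub i₁ j₁).trans (congrArg _ (lineInt_sub x₂.1 x₁.1)))
    have l₃ := (lineInt_congr fun z hz => hY.malgrangeDensity_Ft3 h hW hz).trans
      ((lineInt_add i₃ j₃).trans (congrArg _ (lineInt_sub x₃.1 x₄.1)))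
    rw [x₁.2.2, x₂.2.2, z₁] at l₁
    rw [x₃.2.2, x₄.2.2, z₄, hE] at l₃
    change malgrangeLDU s₁ s₃ c₁ c₃ t Y₁ Y₂ Y₃ = malgrangeLU s₁ s₃ c₁ c₃ t _ W +
      2 * lineInt 0 (fun w => g w * cauchyTr (-c₃) a w)
    rw [malgrangeLDU, malgrangeLU, l₁, l₃]
    ring

end SolvesLDU

/-- The line of the inner integral may be moved, and both integrals converge. -/
theorem Admissible.outer_integral {s₁ s₃ t : ℂ} {c₁ c₃ ε : ℝ} (h : Admissible s₁ s₃ c₁ c₃ t)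
    (hε : 0 < ε) (hε' : ε ≤ c₃) :
    (∀ z : ℂ, z.re = 0 → LineIntegrable (-ε) (innerDensity s₁ s₃ t z)) ∧
    LineIntegrable 0 (outerDensity s₁ s₃ ε t) ∧
    lineInt 0 (outerDensity s₁ s₃ ε t) =
      lineInt 0 (fun z => deriv (fun τ => jumpA s₁ s₃ z τ) t / jumpA s₁ s₃ z t *
        cauchyTr (-c₃) (fun w => deriv (fun v => jumpA s₁ s₃ v t) w / jumpA s₁ s₃ w t) z) := by
  have c₁p := h.c₁_pos
  have hδ := h.decay_pos
  have hδ1 := decay_le_one s₁ s₃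
  set a : ℂ → ℂ := fun w => deriv (fun v => jumpA s₁ s₃ v t) w / jumpA s₁ s₃ w t with ha
  have hs : vline (-ε) ⊆ vstrip (-c₃) c₁ := vline_subset_vstrip (by linarith) (by linarith)
  have haa : ∀ z ∈ vstrip (-c₃) c₁, AnalyticAt ℂ a z := fun z hz =>
    (h.analyticAt_jumpA hz).deriv.fun_div (h.analyticAt_jumpA hz) (h.ne_zero hz)
  have ham : AEStronglyMeasurable (fun y : ℝ => a ((-ε : ℝ) + y * I)) :=
    aestronglyMeasurable_line fun z hz => (haa z (hs hz)).continuousAt.continuousWithinAt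
  have had : DecaysOn a 1 (vline (-ε)) := h.decaysOn_logDeriv_jumpA.mono_set hs
  have hin : ∀ z w, innerDensity s₁ s₃ t z w = a w / (w - z) := fun z w => by
    rw [innerDensity, ha, div_div]
  have hout : ∀ z, outerDensity s₁ s₃ ε t z =
      deriv (fun τ => jumpA s₁ s₃ z τ) t / jumpA s₁ s₃ z t * cauchyTr (-ε) a z := fun z => by
    rw [outerDensity, cauchyTr, lineInt_congr fun w _ => hin z w]
  have x := lineInt_mul_cauchyTr (neg_ne_zero.2 hε.ne') hδ hδ1 ham had
    (h.aestronglyMeasurable_dotA_div (c := 0) (by linarith) c₁p.le)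
    (h.decaysOn_dotA_div.mono_set (vline_subset_vstrip (by linarith) c₁p.le))
  refine ⟨fun z hz => ?_, x.2.1.congr fun z _ => hout z, lineInt_congr fun z hz => ?_⟩
  · exact (lineIntegrable_div_sub one_pos ham had
      (by rw [hz]; exact (neg_ne_zero.2 hε.ne').symm)).congr fun w _ => hin z w
  · have hz' : z.re = 0 := hz
    rw [hout z]
    congr 1
    have hsub : vstrip (-c₃) (-ε) ⊆ vstrip (-c₃) c₁ := fun w hw => ⟨hw.1, by linarith [hw.2]⟩
    have hlow : ∀ w ∈ vstrip (-c₃) (-ε), ε ≤ ‖w - z‖ := fun w hw => by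
      linarith [abs_re_sub_le_norm w z, neg_abs_le (w.re - z.re), hw.2]
    refine (lineInt_eq_of_decaysOn (r := 1 + 1) (by linarith) (by norm_num) (fun w hw => ?_)
      ?_).symm
    · have hne : w - z ≠ 0 := norm_pos_iff.1 (hε.trans_le (hlow w hw))
      exact (haa w (hsub hw)).differentiableAt.fun_div (by fun_prop) hne
    · simp only [div_eq_mul_inv _ (_ - z)]
      exact (h.decaysOn_logDeriv_jumpA.mono_set hsub).mul (DecaysOn.inv_sub hε hlow)

end PainleveTwo

end

theorem proposition4 (s₁ s₃ : ℂ) (hs₁ : s₁ ≠ 0) (hs₃ : s₃ ≠ 0)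
    (hs : 1 - s₁ * s₃ ∈ Complex.slitPlane)
    (c₁ c₃ : ℝ) (hc₁ : 0 < c₁) (hc₁' : c₁ < 1 / 2) (hc₃ : 0 < c₃) (hc₃' : c₃ < 1 / 2)
    (t : ℂ) (ht : 0 < t.re)
    (hA : ∀ z : ℂ, -c₃ ≤ z.re → z.re ≤ c₁ → PainleveTwo.jumpA s₁ s₃ z t ≠ 0)
    (Y₁ Y₂ Y₃ Y₄ : ℂ → Matrix (Fin 2) (Fin 2) ℂ)
    (hY : PainleveTwo.SolvesLDU s₁ s₃ c₁ c₃ t Y₁ Y₂ Y₃ Y₄) :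
    ∃ W₁ W₂ W₄ : ℂ → Matrix (Fin 2) (Fin 2) ℂ,
      -- `W = Y φ^{-σ₃}`, without a jump on the imaginary axis, solves the LU problem
      PainleveTwo.SolvesLU s₁ s₃ c₁ c₃ t W₁ W₂ W₄ ∧
      (∀ z : ℂ, c₁ ≤ z.re → W₁ z = Y₁ z * PainleveTwo.phiConj s₁ s₃ z t) ∧
      (∀ z : ℂ, 0 < z.re → z.re ≤ c₁ → W₂ z = Y₂ z * PainleveTwo.phiConj s₁ s₃ z t) ∧
      (∀ z : ℂ, -c₃ ≤ z.re → z.re < 0 → W₂ z = Y₃ z * PainleveTwo.phiConj s₁ s₃ z t) ∧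
      (∀ z : ℂ, z.re ≤ -c₃ → W₄ z = Y₄ z * PainleveTwo.phiConj s₁ s₃ z t) ∧
      -- the integrals in both Malgrange forms converge
      PainleveTwo.LineIntegrable c₁
        (PainleveTwo.malgrangeDensity Y₁ (PainleveTwo.F1 s₁ s₃) t) ∧
      PainleveTwo.LineIntegrable 0
        (PainleveTwo.malgrangeDensity Y₂ (PainleveTwo.F2 s₁ s₃) t) ∧
      PainleveTwo.LineIntegrable (-c₃)
        (PainleveTwo.malgrangeDensity Y₃ (PainleveTwo.F3 s₁ s₃) t) ∧
      PainleveTwo.LineIntegrable c₁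
        (PainleveTwo.malgrangeDensity W₁ (PainleveTwo.Ft1 s₁ s₃) t) ∧
      PainleveTwo.LineIntegrable (-c₃)
        (PainleveTwo.malgrangeDensity W₂ (PainleveTwo.Ft3 s₁ s₃) t) ∧
      -- the comparison
      ∀ ε : ℝ, 0 < ε → ε ≤ c₃ →
        (∀ z : ℂ, z.re = 0 →
          PainleveTwo.LineIntegrable (-ε) (PainleveTwo.innerDensity s₁ s₃ t z)) ∧
        PainleveTwo.LineIntegrable 0 (PainleveTwo.outerDensity s₁ s₃ ε t) ∧
        PainleveTwo.malgrangeLDU s₁ s₃ c₁ c₃ t Y₁ Y₂ Y₃ =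
          PainleveTwo.malgrangeLU s₁ s₃ c₁ c₃ t W₁ W₂ +
            2 * PainleveTwo.lineInt 0 (PainleveTwo.outerDensity s₁ s₃ ε t) := by
  have h : PainleveTwo.Admissible s₁ s₃ c₁ c₃ t :=
    ⟨hs₁, hs₃, hs, hc₁, hc₁', hc₃, hc₃', ht, hA⟩
  obtain ⟨W₂, hW, hWr, hWl⟩ := hY.exists_solvesLU h
  obtain ⟨i₁, i₃, heq⟩ := hY.malgrangeLDU_eq h hWl
  refine ⟨_, W₂, _, hW, fun z _ => rfl, fun z hz _ => hWr z hz, fun z _ hz => hWl z hz,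
    fun z _ => rfl, hY.lineIntegrable_F1 h, hY.lineIntegrable_F2 h, hY.lineIntegrable_F3 h, i₁, i₃,
    fun ε hε hε' => ?_⟩
  obtain ⟨e₁, e₂, e₃⟩ := h.outer_integral hε hε'
  exact ⟨e₁, e₂, by rw [e₃]; exact heq⟩
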